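/- **Theorem (correctness of the delegated VQA protocol).** *Setting.* A variational quantum algorithm on $n$ qubits with parameters $\theta\in\mathbb R^R$ is given by a circuit $U(\theta)$, which is a product of parametrized single-qubit gates $e^{-i\theta_r H}$ ($H$ Hermitian), unparametrized single-qubit unitaries, and gates of the set $\{X,Z,P,H,T,\mathrm{CNOT}\}$; by unit input vectors $|\psi_k\rangle$, Pauli observables $O_k\in\{I,X,Y,Z\}^{\otimes n}$ and functions $f_k:\mathbb R\to\mathbb R$ ($1\le k\le K$); the cost function is $C(\theta)=\sum_k f_k(\langle\psi_k|U(\theta)^\dagger O_kU(\theta)|\psi_k\rangle)$. Training consists of $T$ iterations; in each, $E$ circuits are executed and measured (each with parameters, input and observable chosen as a function of the current parameters), and a classical optimizer computes the new parameters from the current ones and the $E$ results. *The delegated protocol.* Client and server replace every parametrized or unparametrized single-qubit unitary by the output of the Solovay–Kitaev algorithm over $\{X,Z,P,H,T\}$ with recursion depth $d$ and basic approximations of length at most $l$. Let $L$ be the number of $T$ gates of the resulting sequence. The client generates keys $(pk_i,sk_i,evk_i)_{0\le i\le L}$ of a classical homomorphic encryption scheme (HE, decrypting every homomorphic evaluation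 correctly), encrypts the input with $\bigotimes_w X^{a_w}Z^{b_w}$, and encrypts the bits $a_w,b_w$ with $pk_0$. For each $i<L$ a gadget for the $i$-th $T$ gate is made: its qubits are prepared remotely in states $|{+_\theta}\rangle$, $\theta\in\{0,\frac\pi2,\pi,\frac{3\pi}2\}$, by means of a two-regular trapdoor function family; the server couples them in pairs by a CZ gate followed by $H$ on the first qubit, which gives pairs $X^{x}Z^{z}(P^\dagger)^{p}|\Phi^+\rangle$ with $|\Phi^+\rangle=(|00\rangle+|11\rangle)/\sqrt2$; the pairing and the bits $p$ are determined by $sk_i$ through a permutation branching program that computes $\mathsf{HE.Dec}$ (run forward, then $P^\dagger$ where it accepts, then run backward); and the client encrypts the pairing, $p$, $sk_i$, $x$, $z$ with $pk_{i+1}$. The server applies the gates to the encrypted state. It updates the encrypted Pauli keys homomorphically at Clifford gates. At each $T$ gate it makes the Bell measurements prescribed by the branching program and the encrypted key $\tilde a_w$ of the wire, and computes the new keys, encrypted with $pk_{i+1}$, homomorphically from the results and the encrypted description of the gadget. It finally measures $O_k$; the client decrypts the Pauli keys and flips the result if $O_k$ anticommutes with $\bigotimes_w X^{a'_w}Z^{b'_w}$.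 *Claim.* There are $l_0\in\mathbb N$ and a strictly decreasing sequence $(\varepsilon_d)_{d\ge0}$ of reals, with $9^{jd}\varepsilon_d\to0$ for every $j\in\mathbb N$, such that the following hold for every $l\ge l_0$, every VQA as above, every choice of HE scheme, branching program and trapdoor function family, every security parameter, every $d$, and every possible outcome of an honestly executed preparation phase (keys, ciphertexts, Pauli keys, results of the remote state preparations), probabilities being conditional on that outcome. 1. For every single-qubit unitary $V$ the Solovay–Kitaev algorithm outputs a word of length at most $l\,9^d$ whose matrix is within $\varepsilon_d$ of $V$ in operator norm, up to a global phase. (So the accuracy is negligible in the length.) 2. For every gate sequence over $\{X,Z,P,H,T,\mathrm{CNOT}\}$, every input vector and every Pauli observable, the client's decrypted result of the delegated execution has exactly the law of the result of measuring the observable after applying the sequence to the unencrypted input. 3. For every $\theta$ and $k$, and each of the two results, the probability that the client obtains it in the delegated execution of $U(\theta)$ differs from the probability of obtaining it by measuring $O_k$ on $U(\theta)|\psi_k\rangle$ by at most $2N\varepsilon_d$, where $N$ is the number of single-qubit unitaries in $U(\theta)$ that are decomposed. 4. If all $f_k$ are continuous, then for every $\theta$ the cost function computed from the client's expectation values converges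 to $C(\theta)$ as $d\to\infty$, uniformly in the encryption scheme, branching program, function family, security parameter and preparation. 5. For every training procedure and every event, the probability of the event under the law of the client's decrypted results of the whole delegated training differs from its probability when the same training is carried out directly with the exact circuits $U(\theta)$ by at most $TE\cdot 2N\varepsilon_d$. In particular this holds for the event that the trained parameters lie in any given subset of $\mathbb R^R$. -/

import Mathlib

open Filter

namespace DVQA

noncomputable section

/-! ## Qubit registers, gates, Pauli observables -/

/-- Vectors (not necessarily normalised) of the register of qubits labelled by `ι`, given by their
amplitudes in the computational basis. -/
abbrev Ket (ι : Type) : Type := (ι → Bool) → ℂ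

/-- The squared norm. -/
def normSq {B : Type} [Fintype B] (φ : B → ℂ) : ℝ := ∑ x, ‖φ x‖ ^ 2

/-- The normalised vector. -/
def normalized {B : Type} [Fintype B] (φ : B → ℂ) : B → ℂ :=
  fun x => φ x / ((Real.sqrt (normSq φ) : ℝ) : ℂ)

/-- `(-1) ^ b`. -/
def sgn (b : Bool) : ℂ := if b then -1 else 1

/-- `1 / √2`. -/
def rsqrt2 : ℂ := ((1 / Real.sqrt 2 : ℝ) : ℂ)

/-- The single-qubit gates of the discrete gate set. -/
inductive Gate1 where
  | X | Z | P | H | T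
  deriving DecidableEq

instance : Fintype Gate1 := ⟨{.X, .Z, .P, .H, .T}, by intro g; cases g <;> decide⟩

/-- A diagonal single-qubit matrix with top left entry `1`. -/
def phaseMat (c : ℂ) : Matrix Bool Bool ℂ :=
  Matrix.diagonal (fun b => if b then c else 1)

/-- The matrix of a single-qubit gate. -/
def Gate1.mat : Gate1 → Matrix Bool Bool ℂ
  | .X => Matrix.of fun c d => if c = !d then 1 else 0
  | .Z => phaseMat (-1)
  | .P => phaseMat Complex.I
  | .H => Matrix.of fun c d => rsqrt2 * sgn (c && d)
  | .T => phaseMat (Complex.exp (Complex.I * (Real.pi / 4 : ℝ)))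

/-- Apply a single-qubit matrix to qubit `w`. -/
def apply1 {ι : Type} [DecidableEq ι] (M : Matrix Bool Bool ℂ) (w : ι) (φ : Ket ι) : Ket ι :=
  fun x => ∑ b, M (x w) b * φ (Function.update x w b)

/-- Apply a CNOT gate with control `c` and target `t`. -/
def applyCNOT {ι : Type} [DecidableEq ι] (c t : ι) (φ : Ket ι) : Ket ι :=
  fun x => φ (Function.update x t (xor (x t) (x c)))

/-- Gates of the set `{X, Z, P, H, T, CNOT}` placed on the wires of an `n`-qubit register. -/
inductive Gate (n : ℕ) where
  | one (g : Gate1) (w : Fin n)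
  | cnot (c t : Fin n) (h : c ≠ t)

/-- The action of a gate. -/
def Gate.apply {n : ℕ} : Gate n → Ket (Fin n) → Ket (Fin n)
  | .one g w => apply1 g.mat w
  | .cnot c t _ => applyCNOT c t

/-- The action of a sequence of gates; the head of the list is applied first. -/
def applyGates {n : ℕ} : List (Gate n) → Ket (Fin n) → Ket (Fin n)
  | [], φ => φ
  | g :: gs, φ => applyGates gs (g.apply φ)

/-- Is the gate a `T` gate? -/
def Gate.isT {n : ℕ} : Gate n → Bool
  | .one .T _ => true
  | _ => false

/-- The number `L` of `T` gates. -/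
def tCount {n : ℕ} (gs : List (Gate n)) : ℕ := gs.countP Gate.isT

/-- The encryption operator `⊗ X^{a_w} Z^{b_w}` (quantum one-time pad). -/
def oneTimePad {n : ℕ} (a b : Fin n → Bool) (φ : Ket (Fin n)) : Ket (Fin n) :=
  fun x => (∏ w, sgn (b w && xor (x w) (a w))) * φ (fun w => xor (x w) (a w))

/-- Single-qubit Pauli observables. -/
inductive Pauli where
  | I | X | Y | Z

/-- The matrix of a single-qubit Pauli observable. -/
def Pauli.mat : Pauli → Matrix Bool Bool ℂ
  | .I => 1
  | .X => Gate1.X.mat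
  | .Y => Complex.I • (Gate1.X.mat * Gate1.Z.mat)
  | .Z => Gate1.Z.mat

/-- The action of the Pauli operator `⊗ O_w`. -/
def applyPauli {n : ℕ} (O : Fin n → Pauli) (φ : Ket (Fin n)) : Ket (Fin n) :=
  fun x => ∑ y : Fin n → Bool, (∏ w, (O w).mat (x w) (y w)) * φ y

/-- Born probability that the projective measurement of the observable `O` has the result
`(-1) ^ s`. -/
def measProb {n : ℕ} (O : Fin n → Pauli) (φ : Ket (Fin n)) (s : Bool) : ℝ :=
  normSq (fun x => (φ x + sgn s * applyPauli O φ x) / 2)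

/-- The expectation value `⟨φ|O|φ⟩ = Tr[O |φ⟩⟨φ|]`. -/
def expect {n : ℕ} (O : Fin n → Pauli) (φ : Ket (Fin n)) : ℝ :=
  (∑ x, star (φ x) * applyPauli O φ x).re

/-- Does `O` anticommute with `X^a Z^b`? -/
def Pauli.flip (O : Pauli) (a b : Bool) : Bool :=
  match O with
  | .I => false
  | .X => b
  | .Y => xor a b
  | .Z => a

/-- Must the result of measuring `O` on a state encrypted with the Pauli keys `a, b` be flipped? -/
def flipBit {n : ℕ} (O : Fin n → Pauli) (a b : Fin n → Bool) : Bool :=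
  ((List.finRange n).map fun w => (O w).flip (a w) (b w)).foldr xor false

/-! ## The Solovay-Kitaev algorithm over `{X, Z, P, H, T}` -/

/-- The matrix of a word in the gates; the head of the list is applied first. -/
def wordMat : List Gate1 → Matrix Bool Bool ℂ
  | [] => 1
  | g :: gs => wordMat gs * g.mat

/-- A word for the inverse of a gate: `P† = Z P` and `T† = Z P T`. -/
def Gate1.inv : Gate1 → List Gate1
  | .X => [.X]
  | .Z => [.Z]
  | .P => [.P, .Z]
  | .H => [.H]
  | .T => [.T, .P, .Z]

/-- A word for the inverse of a word. -/
def wordInv (u : List Gate1) : List Gate1 := u.reverse.flatMap Gate1.inv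

/-- The operator-norm distance of two single-qubit unitaries modulo a global phase. -/
def phaseDist (U V : Matrix Bool Bool ℂ) : ℝ :=
  Real.sqrt (2 - ‖(U.conjTranspose * V).trace‖)

theorem exists_nearest (l : ℕ) (U : Matrix Bool Bool ℂ) :
    ∃ u : List Gate1, u.length ≤ l ∧
      ∀ v : List Gate1, v.length ≤ l → phaseDist (wordMat u) U ≤ phaseDist (wordMat v) U := by
  have hfin : {u : List Gate1 | u.length ≤ l}.Finite := List.finite_length_le Gate1 l
  obtain ⟨u, hu, hmin⟩ := Set.exists_min_image _ (fun u => phaseDist (wordMat u) U) hfin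
    ⟨[], by simp⟩
  exact ⟨u, hu, fun v hv => hmin v hv⟩

/-- The basic approximation: a nearest word among those of length at most `l`. -/
def baseApprox (l : ℕ) (U : Matrix Bool Bool ℂ) : List Gate1 := (exists_nearest l U).choose

/-- `(V, W)` is a balanced group commutator decomposition of `D`: up to a global phase
`D = V W V† W†`, with `V` and `W` within the square root of the distance of `D` from `1`. -/
def IsBalancedCommutator (D : Matrix Bool Bool ℂ)
    (VW : Matrix Bool Bool ℂ × Matrix Bool Bool ℂ) : Prop :=
  VW.1 ∈ Matrix.unitaryGroup Bool ℂ ∧ VW.2 ∈ Matrix.unitaryGroup Bool ℂ ∧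
    (∃ c : ℂ, ‖c‖ = 1 ∧
      D = c • (VW.1 * VW.2 * VW.1.conjTranspose * VW.2.conjTranspose)) ∧
    phaseDist VW.1 1 ≤ Real.sqrt (phaseDist D 1) ∧ phaseDist VW.2 1 ≤ Real.sqrt (phaseDist D 1)

open Classical in
/-- Group commutator decomposition (used for `D` close to `1`, where one exists). -/
def gcDecompose (D : Matrix Bool Bool ℂ) : Matrix Bool Bool ℂ × Matrix Bool Bool ℂ :=
  if h : ∃ VW, IsBalancedCommutator D VW then h.choose else (1, 1)

/-- The Solovay-Kitaev algorithm with recursion depth `d` and basic approximations of length at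
most `l`. -/
def solovayKitaev (l : ℕ) : ℕ → Matrix Bool Bool ℂ → List Gate1
  | 0, U => baseApprox l U
  | d + 1, U =>
    let u := solovayKitaev l d U
    let VW := gcDecompose (U * (wordMat u).conjTranspose)
    let v := solovayKitaev l d VW.1
    let w := solovayKitaev l d VW.2
    -- the matrix of this word is `v w v† w† u`
    u ++ wordInv w ++ wordInv v ++ w ++ v

/-! ## Variational quantum algorithms -/

/-- Factors of an ansatz circuit on `n` qubits with `R` parameters: a parametrised single-qubit
gate `exp (- i θ_r H)` on wire `w`, an unparametrised single-qubit unitary on wire `w`, or a gate of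
the discrete gate set. -/
inductive AnsatzGate (n R : ℕ) where
  | rot (w : Fin n) (r : Fin R) (H : Matrix Bool Bool ℂ) (hH : H.IsHermitian)
  | unitary (w : Fin n) (W : Matrix Bool Bool ℂ) (hW : W ∈ Matrix.unitaryGroup Bool ℂ)
  | gate (g : Gate n)

/-- `exp (- i θ H)`. -/
def rotMat (H : Matrix Bool Bool ℂ) (t : ℝ) : Matrix Bool Bool ℂ :=
  NormedSpace.exp ((-Complex.I * (t : ℂ)) • H)

/-- The exact action of a factor. -/
def AnsatzGate.apply {n R : ℕ} (θ : Fin R → ℝ) : AnsatzGate n R → Ket (Fin n) → Ket (Fin n)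
  | .rot w r H _ => apply1 (rotMat H (θ r)) w
  | .unitary w W _ => apply1 W w
  | .gate g => g.apply

/-- The exact action of `U(θ)`; the head of the list is applied first. -/
def applyAnsatz {n R : ℕ} (θ : Fin R → ℝ) :
    List (AnsatzGate n R) → Ket (Fin n) → Ket (Fin n)
  | [], φ => φ
  | g :: gs, φ => applyAnsatz θ gs (g.apply θ φ)

/-- The gate sequence into which a factor is decomposed. -/
def AnsatzGate.decompose {n R : ℕ} (l d : ℕ) (θ : Fin R → ℝ) :
    AnsatzGate n R → List (Gate n)
  | .rot w r H _ => (solovayKitaev l d (rotMat H (θ r))).map fun g => Gate.one g w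
  | .unitary w W _ => (solovayKitaev l d W).map fun g => Gate.one g w
  | .gate g => [g]

/-- The gate sequence into which client and server decompose `U(θ)`. -/
def decompose {n R : ℕ} (l d : ℕ) (A : List (AnsatzGate n R)) (θ : Fin R → ℝ) :
    List (Gate n) :=
  A.flatMap fun g => g.decompose l d θ

/-- Is the factor decomposed by the Solovay-Kitaev algorithm? -/
def AnsatzGate.isApprox {n R : ℕ} : AnsatzGate n R → Bool
  | .gate _ => false
  | _ => true

/-- A variational quantum algorithm on `n` qubits with `R` parameters: the ansatz `U(θ)`, and for
each `k` an input state, a Pauli observable `O_k` and a function `f_k`. -/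
structure VQA (n R K : ℕ) where
  ansatz : List (AnsatzGate n R)
  input : Fin K → Ket (Fin n)
  input_norm : ∀ k, normSq (input k) = 1
  obs : Fin K → Fin n → Pauli
  f : Fin K → ℝ → ℝ

namespace VQA

variable {n R K : ℕ} (Q : VQA n R K)

/-- The number of Solovay-Kitaev decompositions. -/
def numApprox : ℕ := Q.ansatz.countP AnsatzGate.isApprox

/-- The output state `U(θ) |ψ_k⟩`. -/
def output (θ : Fin R → ℝ) (k : Fin K) : Ket (Fin n) := applyAnsatz θ Q.ansatz (Q.input k)

/-- The probability of the result `(-1) ^ s` when `O_k` is measured on `U(θ) |ψ_k⟩`. -/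
def prob (θ : Fin R → ℝ) (k : Fin K) (s : Bool) : ℝ := measProb (Q.obs k) (Q.output θ k) s

/-- The cost function `C(θ) = ∑_k f_k (Tr[O_k U(θ) ρ_k U(θ)†])`. -/
def cost (θ : Fin R → ℝ) : ℝ := ∑ k, Q.f k (expect (Q.obs k) (Q.output θ k))

end VQA

/-- The classical part of the training: in each of `T` iterations the circuit is executed `E` times,
the execution `e` being made with the parameters and the pair of input and observable `query t θ e`
(for instance shifted parameters `θ ± α e_r`, each with many repetitions), and then the optimiser
computes the new parameters from the current ones and the `E` measurement results (for instance by a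
gradient step with a learning rate). -/
structure Training (R K T E : ℕ) where
  init : Fin R → ℝ
  query : Fin T → (Fin R → ℝ) → Fin E → (Fin R → ℝ) × Fin K
  update : Fin T → (Fin R → ℝ) → (Fin E → Bool) → (Fin R → ℝ)

namespace Training

variable {R K T E : ℕ} (τ : Training R K T E)

/-- The parameters after `t` iterations, if the measurement results are `r`. -/
def params (r : Fin T → Fin E → Bool) : ℕ → Fin R → ℝ
  | 0 => τ.init
  | t + 1 => if h : t < T then τ.update ⟨t, h⟩ (params r t) (r ⟨t, h⟩) else params r t

/-- The output of the training: the parameters after the last iteration. -/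
def trained (r : Fin T → Fin E → Bool) : Fin R → ℝ := τ.params r T

open Classical in
/-- The probability that the measurement results of the whole training lie in `S`, when `p t e θ s`
is the probability of the result `s` in execution `e` of iteration `t`, whose current parameters
are `θ`. -/
def prob (p : Fin T → Fin E → (Fin R → ℝ) → Bool → ℝ) (S : Set (Fin T → Fin E → Bool)) : ℝ :=
  ∑ r : Fin T → Fin E → Bool,
    if r ∈ S then ∏ t : Fin T, ∏ e : Fin E, p t e (τ.params r t) (r t e) else 0

end Training

/-! ## Classical homomorphic encryption -/

/-- A classical homomorphic encryption scheme for bits; secret keys are bit strings. -/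
structure CHE where
  PK : Type
  EVK : Type
  CT : Type
  skLen : ℕ → ℕ
  keyGen : (κ : ℕ) → PMF (PK × (Fin (skLen κ) → Bool) × EVK)
  enc : PK → Bool → PMF CT
  eval : EVK → {ι : Type} → [Fintype ι] → ((ι → Bool) → Bool) → (ι → CT) → CT
  dec : {κ : ℕ} → (Fin (skLen κ) → Bool) → CT → Bool

/-- `HE.Encrypts pk evk c x`: the ciphertext `c` arises from fresh encryptions by homomorphic
evaluations, and the same evaluations in the clear give the plaintext `x`. -/
inductive CHE.Encrypts (HE : CHE) (pk : HE.PK) (evk : HE.EVK) : HE.CT → Bool → Prop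
  | fresh (x : Bool) (c : HE.CT) (h : c ∈ (HE.enc pk x).support) : HE.Encrypts pk evk c x
  | eval {ι : Type} [Fintype ι] (C : (ι → Bool) → Bool) (c : ι → HE.CT) (x : ι → Bool)
      (h : ∀ i, HE.Encrypts pk evk (c i) (x i)) : HE.Encrypts pk evk (HE.eval evk C c) (C x)

/-- Decryption recovers the result of every homomorphic computation. -/
def CHE.Correct (HE : CHE) : Prop :=
  ∀ (κ : ℕ) (pk : HE.PK) (sk : Fin (HE.skLen κ) → Bool) (evk : HE.EVK),
    (pk, sk, evk) ∈ (HE.keyGen κ).support →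
      ∀ (c : HE.CT) (x : Bool), HE.Encrypts pk evk c x → HE.dec sk c = x

/-- A permutation branching program of length `len` on two inputs, alternately reading the first
input (through `cl`) and the second (through `sv`). -/
structure PBP (S C : Type) where
  len : ℕ
  width : ℕ
  cl : ℕ → S → Equiv.Perm (Fin width)
  sv : ℕ → C → Equiv.Perm (Fin width)
  start : Fin width
  accept : Fin width → Bool

namespace PBP

variable {S C : Type} (A : PBP S C)

/-- The state after `k` layers. -/
def state (s : S) (c : C) : ℕ → Fin A.width
  | 0 => A.start
  | k + 1 => A.sv k c (A.cl k s (state s c k))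

/-- The value that the program computes. -/
def run (s : S) (c : C) : Bool := A.accept (A.state s c A.len)

/-! ### The gadget structure (`pairs`, `p`) and the measurement pattern

The gadget runs the program forward, has one block whose pipes carry `P†` where the program
accepts, and runs the program backward, so that the qubit leaves at a known place. -/

/-- Labels of the first halves, and likewise of the second halves, of the Bell pairs of the gadget:
(block, pipe). Pairs are labelled by their first halves. -/
abbrev Label : Type := Fin (2 * A.len + 1) × Fin A.width

/-- In block `j`, first half `(j, i)` is paired with second half `(j, A.clientPerm s j i)`. -/
def clientPerm (s : S) (j : ℕ) : Equiv.Perm (Fin A.width) :=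
  if j < A.len then A.cl j s
  else if j = A.len then 1
  else (A.cl (2 * A.len - j) s)⁻¹

/-- The second half of a pair. -/
def mate (s : S) (q : A.Label) : A.Label := (q.1, A.clientPerm s q.1 q.2)

/-- The bit `p` of a pair. -/
def pBit (q : A.Label) : Bool := decide ((q.1 : ℕ) = A.len) && A.accept q.2

/-- The server joins second half `(j, i)` to first half `(j + 1, A.serverPerm c j i)`. -/
def serverPerm (c : C) (j : ℕ) : Equiv.Perm (Fin A.width) :=
  if j < A.len then A.sv j c else (A.sv (2 * A.len - 1 - j) c)⁻¹

/-- The place at which the qubit leaves the gadget (a second half). -/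
def exit : A.Label := (Fin.last _, A.start)

/-- `GenMeasurement`: the qubit measured in the Bell basis together with the first half `q`; it is
the input qubit (`none`) or a second half. -/
def partner (c : C) (q : A.Label) : Option A.Label :=
  if (q.1 : ℕ) = 0 then
    if q.2 = A.start then none else some (Fin.last _, q.2)
  else
    some (⟨(q.1 : ℕ) - 1, by have := q.1.2; omega⟩,
      (A.serverPerm c ((q.1 : ℕ) - 1)).symm q.2)

end PBP

/-! ## Generating gadgets with a classical client -/

/-- A two-regular trapdoor function family. The input has `inLen κ + 1` bits, the last one being
singled out; `inv` returns the two preimages of a point of the range. -/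
structure TrapdoorFamily where
  Key : Type
  Trapdoor : Type
  inLen : ℕ → ℕ
  outLen : ℕ → ℕ
  gen : (κ : ℕ) → PMF (Key × Trapdoor)
  f : (κ : ℕ) → Key → (Fin (inLen κ) → Bool) × Bool → (Fin (outLen κ) → Bool)
  inv : (κ : ℕ) → Trapdoor → (Fin (outLen κ) → Bool) →
    ((Fin (inLen κ) → Bool) × Bool) × ((Fin (inLen κ) → Bool) × Bool)
  inv_spec : ∀ κ k t, (k, t) ∈ (gen κ).support → ∀ y ∈ Set.range (f κ k),
    (inv κ t y).1 ≠ (inv κ t y).2 ∧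
      ∀ x, f κ k x = y ↔ x = (inv κ t y).1 ∨ x = (inv κ t y).2

/-- The classical data of one execution of the remote preparation of a qubit: the function and its
trapdoor, the client's string `α`, and the server's measurement results `y` and `b`. -/
structure Remote (F : TrapdoorFamily) (κ : ℕ) where
  key : F.Key
  trapdoor : F.Trapdoor
  α : Fin (F.inLen κ) → Bool
  y : Fin (F.outLen κ) → Bool
  b : Fin (F.inLen κ) → Bool

namespace Remote

variable {F : TrapdoorFamily} {κ : ℕ} (ρ : Remote F κ)

/-- The two registers `|+⟩ ⊗ |0⟩`. -/
def initial (F : TrapdoorFamily) (κ : ℕ) :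
    ((Fin (F.inLen κ) → Bool) × Bool) × (Fin (F.outLen κ) → Bool) → ℂ :=
  fun z => if z.2 = (fun _ => false) then rsqrt2 ^ (F.inLen κ + 1) else 0

/-- The state after `|x⟩|y⟩ ↦ |x⟩|y ⊕ f x⟩`. -/
def afterOracle : ((Fin (F.inLen κ) → Bool) × Bool) × (Fin (F.outLen κ) → Bool) → ℂ :=
  fun z => initial F κ (z.1, fun j => xor (z.2 j) (F.f κ ρ.key z.1 j))

/-- Amplitudes of the basis vector `(|0⟩ ± e^{i α π / 2} |1⟩) / √2`. -/
def basisAmp (α b x : Bool) : ℂ :=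
  rsqrt2 * (if x then sgn b * (if α then Complex.I else 1) else 1)

/-- The (unnormalised) state of the last qubit after the second register gave `y` in the
computational basis and the other qubits of the first gave `b` in the bases determined by `α`. -/
def lastQubit : Bool → ℂ :=
  fun c => ∑ x : Fin (F.inLen κ) → Bool,
    (∏ i, star (basisAmp (ρ.α i) (ρ.b i) (x i))) * ρ.afterOracle ((x, c), ρ.y)

/-- The qubit held by the server at the end. -/
def qubit : Bool → ℂ := normalized ρ.lastQubit

/-- The execution is possible and not aborted: `y` is in the range, and the last bits of its two
preimages differ. -/
def Ok : Prop :=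
  (ρ.key, ρ.trapdoor) ∈ (F.gen κ).support ∧ ρ.y ∈ Set.range (F.f κ ρ.key) ∧
    (F.inv κ ρ.trapdoor ρ.y).1.2 ≠ (F.inv κ ρ.trapdoor ρ.y).2.2

/-- A bit as a residue. -/
def res (b : Bool) : ZMod 4 := if b then 1 else 0

/-- The angle computed by the client, in units of `π / 2`. -/
def angle : ZMod 4 :=
  let x := (F.inv κ ρ.trapdoor ρ.y).1
  let x' := (F.inv κ ρ.trapdoor ρ.y).2
  (if x.2 then -1 else 1) * ∑ i, (res (x.1 i) - res (x'.1 i)) * (2 * res (ρ.b i) + res (ρ.α i))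

/-- Is the angle `π / 2` or `3 π / 2`? -/
def odd : Bool := decide (ρ.angle = 1 ∨ ρ.angle = 3)

end Remote

/-- The two-qubit state made by the server from the qubits `u` and `v`: a CZ gate followed by a
Hadamard gate on the first qubit. -/
def couple (u v : Bool → ℂ) : Bool → Bool → ℂ :=
  fun c d => ∑ c', Gate1.H.mat c c' * (sgn (c' && d) * (u c' * v d))

/-- The Bell basis vector `(X^u Z^v ⊗ I) (|00⟩ + |11⟩) / √2`. -/
def bell (o : Bool × Bool) : Bool → Bool → ℂ :=
  fun c d => if c = xor d o.1 then rsqrt2 * sgn (o.2 && d) else 0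

/-! ## The protocol -/

/-- The bits of the classical description of a gadget: of the secret key, of the pairing, of `p`,
and of the Pauli keys `x` and `z` of the pairs. -/
inductive GBit (k : ℕ) (j w : ℕ) where
  | sk (i : Fin k)
  | pair (b : Fin j) (i i' : Fin w)
  | p (q : Fin j × Fin w)
  | x (q : Fin j × Fin w)
  | z (q : Fin j × Fin w)
  deriving DecidableEq, Fintype

/-- The public ingredients: a homomorphic encryption scheme, a permutation branching program for its
decryption, and a trapdoor function family. -/
structure Setup where
  HE : CHE
  prog : (κ : ℕ) → PBP (Fin (HE.skLen κ) → Bool) HE.CT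
  fam : TrapdoorFamily

/-- The encryption scheme is correct, and the program computes its decryption function. -/
def Setup.Correct (Ω : Setup) : Prop :=
  Ω.HE.Correct ∧
    ∀ κ (sk : Fin (Ω.HE.skLen κ) → Bool) (c : Ω.HE.CT),
      (Ω.prog κ).run sk c = Ω.HE.dec sk c

namespace Setup

variable (Ω : Setup) (κ : ℕ)

/-- Labels of the pairs of a gadget. -/
abbrev Label : Type := (Ω.prog κ).Label

/-- Bits of the classical description of a gadget. -/
abbrev GBits : Type :=
  GBit (Ω.HE.skLen κ) (2 * (Ω.prog κ).len + 1) (Ω.prog κ).width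

end Setup

/-- All choices of the client and all results of the remote state preparations in the preparation of
one execution of the circuit: the keys `(pk_i, sk_i, evk_i)`, the Pauli keys and their encryptions,
and for the `i`-th gadget the preparations of its qubits and the encryption of its description. -/
structure Prep (Ω : Setup) (κ n : ℕ) where
  key : ℕ → Ω.HE.PK × (Fin (Ω.HE.skLen κ) → Bool) × Ω.HE.EVK
  a : Fin n → Bool
  b : Fin n → Bool
  encA : Fin n → Ω.HE.CT
  encB : Fin n → Ω.HE.CT
  fstQubit : ℕ → Ω.Label κ → Remote Ω.fam κ
  sndQubit : ℕ → Ω.Label κ → Remote Ω.fam κ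
  encG : ℕ → Ω.GBits κ → Ω.HE.CT

namespace Prep

variable {Ω : Setup} {κ n : ℕ} (π : Prep Ω κ n)

/-- The public key `pk_i`. -/
def pk (i : ℕ) : Ω.HE.PK := (π.key i).1

/-- The secret key `sk_i`. -/
def sk (i : ℕ) : Fin (Ω.HE.skLen κ) → Bool := (π.key i).2.1

/-- The evaluation key `evk_i`. -/
def evk (i : ℕ) : Ω.HE.EVK := (π.key i).2.2

/-- The preparation of the second half of pair `q` of gadget `i`. -/
def snd (i : ℕ) (q : Ω.Label κ) : Remote Ω.fam κ :=
  π.sndQubit i ((Ω.prog κ).mate (π.sk i) q)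

/-- The Pauli key `x[q]` of gadget `i`. -/
def xBit (i : ℕ) (q : Ω.Label κ) : Bool := decide ((π.fstQubit i q).angle = 2)

/-- The Pauli key `z[q]` of gadget `i`. -/
def zBit (i : ℕ) (q : Ω.Label κ) : Bool :=
  decide ((π.snd i q).angle = 2 ∨ (π.snd i q).angle = 1)

/-- The classical description `g(sk_i)`, `x`, `z` of gadget `i`. -/
def gBits (i : ℕ) : Ω.GBits κ → Bool
  | .sk k => π.sk i k
  | .pair b j j' => decide (j' = (Ω.prog κ).clientPerm (π.sk i) b j)
  | .p q => (Ω.prog κ).pBit q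
  | .x q => π.xBit i q
  | .z q => π.zBit i q

/-- The state of the qubits of gadget `i` (first halves, second halves). -/
def gadget (i : ℕ) (u v : Ω.Label κ → Bool) : ℂ :=
  ∏ q, couple (π.fstQubit i q).qubit (π.snd i q).qubit (u q)
    (v ((Ω.prog κ).mate (π.sk i) q))

/-- The preparation phase with `L` gadgets and the encryption of the Pauli keys were carried out
honestly: keys and ciphertexts are possible outputs of their algorithms, all remote preparations
succeeded, and the client assigned the prepared qubits to the pairs such that each pair has the
bit `p` it should have. -/
structure Honest (L : ℕ) : Prop where
  key_mem : ∀ i ≤ L, π.key i ∈ (Ω.HE.keyGen κ).support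
  encA_mem : ∀ w, π.encA w ∈ (Ω.HE.enc (π.pk 0) (π.a w)).support
  encB_mem : ∀ w, π.encB w ∈ (Ω.HE.enc (π.pk 0) (π.b w)).support
  fst_ok : ∀ i < L, ∀ q, (π.fstQubit i q).Ok
  snd_ok : ∀ i < L, ∀ q, (π.sndQubit i q).Ok
  fst_even : ∀ i < L, ∀ q, (π.fstQubit i q).odd = false
  snd_odd : ∀ i < L, ∀ q, (π.snd i q).odd = (Ω.prog κ).pBit q
  encG_mem : ∀ i < L, ∀ g, π.encG i g ∈ (Ω.HE.enc (π.pk (i + 1)) (π.gBits i g)).support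

/-- The Bell measurements of the server for the `i`-th `T` gate, on wire `w`: the (unnormalised)
state after the results `o`, if `φ` is the state before and `c` the encrypted key of wire `w`.
The qubit that leaves the gadget becomes wire `w`. -/
def teleport (i : ℕ) (w : Fin n) (c : Ω.HE.CT) (o : Ω.Label κ → Bool × Bool)
    (φ : Ket (Fin n)) : Ket (Fin n) :=
  fun x => ∑ e : Bool, ∑ u : Ω.Label κ → Bool, ∑ v : Ω.Label κ → Bool,
    if v (Ω.prog κ).exit = x w then
      (∏ q, star (bell (o q) (((Ω.prog κ).partner c q).elim e v) (u q))) *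
        π.gadget i u v * φ (Function.update x w e)
    else 0

end Prep

/-- The new Pauli keys of a qubit with keys `a, b` after a `T` gate and its gadget: the qubit is
followed through the blocks of the gadget (`c` is the encrypted key used for the Bell measurements,
`o` are their results, `g` is the description of the gadget). -/
def gadgetKeys {Ω : Setup} {κ : ℕ} (c : Ω.HE.CT) (o : Ω.Label κ → Bool × Bool)
    (g : Ω.GBits κ → Bool) (a b : Bool) : Bool × Bool :=
  let A := Ω.prog κ
  let step : Fin A.width × Bool × Bool → Fin (2 * A.len + 1) → Fin A.width × Bool × Bool :=
    fun st j =>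
      let q : Fin (2 * A.len + 1) × Fin A.width := (j, st.1)
      let a' := xor st.2.1 (xor (g (.x q)) (o q).1)
      let b' := xor st.2.2 (xor (g (.z q)) (o q).2)
      let i' := ((List.finRange A.width).find? fun i' => g (.pair j st.1 i')).getD st.1
      (A.serverPerm c j i', a', xor b' (g (.p q) && a'))
  ((List.finRange (2 * A.len + 1)).foldl step (A.start, a, xor a b)).2

namespace Prep

variable {Ω : Setup} {κ n : ℕ} (π : Prep Ω κ n)

/-- Homomorphic addition of two encrypted bits with `evk_i`. -/
def addCT (i : ℕ) (c c' : Ω.HE.CT) : Ω.HE.CT :=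
  Ω.HE.eval (π.evk i) (fun x : Bool → Bool => xor (x false) (x true))
    (fun s => if s then c' else c)

/-- Homomorphic evaluation with `evk_{i+1}` on the encrypted description of gadget `i`. -/
def evalG (i : ℕ) (C : (Ω.GBits κ → Bool) → Bool) : Ω.HE.CT :=
  Ω.HE.eval (π.evk (i + 1)) C (π.encG i)

/-- The encrypted Pauli keys after the `i`-th `T` gate, on wire `w`, computed homomorphically: the
new keys of wire `w`, and the keys of the other wires, all encrypted with `pk_{i+1}`. -/
def newKeys (i : ℕ) (w : Fin n) (o : Ω.Label κ → Bool × Bool) (ca cb : Fin n → Ω.HE.CT) :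
    (Fin n → Ω.HE.CT) × (Fin n → Ω.HE.CT) :=
  let keys : Fin n → (Ω.GBits κ → Bool) → Bool × Bool := fun w' g =>
    let sk : Fin (Ω.HE.skLen κ) → Bool := fun k => g (.sk k)
    let a := Ω.HE.dec sk (ca w')
    let b := Ω.HE.dec sk (cb w')
    if w' = w then gadgetKeys (ca w) o g a b else (a, b)
  (fun w' => π.evalG i fun g => (keys w' g).1, fun w' => π.evalG i fun g => (keys w' g).2)

/-- The homomorphic evaluation of a gate sequence by the server: `i` gadgets have been used, `φ` is
the (unnormalised) state of the register, `ca, cb` are the encrypted Pauli keys. The weights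
`fin` at the end are added up over all results of the Bell measurements; a squared norm as weight
gives Born probabilities. -/
def evaluate (fin : ℕ → Ket (Fin n) → (Fin n → Ω.HE.CT) → (Fin n → Ω.HE.CT) → ℝ) :
    List (Gate n) → ℕ → Ket (Fin n) → (Fin n → Ω.HE.CT) → (Fin n → Ω.HE.CT) → ℝ
  | [], i, φ, ca, cb => fin i φ ca cb
  | .one .X w :: gs, i, φ, ca, cb => evaluate fin gs i ((Gate.one .X w).apply φ) ca cb
  | .one .Z w :: gs, i, φ, ca, cb => evaluate fin gs i ((Gate.one .Z w).apply φ) ca cb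
  | .one .P w :: gs, i, φ, ca, cb =>
    evaluate fin gs i ((Gate.one .P w).apply φ) ca
      (Function.update cb w (π.addCT i (ca w) (cb w)))
  | .one .H w :: gs, i, φ, ca, cb =>
    evaluate fin gs i ((Gate.one .H w).apply φ) (Function.update ca w (cb w))
      (Function.update cb w (ca w))
  | .cnot c t h :: gs, i, φ, ca, cb =>
    evaluate fin gs i ((Gate.cnot c t h).apply φ)
      (Function.update ca t (π.addCT i (ca c) (ca t)))
      (Function.update cb c (π.addCT i (cb c) (cb t)))
  | .one .T w :: gs, i, φ, ca, cb =>
    ∑ o : Ω.Label κ → Bool × Bool,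
      evaluate fin gs (i + 1) (π.teleport i w (ca w) o ((Gate.one .T w).apply φ))
        (π.newKeys i w o ca cb).1 (π.newKeys i w o ca cb).2

/-- The probability that the client, after decryption, has the result `(-1) ^ s` when the server
evaluates `gs` on the encrypted state `ψ` and measures `O`, given the preparation. -/
def delegatedProb (gs : List (Gate n)) (ψ : Ket (Fin n)) (O : Fin n → Pauli) (s : Bool) : ℝ :=
  π.evaluate
    (fun i φ ca cb => ∑ raw : Bool,
      if xor raw (flipBit O (fun w => Ω.HE.dec (π.sk i) (ca w))
        (fun w => Ω.HE.dec (π.sk i) (cb w))) = s then measProb O φ raw else 0)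
    gs 0 (oneTimePad π.a π.b ψ) π.encA π.encB

/-- The client's expectation value of the result. -/
def delegatedExpect (gs : List (Gate n)) (ψ : Ket (Fin n)) (O : Fin n → Pauli) : ℝ :=
  π.delegatedProb gs ψ O false - π.delegatedProb gs ψ O true

end Prep

namespace VQA

variable {n R K : ℕ} (Q : VQA n R K)

/-- The gate sequence into which `U(θ)` is decomposed. -/
def gates (l d : ℕ) (θ : Fin R → ℝ) : List (Gate n) := decompose l d Q.ansatz θ

/-- `π` is an honest preparation for the delegated execution of `U(θ)`. -/
def HonestPrep {Ω : Setup} {κ : ℕ} (l d : ℕ) (θ : Fin R → ℝ) (π : Prep Ω κ n) : Prop :=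
  π.Honest (tCount (Q.gates l d θ))

/-- The probability that the client has the result `(-1) ^ s` in the delegated execution of `U(θ)`
with input and observable number `k`. -/
def delegatedProb {Ω : Setup} {κ : ℕ} (l d : ℕ) (π : Prep Ω κ n) (θ : Fin R → ℝ) (k : Fin K)
    (s : Bool) : ℝ :=
  π.delegatedProb (Q.gates l d θ) (Q.input k) (Q.obs k) s

/-- The cost function computed from the client's results; `π k` is the preparation for `k`. -/
def delegatedCost {Ω : Setup} {κ : ℕ} (l d : ℕ) (π : Fin K → Prep Ω κ n) (θ : Fin R → ℝ) :
    ℝ :=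
  ∑ k, Q.f k ((π k).delegatedExpect (Q.gates l d θ) (Q.input k) (Q.obs k))

end VQA

/-- The law of the measurement results of the training on the exact circuits, not delegated. -/
def idealTraining {n R K T E : ℕ} (Q : VQA n R K) (τ : Training R K T E)
    (S : Set (Fin T → Fin E → Bool)) : ℝ :=
  τ.prob (fun t e θ s => Q.prob (τ.query t θ e).1 (τ.query t θ e).2 s) S

/-- The law of the client's decrypted results of the delegated training; `π t e θ` is the
preparation of execution `e` of iteration `t`, whose current parameters are `θ`. -/
def delegatedTraining {Ω : Setup} {κ n R K T E : ℕ} (Q : VQA n R K) (τ : Training R K T E)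
    (l d : ℕ) (π : Fin T → Fin E → (Fin R → ℝ) → Prep Ω κ n)
    (S : Set (Fin T → Fin E → Bool)) : ℝ :=
  τ.prob (fun t e θ s => Q.delegatedProb l d (π t e θ) (τ.query t θ e).1 (τ.query t θ e).2 s) S

end

end DVQA

open DVQA

namespace DVQA

noncomputable section

/-! ## Single-qubit matrices on a register -/

section Registers

variable {ι : Type} [DecidableEq ι]

/-! The theorem joins two independent facts: the encrypted execution of a discrete gate sequence is
exact, and the Solovay–Kitaev words are accurate.

Exactness. The invariant (`Honest.evaluate_eq`) is that the server's register is a scalar times the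
one-time pad of the correct intermediate state, and that the server's ciphertexts encrypt the pad
under the current key. A Clifford gate carries `X^a Z^b` to another Pauli, and the keys follow by
homomorphic xors. A `T` gate turns `X^a Z^b` into `X^a Z^(a+b) P^a`, and the gadget has to remove
`P^a` although `a` is known to the server only through a ciphertext. The client's and the server's
pairings join the Bell pairs into strands. The strand of the input qubit runs through the branching
program, meets `P†` in the middle block exactly when the program accepts, that is when the decrypted
bit `a` is true, and is then led back by the inverse permutations to its starting pipe. Every Bell
measurement along it contributes a known Pauli and a factor of modulus 1/2 (`hop_mul_padMat`,
`chain_mul_padMat`). The remaining strands close up, and each contributes only a trace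
(`teleport_eq`). The total weight of all Bell results is one because the four Bell results act as
the four Pauli matrices, an orthogonal basis (`sum_norm_loops`). Hence summing over the results
leaves the law of the unencrypted execution.

Accuracy. Up to a phase a single-qubit unitary is a unit quaternion. The word `T H T H T` is a
rotation by an angle incommensurable with `π`: otherwise twice its cosine would be an algebraic
integer, which would make 1/2 an integer. Its powers fill a circle, a conjugate word gives a
perpendicular axis, and Euler angles give density; compactness bounds the word length
(`exists_length_phaseDist_lt`). Commutators of unitaries near the identity are insensitive to errors
in their factors, so one recursion level improves the accuracy from `s ^ 2` to `10 * s ^ 3`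
(`solovayKitaev_step`). `skError` satisfies this recursion and decays doubly exponentially in the
depth.

Combination. Each replaced unitary moves the state by at most the accuracy, up to a phase, and a
measurement probability moves by at most twice the distance of the states (`abs_measProb_sub_le`).
In the training the parameters depend on earlier results, so the executions are not independent; a
hybrid argument shows that total variation distances still add up (`IsSequential.abs_sum_sub_le`).
-/

theorem apply1_mul (M N : Matrix Bool Bool ℂ) (w : ι) (φ : Ket ι) :
    apply1 (M * N) w φ = apply1 M w (apply1 N w φ) := by
  funext x
  simp only [apply1, Matrix.mul_apply, Fintype.sum_bool, Function.update_self,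
    Function.update_idem]
  ring

theorem apply1_smul (M : Matrix Bool Bool ℂ) (c : ℂ) (w : ι) (φ : Ket ι) :
    apply1 (c • M) w φ = c • apply1 M w φ := by
  funext x
  simp only [apply1, Matrix.smul_apply, Fintype.sum_bool, Pi.smul_apply, smul_eq_mul]
  ring

theorem apply1_smul_ket (M : Matrix Bool Bool ℂ) (c : ℂ) (w : ι) (φ : Ket ι) :
    apply1 M w (c • φ) = c • apply1 M w φ := by
  funext x
  simp only [apply1, Fintype.sum_bool, Pi.smul_apply, smul_eq_mul]
  ring

theorem apply1_one (w : ι) (φ : Ket ι) : apply1 1 w φ = φ := by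
  funext x
  cases h : x w <;> simp [apply1, Matrix.one_apply, h] <;> rw [← h, Function.update_eq_self]

theorem apply1_sub (M N : Matrix Bool Bool ℂ) (w : ι) (φ : Ket ι) :
    apply1 (M - N) w φ = apply1 M w φ - apply1 N w φ := by
  funext x
  simp only [apply1, Matrix.sub_apply, Fintype.sum_bool, Pi.sub_apply]
  ring

theorem apply1_sub_ket (M : Matrix Bool Bool ℂ) (w : ι) (φ ψ : Ket ι) :
    apply1 M w (φ - ψ) = apply1 M w φ - apply1 M w ψ := by
  funext x
  simp only [apply1, Fintype.sum_bool, Pi.sub_apply]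
  ring

end Registers

theorem Gate.apply_smul {n : ℕ} (g : Gate n) (c : ℂ) (φ : Ket (Fin n)) :
    g.apply (c • φ) = c • g.apply φ := by
  cases g with
  | one g w => exact apply1_smul_ket _ _ _ _
  | cnot => rfl

theorem sgn_xor (a b : Bool) : sgn (a ^^ b) = sgn a * sgn b := by
  cases a <;> cases b <;> simp [sgn]

theorem norm_sgn (a : Bool) : ‖sgn a‖ = 1 := by cases a <;> simp [sgn]

theorem rsqrt2_mul_self : rsqrt2 * rsqrt2 = 1 / 2 := by
  have : (1 / Real.sqrt 2) * (1 / Real.sqrt 2) = (1 / 2 : ℝ) := by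
    rw [div_mul_div_comm, Real.mul_self_sqrt (by norm_num)]; norm_num
  rw [rsqrt2, ← Complex.ofReal_mul, this]; norm_num

theorem star_rsqrt2 : star rsqrt2 = rsqrt2 := Complex.conj_ofReal _

theorem star_sgn (b : Bool) : star (sgn b) = sgn b := by cases b <;> simp [sgn]

/-! ## Squared norms -/

section NormSq

variable {B : Type} [Fintype B]

theorem normSq_nonneg (φ : B → ℂ) : 0 ≤ normSq φ := Finset.sum_nonneg fun _ _ => by positivity

theorem normSq_smul (c : ℂ) (φ : B → ℂ) : normSq (c • φ) = ‖c‖ ^ 2 * normSq φ := by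
  simp only [normSq, Pi.smul_apply, norm_smul, mul_pow, Finset.mul_sum]

theorem normSq_eq_norm_sq (φ : B → ℂ) : normSq φ = ‖WithLp.toLp 2 φ‖ ^ 2 := by
  rw [EuclideanSpace.norm_sq_eq]; rfl

end NormSq

/-! ## Pauli encryption -/

/-- The matrix of `X^a Z^b`. -/
def padMat (a b : Bool) : Matrix Bool Bool ℂ :=
  Matrix.of fun c d => if d = (c ^^ a) then sgn (b && d) else 0

/-- The bits of `x` xored with those of `a`. -/
def shift {ι : Type} (x a : ι → Bool) : ι → Bool := fun w => x w ^^ a w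

theorem shift_shift {ι : Type} (x a : ι → Bool) : shift (shift x a) a = x := by
  funext w; simp [shift]

theorem shift_comm {ι : Type} (x a b : ι → Bool) :
    shift (shift x a) b = shift (shift x b) a := by
  funext w; simp only [shift]; cases x w <;> cases a w <;> cases b w <;> rfl

/-- Xoring with a fixed string as an equivalence. -/
def shiftEquiv {ι : Type} (a : ι → Bool) : (ι → Bool) ≃ (ι → Bool) where
  toFun x := shift x a
  invFun x := shift x a
  left_inv x := shift_shift x a
  right_inv x := shift_shift x a

section Pad

variable {n : ℕ}

theorem oneTimePad_apply (a b : Fin n → Bool) (φ : Ket (Fin n)) (x : Fin n → Bool) :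
    oneTimePad a b φ x = (∏ w, sgn (b w && (x w ^^ a w))) * φ (shift x a) := rfl

theorem oneTimePad_smul (a b : Fin n → Bool) (c : ℂ) (φ : Ket (Fin n)) :
    oneTimePad a b (c • φ) = c • oneTimePad a b φ := by
  funext x
  simp only [oneTimePad_apply, Pi.smul_apply, smul_eq_mul]; ring

theorem norm_prod_sgn {ι : Type} [Fintype ι] (f : ι → Bool) : ‖∏ w, sgn (f w)‖ = 1 := by
  rw [norm_prod]; simp [norm_sgn]

theorem normSq_oneTimePad (a b : Fin n → Bool) (φ : Ket (Fin n)) :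
    normSq (oneTimePad a b φ) = normSq φ := by
  simp only [normSq, oneTimePad_apply, norm_mul, norm_prod_sgn, one_mul]
  exact (shiftEquiv a).sum_comp (fun x => ‖φ x‖ ^ 2)

/-- Isolates the part of the pad that acts on one wire, so that commuting a single-qubit gate past
the whole pad reduces to an identity of two-by-two matrices. -/
theorem oneTimePad_eq_apply1 (a b : Fin n → Bool) (w : Fin n) (a' b' : Bool) (φ : Ket (Fin n)) :
    oneTimePad (Function.update a w a') (Function.update b w b') φ =
      apply1 (padMat a' b') w
        (oneTimePad (Function.update a w false) (Function.update b w false) φ) := by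
  funext x
  have key : ∀ a' b' e, oneTimePad (Function.update a w a') (Function.update b w b') φ
      (Function.update x w e) = sgn (b' && (e ^^ a')) *
        ((∏ v ∈ Finset.univ.erase w, sgn (b v && (x v ^^ a v))) *
          φ (Function.update (shift x a) w (e ^^ a'))) := by
    intro a' b' e
    rw [oneTimePad_apply, ← Finset.mul_prod_erase _ _ (Finset.mem_univ w)]
    have h1 : ∏ v ∈ Finset.univ.erase w, sgn (Function.update b w b' v &&
        (Function.update x w e v ^^ Function.update a w a' v)) =
        ∏ v ∈ Finset.univ.erase w, sgn (b v && (x v ^^ a v)) := by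
      refine Finset.prod_congr rfl fun v hv => ?_
      have := Finset.ne_of_mem_erase hv
      simp [Function.update_of_ne this]
    have h2 : shift (Function.update x w e) (Function.update a w a') =
        Function.update (shift x a) w (e ^^ a') := by
      funext v
      by_cases h : v = w
      · subst h; simp [shift]
      · simp [shift, Function.update_of_ne h]
    rw [h1, h2]; simp [mul_assoc]
  have h0 := key a' b' (x w)
  rw [Function.update_eq_self] at h0
  rw [h0]
  simp only [apply1, key, padMat, Matrix.of_apply, Fintype.sum_bool]
  cases x w <;> cases a' <;> simp [sgn]

theorem apply1_oneTimePad_comm (M : Matrix Bool Bool ℂ) (a b : Fin n → Bool) (w : Fin n)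
    (ha : a w = false) (hb : b w = false) (φ : Ket (Fin n)) :
    apply1 M w (oneTimePad a b φ) = oneTimePad a b (apply1 M w φ) := by
  funext x
  have h2 : ∀ e, shift (Function.update x w e) a = Function.update (shift x a) w e := by
    intro e
    funext v
    by_cases h : v = w
    · subst h; simp [shift, ha]
    · simp [shift, Function.update_of_ne h]
  have h1 : ∀ e, ∏ v, sgn (b v && (Function.update x w e v ^^ a v)) =
      ∏ v, sgn (b v && (x v ^^ a v)) := by
    intro e
    refine Finset.prod_congr rfl fun v _ => ?_
    by_cases h : v = w
    · subst h; simp [hb]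
    · simp [Function.update_of_ne h]
  have h3 : shift x a w = x w := by simp [shift, ha]
  simp only [apply1, oneTimePad_apply, h1, h2, h3, Fintype.sum_bool]
  ring

/-- A matrix relation `M X^a Z^b = c X^a' Z^b' N` carries over to registers. -/
theorem apply1_oneTimePad {M N : Matrix Bool Bool ℂ} {c : ℂ} (a b : Fin n → Bool) (w : Fin n)
    {a' b' : Bool} (h : M * padMat (a w) (b w) = c • (padMat a' b' * N)) (φ : Ket (Fin n)) :
    apply1 M w (oneTimePad a b φ) =
      c • oneTimePad (Function.update a w a') (Function.update b w b') (apply1 N w φ) := by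
  have h1 := oneTimePad_eq_apply1 a b w (a w) (b w) φ
  rw [Function.update_eq_self, Function.update_eq_self] at h1
  rw [h1, ← apply1_mul, h, apply1_smul, apply1_mul,
    apply1_oneTimePad_comm N _ _ _ (by simp) (by simp), ← oneTimePad_eq_apply1]

/-- CNOT permutes the basis vectors linearly: an `X` on the control spreads to the target and a `Z`
on the target spreads to the control. No phase appears. -/
theorem applyCNOT_oneTimePad (a b : Fin n → Bool) (c t : Fin n) (hct : c ≠ t)
    (φ : Ket (Fin n)) :
    applyCNOT c t (oneTimePad a b φ) =
      oneTimePad (Function.update a t (a c ^^ a t)) (Function.update b c (b c ^^ b t))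
        (applyCNOT c t φ) := by
  funext x
  have h2 : shift (Function.update x t (x t ^^ x c)) a =
      Function.update (shift x (Function.update a t (a c ^^ a t))) t
        (shift x (Function.update a t (a c ^^ a t)) t ^^
          shift x (Function.update a t (a c ^^ a t)) c) := by
    funext v
    by_cases h : v = t
    · subst h
      simp only [shift, Function.update_self, Function.update_of_ne hct]
      cases x v <;> cases a v <;> cases x c <;> cases a c <;> rfl
    · simp [shift, Function.update_of_ne h]
  have hc : c ∈ (Finset.univ : Finset (Fin n)).erase t := by simp [hct]
  have h1 : ∏ v, sgn (b v && (Function.update x t (x t ^^ x c) v ^^ a v)) =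
      ∏ v, sgn (Function.update b c (b c ^^ b t) v &&
        (x v ^^ Function.update a t (a c ^^ a t) v)) := by
    -- Only the sign factors at `t` and `c` differ between the two sides, and only their product
    -- agrees, so both are split off together.
    rw [← Finset.mul_prod_erase _ _ (Finset.mem_univ t), ← Finset.mul_prod_erase _ _ hc,
      ← Finset.mul_prod_erase (Finset.univ) (fun v => sgn (Function.update b c _ v && _))
        (Finset.mem_univ t), ← Finset.mul_prod_erase _ (fun v => sgn (Function.update b c _ v && _))
        hc, ← mul_assoc, ← mul_assoc]
    congr 1
    · simp only [Function.update_self, Function.update_of_ne hct, Function.update_of_ne hct.symm,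
        ← sgn_xor]
      congr 1
      cases b t <;> cases b c <;> cases x t <;> cases x c <;> cases a t <;> cases a c <;> rfl
    · refine Finset.prod_congr rfl fun v hv => ?_
      rw [Finset.mem_erase, Finset.mem_erase] at hv
      simp [Function.update_of_ne hv.1, Function.update_of_ne hv.2.1]
  simp only [applyCNOT, oneTimePad_apply, h1, h2]

end Pad

/-! ## Pauli observables -/

/-- Does the observable flip the basis vectors? -/
def Pauli.flipsBasis : Pauli → Bool
  | .I => false
  | .X => true
  | .Y => true
  | .Z => false

/-- The nonzero entry in row `c` of the matrix of a Pauli observable. -/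
def Pauli.entry : Pauli → Bool → ℂ
  | .I, _ => 1
  | .X, _ => 1
  | .Y, c => Complex.I * sgn (!c)
  | .Z, c => sgn c

/-- Pauli matrices are monomial, so the sum over all basis strings in `applyPauli` collapses to one
term with a coefficient of modulus one. -/
theorem Pauli.mat_apply (O : Pauli) (c d : Bool) :
    O.mat c d = if d = (c ^^ O.flipsBasis) then O.entry c else 0 := by
  cases O <;> cases c <;> cases d <;>
    simp [Pauli.mat, Pauli.flipsBasis, Pauli.entry, Gate1.mat, phaseMat, sgn, Matrix.mul_apply]

theorem Pauli.norm_entry (O : Pauli) (c : Bool) : ‖O.entry c‖ = 1 := by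
  cases O <;> simp [Pauli.entry, norm_sgn]

section Observables

variable {n : ℕ}

theorem applyPauli_apply (O : Fin n → Pauli) (φ : Ket (Fin n)) (x : Fin n → Bool) :
    applyPauli O φ x =
      (∏ w, (O w).entry (x w)) * φ (shift x fun w => (O w).flipsBasis) := by
  rw [applyPauli, Finset.sum_eq_single (shift x fun w => (O w).flipsBasis)]
  · congr 1
    refine Finset.prod_congr rfl fun w _ => ?_
    rw [Pauli.mat_apply]; exact if_pos rfl
  · intro y _ hy
    obtain ⟨w, hw⟩ := Function.ne_iff.mp hy
    rw [Finset.prod_eq_zero (Finset.mem_univ w), zero_mul]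
    rw [Pauli.mat_apply]; exact if_neg hw
  · simp

theorem applyPauli_smul (O : Fin n → Pauli) (c : ℂ) (φ : Ket (Fin n)) :
    applyPauli O (c • φ) = c • applyPauli O φ := by
  funext x
  simp only [applyPauli_apply, Pi.smul_apply, smul_eq_mul]; ring

theorem applyPauli_sub (O : Fin n → Pauli) (φ ψ : Ket (Fin n)) :
    applyPauli O (φ - ψ) = applyPauli O φ - applyPauli O ψ := by
  funext x
  simp only [applyPauli_apply, Pi.sub_apply]; ring

theorem normSq_applyPauli (O : Fin n → Pauli) (φ : Ket (Fin n)) :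
    normSq (applyPauli O φ) = normSq φ := by
  simp only [normSq, applyPauli_apply, norm_mul, norm_prod, Pauli.norm_entry,
    Finset.prod_const_one, one_mul]
  exact (shiftEquiv fun w => (O w).flipsBasis).sum_comp (fun x => ‖φ x‖ ^ 2)

theorem sgn_foldr_xor (l : List Bool) : sgn (l.foldr xor false) = (l.map sgn).prod := by
  induction l with
  | nil => simp [sgn]
  | cons a l ih => simp [sgn_xor, ih]

theorem sgn_flipBit (O : Fin n → Pauli) (a b : Fin n → Bool) :
    sgn (flipBit O a b) = ∏ w, sgn ((O w).flip (a w) (b w)) := by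
  rw [flipBit, sgn_foldr_xor, List.map_map, Fin.prod_univ_def]; rfl

/-- On every wire the two Pauli matrices commute or anticommute; the signs multiply, and `flipBit`
is the parity of the anticommuting wires. -/
theorem applyPauli_oneTimePad (O : Fin n → Pauli) (a b : Fin n → Bool) (φ : Ket (Fin n)) :
    applyPauli O (oneTimePad a b φ) =
      sgn (flipBit O a b) • oneTimePad a b (applyPauli O φ) := by
  funext x
  simp only [applyPauli_apply, oneTimePad_apply, sgn_flipBit, Pi.smul_apply, smul_eq_mul,
    ← mul_assoc, ← Finset.prod_mul_distrib]
  rw [shift_comm]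
  congr 1
  refine Finset.prod_congr rfl fun w _ => ?_
  simp only [shift]
  cases O w <;> cases x w <;> cases a w <;> cases b w <;>
    simp [Pauli.entry, Pauli.flip, Pauli.flipsBasis, sgn]

theorem measProb_smul (O : Fin n → Pauli) (c : ℂ) (φ : Ket (Fin n)) (s : Bool) :
    measProb O (c • φ) s = ‖c‖ ^ 2 * measProb O φ s := by
  rw [measProb, measProb, ← normSq_smul]
  congr 1
  funext x
  simp only [applyPauli_smul, Pi.smul_apply, smul_eq_mul]; ring

/-- Conjugation by the pad fixes the two eigenprojections of the observable or exchanges them; this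
is why the client's flip of the raw result undoes the encryption. -/
theorem measProb_oneTimePad (O : Fin n → Pauli) (a b : Fin n → Bool) (φ : Ket (Fin n))
    (s : Bool) :
    measProb O (oneTimePad a b φ) s = measProb O φ (s ^^ flipBit O a b) := by
  rw [measProb, measProb, 
    ← normSq_oneTimePad a b fun x => (φ x + sgn (s ^^ flipBit O a b) * applyPauli O φ x) / 2]
  congr 1
  funext x
  simp only [applyPauli_oneTimePad, oneTimePad_apply, Pi.smul_apply, smul_eq_mul, sgn_xor]
  ring

theorem measProb_nonneg (O : Fin n → Pauli) (φ : Ket (Fin n)) (s : Bool) :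
    0 ≤ measProb O φ s := normSq_nonneg _

theorem norm_sq_add_norm_sq_half (a b : ℂ) :
    ‖(a + b) / 2‖ ^ 2 + ‖(a - b) / 2‖ ^ 2 = (‖a‖ ^ 2 + ‖b‖ ^ 2) / 2 := by
  simp only [Complex.sq_norm, Complex.normSq_apply, Complex.div_ofNat_re, Complex.div_ofNat_im,
    Complex.add_re, Complex.add_im, Complex.sub_re, Complex.sub_im]
  ring

theorem norm_sq_sub_norm_sq_half (a b : ℂ) :
    ‖(a + b) / 2‖ ^ 2 - ‖(a - b) / 2‖ ^ 2 = (star a * b).re := by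
  simp only [Complex.sq_norm, Complex.normSq_apply, Complex.div_ofNat_re, Complex.div_ofNat_im,
    Complex.add_re, Complex.add_im, Complex.sub_re, Complex.sub_im, Complex.star_def,
    Complex.mul_re, Complex.conj_re, Complex.conj_im]
  ring

/-- The parallelogram law, with the fact that a Pauli operator preserves the norm. -/
theorem measProb_add (O : Fin n → Pauli) (φ : Ket (Fin n)) :
    measProb O φ false + measProb O φ true = normSq φ := by
  have h : normSq φ = (normSq φ + normSq (applyPauli O φ)) / 2 := by
    rw [normSq_applyPauli]; ring
  rw [h]
  simp only [measProb, normSq, ← Finset.sum_add_distrib, Finset.sum_div]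
  refine Finset.sum_congr rfl fun x _ => ?_
  rw [← norm_sq_add_norm_sq_half]
  simp [sgn, sub_eq_add_neg]

theorem measProb_sub (O : Fin n → Pauli) (φ : Ket (Fin n)) :
    measProb O φ false - measProb O φ true = expect O φ := by
  rw [expect, Complex.re_sum]
  simp only [measProb, normSq, ← Finset.sum_sub_distrib]
  refine Finset.sum_congr rfl fun x _ => ?_
  rw [← norm_sq_sub_norm_sq_half]
  simp [sgn, sub_eq_add_neg]

end Observables

/-! ## Remote state preparation -/

/-- The character `k ↦ i ^ k` of `ℤ / 4`. -/
def iPow : AddChar (ZMod 4) ℂ := AddChar.zmodChar 4 (ζ := Complex.I) Complex.I_pow_four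

theorem iPow_one : iPow 1 = Complex.I := by
  rw [iPow, AddChar.zmodChar_apply]; exact pow_one _

theorem iPow_two : iPow 2 = -1 := by
  rw [iPow, AddChar.zmodChar_apply]; exact Complex.I_sq

theorem iPow_three : iPow 3 = -Complex.I := by
  rw [iPow, AddChar.zmodChar_apply]; exact Complex.I_pow_three

theorem norm_iPow (k : ZMod 4) : ‖iPow k‖ = 1 := by
  rw [iPow, AddChar.zmodChar_apply, norm_pow, Complex.norm_I, one_pow]

theorem iPow_sum {ι : Type*} (s : Finset ι) (f : ι → ZMod 4) :
    iPow (∑ i ∈ s, f i) = ∏ i ∈ s, iPow (f i) := by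
  classical
  induction s using Finset.induction_on with
  | empty => simp
  | insert a s ha ih => rw [Finset.sum_insert ha, Finset.prod_insert ha, AddChar.map_add_eq_mul, ih]

theorem rsqrt2_ne_zero : rsqrt2 ≠ 0 := fun h => by
  have := rsqrt2_mul_self; rw [h] at this; norm_num at this

namespace Remote

variable {F : TrapdoorFamily} {κ : ℕ} (ρ : Remote F κ)

theorem star_basisAmp (α b x : Bool) :
    star (basisAmp α b x) = rsqrt2 * iPow (-(res x * (2 * res b + res α))) := by
  have h1 : (-1 : ZMod 4) = 3 := rfl
  have h2 : (-2 : ZMod 4) = 2 := rfl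
  have h3 : (3 + 2 : ZMod 4) = 1 := rfl
  cases α <;> cases b <;> cases x <;>
    simp [basisAmp, star_rsqrt2, res, sgn, iPow_one, iPow_two, iPow_three, h1, h2, h3]

/-- The phase exponent contributed by a preimage. -/
def expo (x : Fin (F.inLen κ) → Bool) : ZMod 4 :=
  ∑ i, res (x i) * (2 * res (ρ.b i) + res (ρ.α i))

theorem prod_star_basisAmp (x : Fin (F.inLen κ) → Bool) :
    ∏ i, star (basisAmp (ρ.α i) (ρ.b i) (x i)) = rsqrt2 ^ F.inLen κ * iPow (-ρ.expo x) := by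
  simp only [star_basisAmp, Finset.prod_mul_distrib, Finset.prod_const, Finset.card_univ,
    Fintype.card_fin, expo]
  rw [← Finset.sum_neg_distrib, iPow_sum]

theorem afterOracle_apply (x : (Fin (F.inLen κ) → Bool) × Bool) :
    ρ.afterOracle (x, ρ.y) = if F.f κ ρ.key x = ρ.y then rsqrt2 ^ (F.inLen κ + 1) else 0 := by
  simp only [afterOracle, initial]
  congr 1
  rw [eq_iff_iff]
  constructor
  · intro h
    funext j
    have := congrFun h j
    revert this
    cases F.f κ ρ.key x j <;> cases ρ.y j <;> simp
  · rintro h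
    funext j
    rw [h]; simp

/-- The oracle leaves only preimages of `y` in the sum, so a single preimage with last bit `c`
contributes a single phase. -/
theorem lastQubit_of_unique {x : Fin (F.inLen κ) → Bool} {c : Bool}
    (h : ∀ x', F.f κ ρ.key (x', c) = ρ.y ↔ x' = x) :
    ρ.lastQubit c = rsqrt2 ^ (F.inLen κ + 1) * rsqrt2 ^ F.inLen κ * iPow (-ρ.expo x) := by
  rw [lastQubit, Finset.sum_eq_single x]
  · rw [prod_star_basisAmp, afterOracle_apply, if_pos ((h x).2 rfl)]; ring
  · intro x' _ hx'
    rw [afterOracle_apply, if_neg fun h' => hx' ((h x').1 h'), mul_zero]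
  · simp

/-- The two preimages of `y` have different last bits, so each basis state of the last qubit
receives the phase of one of them. The relative phase is the difference of the two exponents, with a
sign recording which preimage belongs to `|0⟩`; this is the client's `angle`. -/
theorem lastQubit_eq (h : ρ.Ok) :
    ∃ K : ℂ, K ≠ 0 ∧ ∀ c, ρ.lastQubit c = K * if c then iPow ρ.angle else 1 := by
  obtain ⟨hk, hy, hne⟩ := h
  have hspec := (F.inv_spec κ ρ.key ρ.trapdoor hk ρ.y hy).2
  obtain ⟨⟨x, c⟩, hx⟩ : ∃ p, (F.inv κ ρ.trapdoor ρ.y).1 = p := ⟨_, rfl⟩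
  obtain ⟨⟨x', c'⟩, hx'⟩ : ∃ p, (F.inv κ ρ.trapdoor ρ.y).2 = p := ⟨_, rfl⟩
  rw [hx, hx'] at hspec hne
  change c ≠ c' at hne
  have h1 : ρ.lastQubit c = _ := ρ.lastQubit_of_unique (x := x) fun z => by
    rw [hspec]; simp [hne]
  have h2 : ρ.lastQubit c' = _ := ρ.lastQubit_of_unique (x := x') fun z => by
    rw [hspec]; simp [hne.symm]
  have hangle : ρ.angle = (if c then -1 else 1) * (ρ.expo x - ρ.expo x') := by
    simp only [angle, hx, hx', expo, ← Finset.sum_sub_distrib, sub_mul]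
  have hr : rsqrt2 ^ (F.inLen κ + 1) * rsqrt2 ^ F.inLen κ ≠ 0 :=
    mul_ne_zero (pow_ne_zero _ rsqrt2_ne_zero) (pow_ne_zero _ rsqrt2_ne_zero)
  have hi : ∀ k, iPow k ≠ 0 := fun k h0 => by have := norm_iPow k; simp [h0] at this
  refine ⟨ρ.lastQubit false, ?_, ?_⟩
  · cases c <;> cases c' <;> first | exact absurd rfl hne | skip
    · rw [h1]; exact mul_ne_zero hr (hi _)
    · rw [h2]; exact mul_ne_zero hr (hi _)
  · intro e
    cases e
    · simp
    · rw [if_pos rfl, hangle]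
      cases c <;> cases c' <;> first | exact absurd rfl hne | skip
      · rw [h1, h2, mul_assoc _ (iPow _) (iPow _), ← AddChar.map_add_eq_mul]
        congr 2; simp only [Bool.false_eq_true, if_false]; ring
      · rw [h1, h2, mul_assoc _ (iPow _) (iPow _), ← AddChar.map_add_eq_mul]
        congr 2; simp only [if_true]; ring

theorem qubit_eq (h : ρ.Ok) :
    ∃ γ : ℂ, ‖γ‖ = 1 ∧ ∀ c, ρ.qubit c = γ * (rsqrt2 * if c then iPow ρ.angle else 1) := by
  obtain ⟨K, hK, hq⟩ := ρ.lastQubit_eq h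
  have hn : normSq ρ.lastQubit = 2 * ‖K‖ ^ 2 := by
    simp only [normSq, Fintype.sum_bool, hq, norm_mul, if_true, norm_iPow]
    simp; ring
  have hs : Real.sqrt (normSq ρ.lastQubit) = Real.sqrt 2 * ‖K‖ := by
    rw [hn, Real.sqrt_mul (by norm_num), Real.sqrt_sq (norm_nonneg _)]
  refine ⟨K / (‖K‖ : ℂ), ?_, fun c => ?_⟩
  · rw [norm_div]; simp [hK]
  · rw [qubit, normalized, hs, hq, rsqrt2]
    push_cast
    have : ((‖K‖ : ℝ) : ℂ) ≠ 0 := by simpa using hK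
    have : ((Real.sqrt 2 : ℝ) : ℂ) ≠ 0 := by simp
    field_simp

end Remote

/-- The amplitudes of `X^x Z^z (P†)^p` applied to the first half of `(|00⟩ + |11⟩) / √2`. -/
def pairAmp (x z p : Bool) (u v : Bool) : ℂ :=
  if u = (v ^^ x) then rsqrt2 * sgn (z && v) * (if p && v then -Complex.I else 1) else 0

/-- The Hadamard gate turns the sign `sgn x` of the first qubit, together with the CZ sign, into the
condition `c = d ^^ x`. The phase `i ^ k` of the second qubit survives and is written as a sign
times a power of `-i`: `i = (-1)(-i)` explains why `z` is set for `k = 1` as well as for `k = 2`. -/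
theorem couple_phase (k : ZMod 4) (x : Bool) (γ γ' : ℂ) (u v : Bool → ℂ)
    (hu : ∀ c, u c = γ * (rsqrt2 * if c then sgn x else 1))
    (hv : ∀ c, v c = γ' * (rsqrt2 * if c then iPow k else 1)) (c d : Bool) :
    couple u v c d =
      γ * γ' * pairAmp x (decide (k = 2 ∨ k = 1)) (decide (k = 1 ∨ k = 3)) c d := by
  have h2 : couple u v c d = γ * γ' * (if d then iPow k else 1) * rsqrt2 * (rsqrt2 * rsqrt2) *
      (1 + sgn (c ^^ d ^^ x)) := by
    simp only [couple, hu, hv, Fintype.sum_bool, Gate1.mat, Matrix.of_apply, sgn_xor]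
    cases c <;> cases d <;> cases x <;> simp [sgn] <;> ring_nf
  have h4 : ∀ k : ZMod 4, k = 0 ∨ k = 1 ∨ k = 2 ∨ k = 3 := by decide
  have h3 : (if d then iPow k else 1) = sgn (decide (k = 2 ∨ k = 1) && d) *
      (if decide (k = 1 ∨ k = 3) && d then -Complex.I else 1) := by
    have e02 : ¬ (0 : ZMod 4) = 2 := by decide
    have e03 : ¬ (0 : ZMod 4) = 3 := by decide
    have e12 : ¬ (1 : ZMod 4) = 2 := by decide
    have e21 : ¬ (2 : ZMod 4) = 1 := by decide
    have e23 : ¬ (2 : ZMod 4) = 3 := by decide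
    have e32 : ¬ (3 : ZMod 4) = 2 := by decide
    have e31 : ¬ (3 : ZMod 4) = 1 := by decide
    have e01 : ¬ (0 : ZMod 4) = 1 := by decide
    rcases h4 k with rfl | rfl | rfl | rfl <;> cases d <;>
      simp [iPow_one, iPow_two, iPow_three, sgn, e01, e02, e03, e12, e21, e23, e32, e31]
  rw [h2, h3, rsqrt2_mul_self, pairAmp]
  cases c <;> cases d <;> cases x <;> simp [sgn] <;> ring_nf

theorem couple_qubits {F : TrapdoorFamily} {κ : ℕ} (ρ σ : Remote F κ) (hρ : ρ.Ok) (hσ : σ.Ok)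
    (heven : ρ.odd = false) :
    ∃ γ : ℂ, ‖γ‖ = 1 ∧ ∀ c d, couple ρ.qubit σ.qubit c d =
      γ * pairAmp (decide (ρ.angle = 2)) (decide (σ.angle = 2 ∨ σ.angle = 1)) σ.odd c d := by
  obtain ⟨γ, hγ, hq⟩ := ρ.qubit_eq hρ
  obtain ⟨γ', hγ', hq'⟩ := σ.qubit_eq hσ
  refine ⟨γ * γ', by rw [norm_mul, hγ, hγ', one_mul], fun c d => ?_⟩
  refine couple_phase σ.angle _ γ γ' _ _ (fun c => ?_) hq' c d
  rw [hq]
  congr 3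
  have h4 : ρ.angle = 0 ∨ ρ.angle = 2 := by
    simp only [Remote.odd, decide_eq_false_iff_not] at heven
    revert heven
    generalize ρ.angle = k
    revert k; decide
  rcases h4 with h | h <;> rw [h]
  · have e02 : ¬ (0 : ZMod 4) = 2 := by decide
    simp [e02, sgn]
  · simp [iPow_two, sgn]

namespace Prep

variable {Ω : Setup} {κ n : ℕ} (π : Prep Ω κ n)

theorem gadget_eq {L : ℕ} (h : π.Honest L) {i : ℕ} (hi : i < L) :
    ∃ γ : ℂ, ‖γ‖ = 1 ∧ ∀ u v, π.gadget i u v =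
      γ * ∏ q, pairAmp (π.xBit i q) (π.zBit i q) ((Ω.prog κ).pBit q) (u q)
        (v ((Ω.prog κ).mate (π.sk i) q)) := by
  have := fun q => couple_qubits (π.fstQubit i q) (π.snd i q) (h.fst_ok i hi q)
    (h.snd_ok i hi _) (h.fst_even i hi q)
  choose γ hγ hc using this
  refine ⟨∏ q, γ q, by rw [norm_prod]; simp [hγ], fun u v => ?_⟩
  rw [gadget, ← Finset.prod_mul_distrib]
  refine Finset.prod_congr rfl fun q _ => ?_
  rw [hc, h.snd_odd i hi]; rfl

end Prep

/-! ## Chains of single-qubit matrices -/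

/-- The product `M_{m-1} ⋯ M_0`. -/
def chain : (m : ℕ) → (Fin m → Matrix Bool Bool ℂ) → Matrix Bool Bool ℂ
  | 0, _ => 1
  | m + 1, M => chain m (fun j => M j.succ) * M 0

theorem sum_fin_succ_fun {α β : Type*} [Fintype α] [AddCommMonoid β] {m : ℕ}
    (F : (Fin (m + 1) → α) → β) :
    ∑ y, F y = ∑ a : α, ∑ y : Fin m → α, F (Fin.cons a y) := by
  rw [← (Fin.consEquiv (fun _ => α)).sum_comp F, Fintype.sum_prod_type]
  rfl

/-- The bits `y` are the summation indices of the expanded matrix product. This evaluates the strand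
that carries the input qubit: `e` is its entry and `f` its exit. -/
theorem sum_path_eq_chain (m : ℕ) (M : Fin m → Matrix Bool Bool ℂ) (e f : Bool) :
    (∑ y : Fin m → Bool, if (Fin.cons e y : Fin (m + 1) → Bool) (Fin.last m) = f then
      ∏ j, M j (y j) ((Fin.cons e y : Fin (m + 1) → Bool) j.castSucc) else 0) =
      chain m M f e := by
  induction m generalizing e with
  | zero => simp [chain, Matrix.one_apply, eq_comm]
  | succ m ih =>
    rw [sum_fin_succ_fun, chain, Matrix.mul_apply]
    refine Finset.sum_congr rfl fun a _ => ?_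
    rw [← ih, Finset.sum_mul]
    refine Finset.sum_congr rfl fun y _ => ?_
    rw [← Fin.succ_last, Fin.cons_succ, ite_mul, zero_mul, Fin.prod_univ_succ]
    simp only [Fin.cons_zero, Fin.cons_succ, Fin.castSucc_zero, Fin.castSucc_succ]
    rw [mul_comm]

/-- A strand whose last qubit is measured together with its own first one has equal initial and
final index, and the path sum becomes a trace. -/
theorem sum_loop_eq_trace (m : ℕ) (M : Fin (m + 1) → Matrix Bool Bool ℂ) :
    (∑ y : Fin (m + 1) → Bool,
      ∏ j, M j (y j) ((Fin.cons (y (Fin.last m)) y : Fin (m + 2) → Bool) j.castSucc)) =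
      (chain (m + 1) M).trace := by
  rw [Matrix.trace]
  simp only [Matrix.diag_apply, ← sum_path_eq_chain]
  rw [Finset.sum_comm]
  refine Finset.sum_congr rfl fun y _ => ?_
  rw [← Fin.succ_last]
  simp only [Fin.cons_succ, Finset.sum_ite_eq, Finset.mem_univ, if_true]

/-- Relating a fold to a chain of matrices. -/
theorem foldl_finRange_chain {σ : Type*} (m : ℕ) (M : Fin m → Matrix Bool Bool ℂ)
    (step : σ → Fin m → σ) (R : ℕ → σ → Matrix Bool Bool ℂ → Prop) (s₀ : σ)
    (N₀ : Matrix Bool Bool ℂ) (h₀ : R 0 s₀ N₀)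
    (hs : ∀ (j : Fin m) s N, R j s N → R (j + 1) (step s j) (M j * N)) :
    R m ((List.finRange m).foldl step s₀) (chain m M * N₀) := by
  induction m generalizing R s₀ N₀ with
  | zero => simpa [chain] using h₀
  | succ m ih =>
    rw [List.finRange_succ, List.foldl_cons, List.foldl_map, chain, mul_assoc]
    exact ih (fun j => M j.succ) (fun s j => step s j.succ) (fun k => R (k + 1)) _ _ (hs 0 _ _ h₀)
      fun j s N h => hs j.succ s N h

/-! ## Teleportation through one pair -/

/-- The matrix, from the qubit measured together with a pair to the second half of the pair, of a
Bell measurement with result `o`. -/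
def hop (x z p : Bool) (o : Bool × Bool) : Matrix Bool Bool ℂ :=
  Matrix.of fun y e => star (bell o e (y ^^ x)) * pairAmp x z p (y ^^ x) y

theorem sum_bell_pairAmp (x z p : Bool) (o : Bool × Bool) (y e : Bool) :
    ∑ b, star (bell o e b) * pairAmp x z p b y = hop x z p o y e := by
  rw [Finset.sum_eq_single (y ^^ x)]
  · rfl
  · intro b _ hb
    rw [pairAmp, if_neg hb, mul_zero]
  · simp

theorem hop_apply (x z p : Bool) (o : Bool × Bool) (y e : Bool) :
    hop x z p o y e = if e = (y ^^ x ^^ o.1) then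
      1 / 2 * sgn (o.2 && (y ^^ x)) * (sgn (z && y) * if p && y then -Complex.I else 1) else 0 := by
  rw [hop, Matrix.of_apply, bell, pairAmp, if_pos rfl, ← rsqrt2_mul_self]
  split_ifs <;> simp [star_rsqrt2, star_sgn] <;> ring

/-- `P†` or the identity. -/
def pdag (p : Bool) : Matrix Bool Bool ℂ := phaseMat (if p then -Complex.I else 1)

/-- Teleportation through a pair: the Bell result `o` adds its Pauli to the Pauli `X^x Z^z` of the
pair, and `P†` follows. The modulus 1/2 is the amplitude of each of the four results. -/
theorem hop_eq (x z p : Bool) (o : Bool × Bool) :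
    ∃ c : ℂ, ‖c‖ = 1 / 2 ∧ hop x z p o = c • (pdag p * padMat (x ^^ o.1) (z ^^ o.2)) := by
  obtain ⟨o₁, o₂⟩ := o
  refine ⟨1 / 2 * (sgn (o₂ && o₁) * sgn (z && (x ^^ o₁))), by simp [norm_sgn], ?_⟩
  ext y e
  rw [hop_apply, pdag, phaseMat, Matrix.smul_apply, Matrix.diagonal_mul, padMat, Matrix.of_apply]
  by_cases h : e = (y ^^ x ^^ o₁)
  · have h' : e = (y ^^ (x ^^ o₁)) := by rw [h, Bool.xor_assoc]
    rw [if_pos h, if_pos h', h]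
    have : sgn (o₂ && (y ^^ x)) * sgn (z && y) =
        sgn (o₂ && o₁) * sgn (z && (x ^^ o₁)) * sgn ((z ^^ o₂) && (y ^^ x ^^ o₁)) := by
      cases o₁ <;> cases o₂ <;> cases x <;> cases y <;> cases z <;> simp [sgn]
    have h2 : (if (p && y) = true then -Complex.I else 1) =
        if y = true then (if p = true then -Complex.I else 1) else 1 := by
      cases p <;> cases y <;> simp
    rw [smul_eq_mul, h2]
    linear_combination (1 / 2 * if y = true then (if p = true then -Complex.I else 1) else 1) * this
  · have h' : ¬ e = (y ^^ (x ^^ o₁)) := by rwa [← Bool.xor_assoc]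
    rw [if_neg h, if_neg h']; simp

theorem padMat_mul (a b a' b' : Bool) :
    padMat a b * padMat a' b' = sgn (b && a') • padMat (a ^^ a') (b ^^ b') := by
  ext c d
  simp only [padMat, Matrix.mul_apply, Matrix.of_apply, Matrix.smul_apply, Fintype.sum_bool]
  cases a <;> cases a' <;> cases c <;> cases d <;> cases b <;> cases b' <;> simp [sgn]

/-- `P†` does not commute with `X` but produces an extra `Z`; this is the term `p && a'` in the key
update of `gadgetKeys`. -/
theorem pdag_mul_padMat (p a b : Bool) :
    ∃ c : ℂ, ‖c‖ = 1 ∧ pdag p * padMat a b = c • (padMat a (b ^^ (p && a)) * pdag p) := by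
  refine ⟨if p && a then -Complex.I else 1, by split_ifs <;> simp, ?_⟩
  ext c d
  simp only [pdag, phaseMat, padMat, Matrix.diagonal_mul, Matrix.mul_diagonal, Matrix.of_apply,
    Matrix.smul_apply, smul_eq_mul]
  cases p <;> cases a <;> cases c <;> cases d <;> cases b <;> simp [sgn]

theorem hop_mul_padMat (x z p a b : Bool) (o : Bool × Bool) :
    ∃ c : ℂ, ‖c‖ = 1 / 2 ∧ hop x z p o * padMat a b =
      c • (padMat (a ^^ (x ^^ o.1)) (b ^^ (z ^^ o.2) ^^ (p && (a ^^ (x ^^ o.1)))) * pdag p) := by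
  obtain ⟨c₁, h₁, e₁⟩ := hop_eq x z p o
  obtain ⟨c₂, h₂, e₂⟩ := pdag_mul_padMat p (a ^^ (x ^^ o.1)) (b ^^ (z ^^ o.2))
  refine ⟨c₁ * (sgn ((z ^^ o.2) && a) * c₂), by simp [h₁, h₂, norm_sgn], ?_⟩
  rw [e₁, Matrix.smul_mul, mul_assoc, padMat_mul, Matrix.mul_smul, Bool.xor_comm (x ^^ o.1) a,
    Bool.xor_comm (z ^^ o.2) b, e₂, smul_smul, smul_smul, mul_assoc]

/-- The square of the `T` phase is `i`, so moving `T` past `X` leaves a `Z` and a `P`. The power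
`P^a` is not a Pauli and is the error that the gadget must remove. -/
theorem T_mul_padMat (a b : Bool) :
    ∃ c : ℂ, ‖c‖ = 1 ∧ Gate1.T.mat * padMat a b =
      c • (padMat a (a ^^ b) * (phaseMat (if a then Complex.I else 1) * Gate1.T.mat)) := by
  have hω : Complex.exp (Complex.I * (Real.pi / 4 : ℝ)) *
      Complex.exp (Complex.I * (Real.pi / 4 : ℝ)) = Complex.I := by
    rw [← Complex.exp_add, ← mul_add, ← Complex.ofReal_add,
      show Real.pi / 4 + Real.pi / 4 = Real.pi / 2 by ring, mul_comm]
    push_cast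
    exact Complex.exp_pi_div_two_mul_I
  have hn : ‖Complex.exp (Complex.I * (Real.pi / 4 : ℝ))‖ = 1 := by
    rw [mul_comm, Complex.norm_exp_ofReal_mul_I]
  simp only [Gate1.mat]
  generalize Complex.exp (Complex.I * (Real.pi / 4 : ℝ)) = ω at hω hn
  have h2 : Complex.I * (ω * ω) = -1 := by rw [hω, Complex.I_mul_I]
  refine ⟨if a then ω else 1, by split_ifs <;> simp [hn], ?_⟩
  ext c d
  simp only [phaseMat, padMat, Matrix.diagonal_mul, Matrix.mul_diagonal, Matrix.of_apply,
    Matrix.smul_apply, smul_eq_mul, Matrix.diagonal_mul_diagonal]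
  cases a <;> cases c <;> cases d <;> cases b <;> simp [sgn] <;>
    first | linear_combination h2 | linear_combination -h2

/-! ## Completeness of the Bell measurements -/

/-- The sum of the squared absolute values of the entries. -/
def frob (N : Matrix Bool Bool ℂ) : ℝ := ∑ c, ∑ d, ‖N c d‖ ^ 2

theorem norm_sq_parallelogram (a b : ℂ) :
    ‖a + b‖ ^ 2 + ‖a - b‖ ^ 2 = 2 * (‖a‖ ^ 2 + ‖b‖ ^ 2) := by
  have := parallelogram_law_with_norm ℝ a b
  nlinarith [this]

/-- Entrywise description of the matrices `hop`: up to unit factors. -/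
theorem hop_entries (x z p : Bool) :
    ∃ ζ : Bool → ℂ, (∀ y, ‖ζ y‖ = 1) ∧ ∀ o y e, hop x z p o y e =
      if e = (y ^^ x ^^ o.1) then 1 / 2 * (sgn (o.2 && (y ^^ x)) * ζ y) else 0 := by
  refine ⟨fun y => sgn (z && y) * if p && y then -Complex.I else 1, fun y => ?_, fun o y e => ?_⟩
  · rw [norm_mul, norm_sgn, one_mul]; split_ifs <;> simp
  · rw [hop_apply]
    by_cases h : e = (y ^^ x ^^ o.1)
    · rw [if_pos h, if_pos h]; ring
    · rw [if_neg h, if_neg h]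

/-- Parseval: over the four results `o` the matrices `hop` are pairwise orthogonal, each half a
unitary, hence an orthonormal basis for the trace form after scaling by `√2`. -/
theorem sum_norm_trace_hop (N : Matrix Bool Bool ℂ) (x z p : Bool) :
    ∑ o, ‖(N * hop x z p o).trace‖ ^ 2 = 1 / 2 * frob N := by
  obtain ⟨ζ, hζ, he⟩ := hop_entries x z p
  have key : ∀ (A B : ℂ) (y y' : Bool),
      ‖A * (2⁻¹ * ζ y) + -(B * (2⁻¹ * ζ y'))‖ ^ 2 + ‖A * (2⁻¹ * ζ y) + B * (2⁻¹ * ζ y')‖ ^ 2 =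
        1 / 2 * (‖A‖ ^ 2 + ‖B‖ ^ 2) := by
    intro A B y y'
    rw [← sub_eq_add_neg, add_comm, norm_sq_parallelogram]
    simp only [norm_mul, hζ]; norm_num; ring
  have key' : ∀ (A B : ℂ) (y y' : Bool),
      ‖-(A * (2⁻¹ * ζ y)) + B * (2⁻¹ * ζ y')‖ ^ 2 + ‖A * (2⁻¹ * ζ y) + B * (2⁻¹ * ζ y')‖ ^ 2 =
        1 / 2 * (‖A‖ ^ 2 + ‖B‖ ^ 2) := by
    intro A B y y'
    rw [← key A B y y', ← norm_neg]
    congr 3; ring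
  simp only [Matrix.trace, Matrix.diag_apply, Matrix.mul_apply, he, Fintype.sum_prod_type,
    Fintype.sum_bool, frob]
  cases x <;> simp [sgn, key, key'] <;> ring

/-- Each of the four matrices is half a unitary and preserves a quarter of the Frobenius norm
squared. -/
theorem frob_mul_hop (N : Matrix Bool Bool ℂ) (x z p : Bool) :
    ∑ o, frob (N * hop x z p o) = frob N := by
  obtain ⟨ζ, hζ, he⟩ := hop_entries x z p
  simp only [frob, Matrix.mul_apply, he, Fintype.sum_prod_type, Fintype.sum_bool]
  cases x <;> simp [sgn, hζ, mul_pow] <;> ring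

theorem sum_frob_chain (m : ℕ) (x z p : Fin m → Bool) (N : Matrix Bool Bool ℂ) :
    ∑ o : Fin m → Bool × Bool, frob (N * chain m fun j => hop (x j) (z j) (p j) (o j)) =
      frob N := by
  induction m with
  | zero => simp [chain]
  | succ m ih =>
    rw [sum_fin_succ_fun, Finset.sum_comm]
    simp only [chain, Fin.cons_zero, Fin.cons_succ, ← mul_assoc, frob_mul_hop]
    exact ih _ _ _

/-- The weights of the Bell results on one closed strand add up to one. One block turns the trace
into half a Frobenius norm squared, the other blocks preserve that norm in total, and the identity
has norm squared two. -/
theorem sum_norm_trace_chain (m : ℕ) (x z p : Fin (m + 1) → Bool) :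
    ∑ o : Fin (m + 1) → Bool × Bool,
      ‖(chain (m + 1) fun j => hop (x j) (z j) (p j) (o j)).trace‖ ^ 2 = 1 := by
  rw [sum_fin_succ_fun, Finset.sum_comm]
  simp only [chain, Fin.cons_zero, Fin.cons_succ, sum_norm_trace_hop]
  rw [← Finset.mul_sum]
  have := sum_frob_chain m (fun j => x j.succ) (fun j => z j.succ) (fun j => p j.succ) 1
  simp only [one_mul] at this
  rw [this]
  simp [frob, Matrix.one_apply]; norm_num

/-! ## The strands of a gadget -/

namespace PBP

variable {S C : Type} (A : PBP S C) (s : S) (c : C)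

/-- The first half at which a strand passes through block `j`, as a permutation of the pipes. -/
def pos : ℕ → Equiv.Perm (Fin A.width)
  | 0 => 1
  | j + 1 => A.serverPerm c j * A.clientPerm s j * pos j

theorem pos_succ (j : ℕ) (i : Fin A.width) :
    A.pos s c (j + 1) i = A.serverPerm c j (A.clientPerm s j (A.pos s c j i)) := rfl

/-- Before the middle block the client's and the server's permutations alternate just as the layers
of the program do. -/
theorem pos_start_eq_state {k : ℕ} (hk : k ≤ A.len) : A.pos s c k A.start = A.state s c k := by
  induction k with
  | zero => rfl
  | succ k ih =>
    rw [pos_succ, ih (by omega), state, serverPerm, clientPerm, if_pos (by omega),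
      if_pos (by omega)]

/-- Past the middle block the permutations are the inverses of the earlier ones in reverse order, so
the strand retraces its pipes. -/
theorem clientPerm_pos_len_add {k : ℕ} (hk : k ≤ A.len) (i : Fin A.width) :
    A.clientPerm s (A.len + k) (A.pos s c (A.len + k) i) = A.pos s c (A.len - k) i := by
  induction k with
  | zero => simp [clientPerm]
  | succ k ih =>
    rw [← add_assoc, pos_succ, ih (by omega), serverPerm, clientPerm, if_neg (by omega),
      if_neg (by omega), if_neg (by omega)]
    have h1 : 2 * A.len - 1 - (A.len + k) = A.len - (k + 1) := by omega
    have h2 : 2 * A.len - (A.len + k + 1) = A.len - (k + 1) := by omega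
    have h3 : A.len - k = A.len - (k + 1) + 1 := by omega
    rw [h1, h2, h3, pos_succ, serverPerm, clientPerm, if_pos (by omega), if_pos (by omega)]
    simp

/-- Every strand ends in the pipe in which it began, independently of the secret key. Therefore the
input qubit leaves at `exit`, and the server's pairing of the other outer ends closes each remaining
strand into a loop. -/
theorem clientPerm_pos_last (i : Fin A.width) :
    A.clientPerm s (2 * A.len) (A.pos s c (2 * A.len) i) = i := by
  have := A.clientPerm_pos_len_add s c (le_refl A.len) i
  rwa [← two_mul, Nat.sub_self] at this

/-- The strand-wise description of a function of the labels. -/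
def strands {α : Type} : (Fin A.width → Fin (2 * A.len + 1) → α) ≃ (A.Label → α) where
  toFun Y q := Y ((A.pos s c q.1).symm q.2) q.1
  invFun v i j := v (j, A.pos s c j i)
  left_inv Y := by funext i j; simp
  right_inv v := by funext q; simp

/-- As `strands`, for the second halves. -/
def outStrands {α : Type} : (Fin A.width → Fin (2 * A.len + 1) → α) ≃ (A.Label → α) where
  toFun Y q := Y ((A.pos s c q.1).symm ((A.clientPerm s q.1).symm q.2)) q.1
  invFun v i j := v (j, A.clientPerm s j (A.pos s c j i))
  left_inv Y := by funext i j; simp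
  right_inv v := by funext q; simp

theorem prod_label {β : Type*} [CommMonoid β] (F : A.Label → β) :
    ∏ q, F q = ∏ i, ∏ j : Fin (2 * A.len + 1), F (j, A.pos s c j i) := by
  rw [Fintype.prod_prod_type]
  conv_rhs => rw [Finset.prod_comm]
  exact Finset.prod_congr rfl fun j _ => (Equiv.prod_comp (A.pos s c j) fun i => F (j, i)).symm

theorem outStrands_mate {α : Type} (Y : Fin A.width → Fin (2 * A.len + 1) → α)
    (i : Fin A.width) (j : Fin (2 * A.len + 1)) :
    A.outStrands s c Y (A.mate s (j, A.pos s c j i)) = Y i j := by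
  simp [outStrands, mate]

theorem outStrands_exit {α : Type} (Y : Fin A.width → Fin (2 * A.len + 1) → α) :
    A.outStrands s c Y A.exit = Y A.start (Fin.last _) := by
  have h := A.clientPerm_pos_last s c A.start
  simp only [outStrands, exit, Equiv.coe_fn_mk, Fin.val_last]
  conv_lhs => rw [← h]
  simp

/-- Along a strand the measurement partner of a first half is the preceding second half. The entry
prepended by `Fin.cons` is the predecessor of block 0: the input bit for the start strand, the
strand's own last bit for a loop. -/
theorem partner_pos (e : Bool) (Y : Fin A.width → Fin (2 * A.len + 1) → Bool)
    (i : Fin A.width) (j : Fin (2 * A.len + 1)) :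
    (A.partner c (j, A.pos s c j i)).elim e (A.outStrands s c Y) =
      (Fin.cons (if i = A.start then e else Y i (Fin.last _)) (Y i) :
        Fin (2 * A.len + 2) → Bool) j.castSucc := by
  induction j using Fin.cases with
  | zero =>
    have h0 : A.pos s c ((0 : Fin (2 * A.len + 1)) : ℕ) i = i := rfl
    have hz : ((0 : Fin (2 * A.len + 1)) : ℕ) = 0 := rfl
    rw [h0]
    simp only [partner, hz, if_true]
    by_cases hi : i = A.start
    · simp [hi]
    · have h := A.clientPerm_pos_last s c i
      simp only [hi, if_false, Option.elim, outStrands, Equiv.coe_fn_mk, Fin.val_last,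
        Fin.castSucc_zero, Fin.cons_zero]
      conv_lhs => rw [← h]
      simp
  | succ j =>
    rw [partner, if_neg (by simp)]
    simp only [Option.elim, Fin.castSucc_succ, Fin.cons_succ, Fin.val_succ, Nat.add_sub_cancel,
      pos_succ, Equiv.symm_apply_apply, outStrands, Equiv.coe_fn_mk]
    rfl

end PBP

theorem prod_sum_eq_sum_prod {ι α : Type*} [Fintype ι] [DecidableEq ι] [Fintype α]
    {β : Type*} [CommSemiring β] (F : ι → α → β) :
    ∑ y : ι → α, ∏ i, F i (y i) = ∏ i, ∑ a, F i a := by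
  rw [Finset.prod_univ_sum, Fintype.piFinset_univ]

namespace Prep

variable {Ω : Setup} {κ n : ℕ} (π : Prep Ω κ n)

/-- The matrices of the blocks along strand `i` of gadget `k`. -/
def strandHop (k : ℕ) (c : Ω.HE.CT) (o : Ω.Label κ → Bool × Bool) (i : Fin (Ω.prog κ).width)
    (j : Fin (2 * (Ω.prog κ).len + 1)) : Matrix Bool Bool ℂ :=
  let q : Ω.Label κ := (j, (Ω.prog κ).pos (π.sk k) c j i)
  hop (π.xBit k q) (π.zBit k q) ((Ω.prog κ).pBit q) (o q)

/-- The factor that the closed strands contribute. -/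
def loops (k : ℕ) (c : Ω.HE.CT) (o : Ω.Label κ → Bool × Bool) : ℂ :=
  ∏ i ∈ Finset.univ.erase (Ω.prog κ).start, (chain _ (π.strandHop k c o i)).trace

/-- Summing over the first halves leaves one `hop` per pair. Indexed by strands, the sum over the
second halves factorises: the start strand gives a matrix acting on wire `w`, and every other strand
gives a trace. The phase `γ` comes from the remote preparations and does not depend on the results.
-/
theorem teleport_eq {L : ℕ} (h : π.Honest L) {k : ℕ} (hk : k < L) (w : Fin n) (c : Ω.HE.CT) :
    ∃ γ : ℂ, ‖γ‖ = 1 ∧ ∀ o φ, π.teleport k w c o φ =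
      (γ * π.loops k c o) •
        apply1 (chain _ (π.strandHop k c o (Ω.prog κ).start)) w φ := by
  obtain ⟨γ, hγ, hg⟩ := π.gadget_eq h hk
  refine ⟨γ, hγ, fun o φ => ?_⟩
  funext x
  -- summing over the first halves
  have h1 : ∀ (e : Bool) (v : Ω.Label κ → Bool),
      (∑ u : Ω.Label κ → Bool, (∏ q, star (bell (o q) (((Ω.prog κ).partner c q).elim e v) (u q))) *
        π.gadget k u v * φ (Function.update x w e)) =
      γ * φ (Function.update x w e) * ∏ q, hop (π.xBit k q) (π.zBit k q) ((Ω.prog κ).pBit q) (o q)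
        (v ((Ω.prog κ).mate (π.sk k) q)) (((Ω.prog κ).partner c q).elim e v) := by
    intro e v
    simp only [← sum_bell_pairAmp]
    rw [← prod_sum_eq_sum_prod, Finset.mul_sum]
    refine Finset.sum_congr rfl fun u _ => ?_
    rw [hg, Finset.prod_mul_distrib]; ring
  -- rewriting by strands
  have h2 : ∀ (e : Bool) (Y : Fin (Ω.prog κ).width → Fin (2 * (Ω.prog κ).len + 1) → Bool),
      (∏ q, hop (π.xBit k q) (π.zBit k q) ((Ω.prog κ).pBit q) (o q)
        ((Ω.prog κ).outStrands (π.sk k) c Y ((Ω.prog κ).mate (π.sk k) q))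
        (((Ω.prog κ).partner c q).elim e ((Ω.prog κ).outStrands (π.sk k) c Y))) =
      ∏ i, ∏ j, π.strandHop k c o i j (Y i j)
        ((Fin.cons (if i = (Ω.prog κ).start then e else Y i (Fin.last _)) (Y i) :
          Fin (2 * (Ω.prog κ).len + 2) → Bool) j.castSucc) := by
    intro e Y
    rw [(Ω.prog κ).prod_label (π.sk k) c]
    refine Finset.prod_congr rfl fun i _ => Finset.prod_congr rfl fun j _ => ?_
    rw [(Ω.prog κ).partner_pos, (Ω.prog κ).outStrands_mate]; rfl
  -- the sum over one strand
  let F : Bool → Fin (Ω.prog κ).width → (Fin (2 * (Ω.prog κ).len + 1) → Bool) → ℂ := fun e i y =>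
    if i = (Ω.prog κ).start then
      if (Fin.cons e y : Fin (2 * (Ω.prog κ).len + 2) → Bool) (Fin.last _) = x w then
        ∏ j, π.strandHop k c o i j (y j)
          ((Fin.cons e y : Fin (2 * (Ω.prog κ).len + 2) → Bool) j.castSucc) else 0
    else ∏ j, π.strandHop k c o i j (y j)
      ((Fin.cons (y (Fin.last _)) y : Fin (2 * (Ω.prog κ).len + 2) → Bool) j.castSucc)
  -- The condition on the exit qubit concerns the start strand only, so it can be absorbed into that
  -- strand's factor.
  have h3 : ∀ (e : Bool) (Y : Fin (Ω.prog κ).width → Fin (2 * (Ω.prog κ).len + 1) → Bool),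
      (if Y (Ω.prog κ).start (Fin.last _) = x w then
        ∏ i, ∏ j, π.strandHop k c o i j (Y i j)
          ((Fin.cons (if i = (Ω.prog κ).start then e else Y i (Fin.last _)) (Y i) :
            Fin (2 * (Ω.prog κ).len + 2) → Bool) j.castSucc) else 0) = ∏ i, F e i (Y i) := by
    intro e Y
    have hl : (Fin.cons e (Y (Ω.prog κ).start) : Fin (2 * (Ω.prog κ).len + 2) → Bool) (Fin.last _) =
        Y (Ω.prog κ).start (Fin.last _) := by
      rw [← Fin.succ_last, Fin.cons_succ]
    split_ifs with hx
    · refine Finset.prod_congr rfl fun i _ => ?_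
      by_cases hi : i = (Ω.prog κ).start
      · subst hi; simp only [F, hl, hx, if_true]
      · simp only [F, hi, if_false]
    · symm
      refine Finset.prod_eq_zero (Finset.mem_univ (Ω.prog κ).start) ?_
      simp only [F, hl, hx, if_true, if_false]
  have h4 : ∀ e, ∏ i, ∑ y, F e i y =
      chain _ (π.strandHop k c o (Ω.prog κ).start) (x w) e * π.loops k c o := by
    intro e
    rw [← Finset.mul_prod_erase _ _ (Finset.mem_univ (Ω.prog κ).start)]
    congr 1
    · simp only [F, if_true]
      exact sum_path_eq_chain _ _ _ _
    · refine Finset.prod_congr rfl fun i hi => ?_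
      simp only [F, Finset.ne_of_mem_erase hi, if_false]
      exact sum_loop_eq_trace _ _
  simp only [teleport, apply1, Pi.smul_apply, smul_eq_mul, Finset.mul_sum]
  refine Finset.sum_congr rfl fun e _ => ?_
  rw [Finset.sum_comm, ← ((Ω.prog κ).outStrands (π.sk k) c).sum_comp]
  simp only [(Ω.prog κ).outStrands_exit]
  have h5 : ∀ Y : Fin (Ω.prog κ).width → Fin (2 * (Ω.prog κ).len + 1) → Bool,
      (∑ u : Ω.Label κ → Bool, if Y (Ω.prog κ).start (Fin.last _) = x w then
        (∏ q, star (bell (o q) (((Ω.prog κ).partner c q).elim e ((Ω.prog κ).outStrands (π.sk k) c Y)) (u q))) *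
          π.gadget k u ((Ω.prog κ).outStrands (π.sk k) c Y) * φ (Function.update x w e) else 0) =
      γ * φ (Function.update x w e) * ∏ i, F e i (Y i) := by
    intro Y
    rw [← h3]
    split_ifs
    · rw [h1, h2]
    · simp
  rw [Finset.sum_congr rfl fun Y _ => h5 Y, ← Finset.mul_sum, prod_sum_eq_sum_prod, h4]
  ring

/-- The weights of the results of the Bell measurements. -/
theorem sum_norm_loops (k : ℕ) (c : Ω.HE.CT) :
    ∑ o, (1 / 4 : ℝ) ^ (2 * (Ω.prog κ).len + 1) * ‖π.loops k c o‖ ^ 2 = 1 := by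
  -- The start strand has no trace; its factor is the constant weight of its results, which sums to
  -- one over all `4 ^ (2 * len + 1)` of them.
  let G : Fin (Ω.prog κ).width → (Fin (2 * (Ω.prog κ).len + 1) → Bool × Bool) → ℝ := fun i a =>
    if i = (Ω.prog κ).start then (1 / 4 : ℝ) ^ (2 * (Ω.prog κ).len + 1) else
      ‖(chain _ fun j : Fin (2 * (Ω.prog κ).len + 1) =>
        hop (π.xBit k (j, (Ω.prog κ).pos (π.sk k) c j i)) (π.zBit k (j, (Ω.prog κ).pos (π.sk k) c j i))
          ((Ω.prog κ).pBit (j, (Ω.prog κ).pos (π.sk k) c j i)) (a j)).trace‖ ^ 2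
  rw [← ((Ω.prog κ).strands (π.sk k) c).sum_comp]
  have h1 : ∀ Y : Fin (Ω.prog κ).width → Fin (2 * (Ω.prog κ).len + 1) → Bool × Bool,
      (1 / 4 : ℝ) ^ (2 * (Ω.prog κ).len + 1) * ‖π.loops k c ((Ω.prog κ).strands (π.sk k) c Y)‖ ^ 2 =
        ∏ i, G i (Y i) := by
    intro Y
    rw [← Finset.mul_prod_erase _ _ (Finset.mem_univ (Ω.prog κ).start), loops, norm_prod, ← Finset.prod_pow]
    congr 1
    · simp only [G, if_true]
    · refine Finset.prod_congr rfl fun i hi => ?_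
      simp only [G, Finset.ne_of_mem_erase hi, if_false]
      congr 4
      funext j
      simp only [strandHop, PBP.strands, Equiv.coe_fn_mk, Equiv.symm_apply_apply]
  rw [Finset.sum_congr rfl fun Y _ => h1 Y, prod_sum_eq_sum_prod]
  refine Finset.prod_eq_one fun i _ => ?_
  by_cases hi : i = (Ω.prog κ).start
  · simp only [G, hi, if_true, Finset.sum_const, Finset.card_univ, nsmul_eq_mul]
    rw [Fintype.card_fun, Fintype.card_prod, Fintype.card_bool, Fintype.card_fin]
    push_cast
    rw [← mul_pow]; norm_num
  · simp only [G, hi, if_false]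
    exact sum_norm_trace_chain _ _ _ _

theorem pdag_mul_pdag_or {p q : Bool} (h : (p && q) = false) :
    pdag p * pdag q = pdag (q || p) := by
  cases p <;> cases q <;> simp_all [pdag, phaseMat]

/-- Following a qubit with Pauli keys `a, b` through the gadget. -/
theorem chain_mul_padMat (k : ℕ) (c : Ω.HE.CT) (o : Ω.Label κ → Bool × Bool) (a b : Bool) :
    ∃ z : ℂ, ‖z‖ = (1 / 2) ^ (2 * (Ω.prog κ).len + 1) ∧
      chain _ (π.strandHop k c o (Ω.prog κ).start) * padMat a (a ^^ b) =
        z • (padMat (gadgetKeys c o (π.gBits k) a b).1 (gadgetKeys c o (π.gBits k) a b).2 *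
          pdag ((Ω.prog κ).run (π.sk k) c)) := by
  -- The invariant after `m` blocks: the fold is at the strand's pipe, and the matrix product is the
  -- Pauli given by the current keys, followed on the right by `P†` once the middle block has been
  -- passed and the program accepts.
  let R : ℕ → Fin (Ω.prog κ).width × Bool × Bool → Matrix Bool Bool ℂ → Prop := fun m st N =>
    st.1 = (Ω.prog κ).pos (π.sk k) c m (Ω.prog κ).start ∧ ∃ z : ℂ, ‖z‖ = (1 / 2) ^ m ∧
      N = z • (padMat st.2.1 st.2.2 * pdag (decide ((Ω.prog κ).len < m) && (Ω.prog κ).run (π.sk k) c))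
  let step : Fin (Ω.prog κ).width × Bool × Bool → Fin (2 * (Ω.prog κ).len + 1) → Fin (Ω.prog κ).width × Bool × Bool :=
    fun st j =>
      let q : Fin (2 * (Ω.prog κ).len + 1) × Fin (Ω.prog κ).width := (j, st.1)
      let a' := xor st.2.1 (xor (π.gBits k (.x q)) (o q).1)
      let b' := xor st.2.2 (xor (π.gBits k (.z q)) (o q).2)
      let i' := ((List.finRange (Ω.prog κ).width).find? fun i' =>
        π.gBits k (.pair j st.1 i')).getD st.1
      ((Ω.prog κ).serverPerm c j i', a', xor b' (π.gBits k (.p q) && a'))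
  have key := foldl_finRange_chain (2 * (Ω.prog κ).len + 1) (π.strandHop k c o (Ω.prog κ).start) step R
    ((Ω.prog κ).start, a, xor a b) (padMat a (a ^^ b)) ⟨rfl, 1, by simp, by simp [pdag, phaseMat]⟩ ?_
  · obtain ⟨-, z, hz, hN⟩ := key
    refine ⟨z, hz, ?_⟩
    rw [hN, show decide ((Ω.prog κ).len < 2 * (Ω.prog κ).len + 1) = true by simp; omega, Bool.true_and]
    rfl
  · rintro j ⟨i, a₁, b₁⟩ N ⟨hi, z, hz, rfl⟩
    dsimp only at hi
    -- The pairing bits mark exactly one pipe, the image under the client's permutation, so the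
    -- search succeeds and the default value is never used.
    have hfind : ((List.finRange (Ω.prog κ).width).find? fun i' => π.gBits k (.pair j i i')).getD i =
        (Ω.prog κ).clientPerm (π.sk k) j i := by
      have : (List.finRange (Ω.prog κ).width).find? (fun i' => π.gBits k (.pair j i i')) =
          some ((Ω.prog κ).clientPerm (π.sk k) j i) := by
        rcases hf : (List.finRange (Ω.prog κ).width).find? (fun i' => π.gBits k (.pair j i i')) with _ | i'
        · rw [List.find?_eq_none] at hf
          exact absurd (by simp [gBits]) (hf ((Ω.prog κ).clientPerm (π.sk k) j i) (List.mem_finRange _))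
        · have := List.find?_some hf
          simp only [gBits, decide_eq_true_eq] at this
          rw [this]
      rw [this]; rfl
    refine ⟨?_, ?_⟩
    · simp only [step, hfind]
      rw [PBP.pos_succ, hi]
    · obtain ⟨y, hy, e⟩ := hop_mul_padMat (π.xBit k (j, i)) (π.zBit k (j, i)) ((Ω.prog κ).pBit (j, i)) a₁ b₁
        (o (j, i))
      refine ⟨z * y, by rw [norm_mul, hz, hy, pow_succ], ?_⟩
      have hs : π.strandHop k c o (Ω.prog κ).start j =
          hop (π.xBit k (j, i)) (π.zBit k (j, i)) ((Ω.prog κ).pBit (j, i)) (o (j, i)) := by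
        rw [strandHop, hi]
      have hp : pdag ((Ω.prog κ).pBit (j, i)) * pdag (decide ((Ω.prog κ).len < j) && (Ω.prog κ).run (π.sk k) c) =
          pdag (decide ((Ω.prog κ).len < j + 1) && (Ω.prog κ).run (π.sk k) c) := by
        -- In the middle block the strand's pipe is the final state of the program, so the bit `p`
        -- found there is the computed value; all other blocks have `p` false.
        have hcase : (Ω.prog κ).pBit (j, i) = (decide ((j : ℕ) = (Ω.prog κ).len) && (Ω.prog κ).run (π.sk k) c) := by
          by_cases hj : (j : ℕ) = (Ω.prog κ).len
          · rw [PBP.run, ← (Ω.prog κ).pos_start_eq_state _ _ le_rfl, PBP.pBit, hi, hj]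
          · simp [PBP.pBit, hj]
        rw [hcase, pdag_mul_pdag_or]
        · congr 1
          rw [← Bool.and_or_distrib_right]
          congr 1
          rw [← Bool.decide_or, decide_eq_decide]
          omega
        · by_cases hj : (j : ℕ) = (Ω.prog κ).len <;> simp [hj]
      rw [hs, Matrix.mul_smul, ← mul_assoc, e, Matrix.smul_mul, smul_smul, mul_assoc, hp]
      rfl

/-- A `T` gate on an encrypted register followed by its gadget is, up to a factor, an encryption of
the result of the `T` gate with the new keys; the weights of the factors add up to one. -/
theorem teleport_oneTimePad {L : ℕ} (h : π.Honest L) {k : ℕ} (hk : k < L) (w : Fin n)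
    (c : Ω.HE.CT) (a b : Fin n → Bool) (hc : (Ω.prog κ).run (π.sk k) c = a w) :
    ∃ z : (Ω.Label κ → Bool × Bool) → ℂ, ∑ o, ‖z o‖ ^ 2 = 1 ∧ ∀ o ψ,
      π.teleport k w c o ((Gate.one .T w).apply (oneTimePad a b ψ)) =
        z o • oneTimePad
          (Function.update a w (gadgetKeys c o (π.gBits k) (a w) (b w)).1)
          (Function.update b w (gadgetKeys c o (π.gBits k) (a w) (b w)).2)
          ((Gate.one .T w).apply ψ) := by
  obtain ⟨γ, hγ, ht⟩ := π.teleport_eq h hk w c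
  obtain ⟨τ, hτ, eT⟩ := T_mul_padMat (a w) (b w)
  have := fun o => π.chain_mul_padMat k c o (a w) (b w)
  choose z hz ez using this
  refine ⟨fun o => γ * π.loops k c o * (τ * z o), ?_, fun o ψ => ?_⟩
  -- Squaring the modulus `(1 / 2) ^ (2 * len + 1)` of the start strand gives the power of 1/4 that
  -- completes the loop weights.
  · rw [← π.sum_norm_loops k c]
    refine Finset.sum_congr rfl fun o _ => ?_
    rw [norm_mul, norm_mul, norm_mul, hγ, hτ, hz, one_mul, one_mul, mul_pow, ← pow_mul,
      mul_comm (2 * _ + 1) 2, pow_mul, mul_comm]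
    norm_num
  -- By `hc` the program computes the pad bit `a w`, so the `P†` of the gadget cancels the `P` left
  -- behind by the `T` gate.
  · have hP : pdag (a w) * phaseMat (if a w then Complex.I else 1) = 1 := by
      cases a w <;> simp [pdag, phaseMat, Matrix.diagonal_eq_diagonal_iff,
        ← Matrix.diagonal_one]
    have hM : chain _ (π.strandHop k c o (Ω.prog κ).start) * Gate1.T.mat * padMat (a w) (b w) =
        (τ * z o) • (padMat (gadgetKeys c o (π.gBits k) (a w) (b w)).1
          (gadgetKeys c o (π.gBits k) (a w) (b w)).2 * Gate1.T.mat) := by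
      rw [mul_assoc, eT, Matrix.mul_smul, ← mul_assoc, ez, hc, Matrix.smul_mul, smul_smul,
        mul_assoc, ← mul_assoc (pdag _), hP, one_mul]
    rw [ht, Gate.apply, ← apply1_mul, apply1_oneTimePad a b w hM, smul_smul]

end Prep

/-! ## Homomorphic evaluation -/

theorem X_mul_padMat (a b : Bool) :
    Gate1.X.mat * padMat a b = sgn b • (padMat a b * Gate1.X.mat) := by
  ext c d
  simp only [Gate1.mat, padMat, Matrix.mul_apply, Matrix.of_apply, Matrix.smul_apply,
    Fintype.sum_bool]
  cases a <;> cases c <;> cases d <;> cases b <;> simp [sgn]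

theorem Z_mul_padMat (a b : Bool) :
    Gate1.Z.mat * padMat a b = sgn a • (padMat a b * Gate1.Z.mat) := by
  ext c d
  simp only [Gate1.mat, padMat, phaseMat, Matrix.diagonal_mul, Matrix.mul_diagonal,
    Matrix.of_apply, Matrix.smul_apply]
  cases a <;> cases c <;> cases d <;> cases b <;> simp [sgn]

theorem P_mul_padMat (a b : Bool) :
    Gate1.P.mat * padMat a b =
      (if a then Complex.I else 1) • (padMat a (a ^^ b) * Gate1.P.mat) := by
  ext c d
  simp only [Gate1.mat, padMat, phaseMat, Matrix.diagonal_mul, Matrix.mul_diagonal,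
    Matrix.of_apply, Matrix.smul_apply]
  cases a <;> cases c <;> cases d <;> cases b <;> simp [sgn]

theorem H_mul_padMat (a b : Bool) :
    Gate1.H.mat * padMat a b = sgn (a && b) • (padMat b a * Gate1.H.mat) := by
  ext c d
  simp only [Gate1.mat, padMat, Matrix.mul_apply, Matrix.of_apply, Matrix.smul_apply,
    Fintype.sum_bool]
  cases a <;> cases c <;> cases d <;> cases b <;> simp [sgn]

namespace Prep

variable {Ω : Setup} {κ n : ℕ} (π : Prep Ω κ n)

/-- The wires' keys `a` are encrypted with the keys number `i` by `c`. -/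
def EncryptsKeys (i : ℕ) (c : Fin n → Ω.HE.CT) (a : Fin n → Bool) : Prop :=
  ∀ w, Ω.HE.Encrypts (π.pk i) (π.evk i) (c w) (a w)

theorem Honest.dec_eq {π : Prep Ω κ n} {L : ℕ} (h : π.Honest L) (hΩ : Ω.Correct) {i : ℕ}
    (hi : i ≤ L) {c : Ω.HE.CT} {x : Bool} (hc : Ω.HE.Encrypts (π.pk i) (π.evk i) c x) :
    Ω.HE.dec (π.sk i) c = x :=
  hΩ.1 κ _ _ _ (h.key_mem i hi) c x hc

theorem encrypts_addCT {i : ℕ} {c c' : Ω.HE.CT} {x x' : Bool}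
    (h : Ω.HE.Encrypts (π.pk i) (π.evk i) c x) (h' : Ω.HE.Encrypts (π.pk i) (π.evk i) c' x') :
    Ω.HE.Encrypts (π.pk i) (π.evk i) (π.addCT i c c') (x ^^ x') := by
  refine CHE.Encrypts.eval (fun x : Bool → Bool => xor (x false) (x true))
    (fun s => if s then c' else c) (fun s => if s then x' else x) fun s => ?_
  cases s
  · exact h
  · exact h'

theorem EncryptsKeys.update {π : Prep Ω κ n} {i : ℕ} {c : Fin n → Ω.HE.CT} {a : Fin n → Bool}
    (h : π.EncryptsKeys i c a) (w : Fin n) {c' : Ω.HE.CT} {x : Bool}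
    (h' : Ω.HE.Encrypts (π.pk i) (π.evk i) c' x) :
    π.EncryptsKeys i (Function.update c w c') (Function.update a w x) := by
  intro v
  by_cases hv : v = w
  · subst hv; simpa using h'
  · simpa [Function.update_of_ne hv] using h v

theorem Honest.encrypts_evalG {π : Prep Ω κ n} {L : ℕ} (h : π.Honest L) {i : ℕ} (hi : i < L)
    (C : (Ω.GBits κ → Bool) → Bool) :
    Ω.HE.Encrypts (π.pk (i + 1)) (π.evk (i + 1)) (π.evalG i C) (C (π.gBits i)) :=
  CHE.Encrypts.eval C (π.encG i) (π.gBits i) fun g => CHE.Encrypts.fresh _ _ (h.encG_mem i hi g)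

/-- Bootstrapping: the old ciphertexts are constants in a function of the gadget description, which
contains `sk_i` encrypted under `pk_{i+1}`. Evaluating the decryption inside this function moves all
wires' keys to the next key pair. -/
theorem Honest.encrypts_newKeys {π : Prep Ω κ n} {L : ℕ} (h : π.Honest L) (hΩ : Ω.Correct)
    {i : ℕ} (hi : i < L) (w : Fin n) (o : Ω.Label κ → Bool × Bool) {ca cb : Fin n → Ω.HE.CT}
    {a b : Fin n → Bool} (ha : π.EncryptsKeys i ca a) (hb : π.EncryptsKeys i cb b) :
    π.EncryptsKeys (i + 1) (π.newKeys i w o ca cb).1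
        (Function.update a w (gadgetKeys (ca w) o (π.gBits i) (a w) (b w)).1) ∧
      π.EncryptsKeys (i + 1) (π.newKeys i w o ca cb).2
        (Function.update b w (gadgetKeys (ca w) o (π.gBits i) (a w) (b w)).2) := by
  have hda : ∀ v, Ω.HE.dec (π.sk i) (ca v) = a v := fun v => h.dec_eq hΩ hi.le (ha v)
  have hdb : ∀ v, Ω.HE.dec (π.sk i) (cb v) = b v := fun v => h.dec_eq hΩ hi.le (hb v)
  have hsk : (fun k => π.gBits i (.sk k)) = π.sk i := rfl
  constructor <;> intro v
  · have e := h.encrypts_evalG hi fun g => (if v = w then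
      gadgetKeys (ca w) o g (Ω.HE.dec (κ := κ) (fun k => g (.sk k)) (ca v))
        (Ω.HE.dec (κ := κ) (fun k => g (.sk k)) (cb v))
      else (Ω.HE.dec (κ := κ) (fun k => g (.sk k)) (ca v),
        Ω.HE.dec (κ := κ) (fun k => g (.sk k)) (cb v))).1
    -- At the true description the inner decryptions use the true `sk_i` and return the pad bits.
    rw [hsk, hda, hdb] at e
    refine Eq.subst (motive := fun x => Ω.HE.Encrypts _ _ ((π.newKeys i w o ca cb).1 v) x) ?_ e
    by_cases hv : v = w
    · subst hv; simp
    · simp [hv]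
  · have e := h.encrypts_evalG hi fun g => (if v = w then
      gadgetKeys (ca w) o g (Ω.HE.dec (κ := κ) (fun k => g (.sk k)) (ca v))
        (Ω.HE.dec (κ := κ) (fun k => g (.sk k)) (cb v))
      else (Ω.HE.dec (κ := κ) (fun k => g (.sk k)) (ca v),
        Ω.HE.dec (κ := κ) (fun k => g (.sk k)) (cb v))).2
    rw [hsk, hda, hdb] at e
    refine Eq.subst (motive := fun x => Ω.HE.Encrypts _ _ ((π.newKeys i w o ca cb).2 v) x) ?_ e
    by_cases hv : v = w
    · subst hv; simp
    · simp [hv]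

/-- The weight with which the client obtains the result `(-1) ^ s` at the end. -/
def clientWeight (O : Fin n → Pauli) (s : Bool) (i : ℕ) (φ : Ket (Fin n))
    (ca cb : Fin n → Ω.HE.CT) : ℝ :=
  ∑ raw : Bool, if xor raw (flipBit O (fun w => Ω.HE.dec (π.sk i) (ca w))
    (fun w => Ω.HE.dec (π.sk i) (cb w))) = s then measProb O φ raw else 0

theorem Honest.clientWeight_eq {π : Prep Ω κ n} {L : ℕ} (h : π.Honest L) (hΩ : Ω.Correct)
    (O : Fin n → Pauli) (s : Bool) {i : ℕ} (hi : i ≤ L) {ca cb : Fin n → Ω.HE.CT}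
    {a b : Fin n → Bool} (ha : π.EncryptsKeys i ca a) (hb : π.EncryptsKeys i cb b) (c : ℂ)
    (ψ : Ket (Fin n)) :
    π.clientWeight O s i (c • oneTimePad a b ψ) ca cb = ‖c‖ ^ 2 * measProb O ψ s := by
  have hda : (fun w => Ω.HE.dec (π.sk i) (ca w)) = a := funext fun v => h.dec_eq hΩ hi (ha v)
  have hdb : (fun w => Ω.HE.dec (π.sk i) (cb w)) = b := funext fun v => h.dec_eq hΩ hi (hb v)
  rw [clientWeight, hda, hdb]
  simp only [measProb_smul, measProb_oneTimePad, Fintype.sum_bool]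
  cases flipBit O a b <;> cases s <;> simp

/-- Induction on the gate sequence with the pad, the ciphertexts and the scalar all arbitrary. The
scalar is carried along because measured states are not renormalised; its squared modulus is the
probability of the Bell results so far. -/
theorem Honest.evaluate_eq {π : Prep Ω κ n} {L : ℕ} (h : π.Honest L) (hΩ : Ω.Correct)
    (O : Fin n → Pauli) (s : Bool) (gs : List (Gate n)) :
    ∀ (i : ℕ), i + tCount gs ≤ L → ∀ (ca cb : Fin n → Ω.HE.CT) (a b : Fin n → Bool),
      π.EncryptsKeys i ca a → π.EncryptsKeys i cb b → ∀ (c : ℂ) (ψ : Ket (Fin n)),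
        π.evaluate (π.clientWeight O s) gs i (c • oneTimePad a b ψ) ca cb =
          ‖c‖ ^ 2 * measProb O (applyGates gs ψ) s := by
  induction gs with
  | nil =>
    intro i hi ca cb a b ha hb c ψ
    exact h.clientWeight_eq hΩ O s (by simpa [tCount] using hi) ha hb c ψ
  | cons g gs ih =>
    intro i hi ca cb a b ha hb c ψ
    have hcount : tCount (g :: gs) = tCount gs + if g.isT then 1 else 0 := by
      rw [tCount, tCount, List.countP_cons]
    rw [hcount] at hi
    have hi' : i + tCount gs ≤ L := by omega
    cases g with
    | cnot u v huv =>
      rw [evaluate, Gate.apply_smul, Gate.apply, applyCNOT_oneTimePad _ _ _ _ huv, applyGates]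
      exact ih i hi' _ _ _ _ (ha.update v (π.encrypts_addCT (ha u) (ha v)))
        (hb.update u (π.encrypts_addCT (hb u) (hb v))) _ _
    | one g w =>
      cases g with
      | X =>
        have := apply1_oneTimePad a b w (X_mul_padMat (a w) (b w)) ψ
        rw [Function.update_eq_self, Function.update_eq_self] at this
        rw [evaluate, Gate.apply_smul, Gate.apply, this, smul_smul, applyGates,
          ih i hi' _ _ _ _ ha hb, norm_mul, norm_sgn, mul_one]
        rfl
      | Z =>
        have := apply1_oneTimePad a b w (Z_mul_padMat (a w) (b w)) ψ
        rw [Function.update_eq_self, Function.update_eq_self] at this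
        rw [evaluate, Gate.apply_smul, Gate.apply, this, smul_smul, applyGates,
          ih i hi' _ _ _ _ ha hb, norm_mul, norm_sgn, mul_one]
        rfl
      | P =>
        have := apply1_oneTimePad a b w (P_mul_padMat (a w) (b w)) ψ
        rw [Function.update_eq_self] at this
        rw [evaluate, Gate.apply_smul, Gate.apply, this, smul_smul, applyGates,
          ih i hi' _ _ _ _ ha (hb.update w (π.encrypts_addCT (ha w) (hb w))), norm_mul]
        have hI : ‖(if a w then Complex.I else 1 : ℂ)‖ = 1 := by split_ifs <;> simp
        rw [hI, mul_one]
        rfl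
      | H =>
        have := apply1_oneTimePad a b w (H_mul_padMat (a w) (b w)) ψ
        rw [evaluate, Gate.apply_smul, Gate.apply, this, smul_smul, applyGates,
          ih i hi' _ _ _ _ (ha.update w (hb w)) (hb.update w (ha w)), norm_mul, norm_sgn, mul_one]
        rfl
      | T =>
        have hiL : i < L := by simp [Gate.isT] at hi; omega
        obtain ⟨z, hz, ht⟩ := π.teleport_oneTimePad h hiL w (ca w) a b
          (by rw [hΩ.2]; exact h.dec_eq hΩ hiL.le (ha w))
        rw [evaluate]
        have hstep : ∀ o, π.evaluate (π.clientWeight O s) gs (i + 1)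
            (π.teleport i w (ca w) o ((Gate.one .T w).apply (c • oneTimePad a b ψ)))
            (π.newKeys i w o ca cb).1 (π.newKeys i w o ca cb).2 =
            ‖z o‖ ^ 2 * (‖c‖ ^ 2 * measProb O (applyGates (.one .T w :: gs) ψ) s) := by
          intro o
          have hk := h.encrypts_newKeys hΩ hiL w o ha hb
          rw [← oneTimePad_smul, ht, Gate.apply_smul, oneTimePad_smul, smul_smul,
            ih (i + 1) (by simp [Gate.isT] at hi; omega) _ _ _ _ hk.1 hk.2, norm_mul, mul_pow,
            mul_assoc]
          rfl
        -- After the `T` gate the law no longer depends on the Bell results, so only their weights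
        -- remain to be summed.
        rw [Finset.sum_congr rfl fun o _ => hstep o, ← Finset.sum_mul, hz, one_mul]

/-- The delegated execution of a gate sequence has exactly the right law. -/
theorem Honest.delegatedProb_eq {π : Prep Ω κ n} {gs : List (Gate n)}
    (h : π.Honest (tCount gs)) (hΩ : Ω.Correct) (ψ : Ket (Fin n)) (O : Fin n → Pauli) (s : Bool) :
    π.delegatedProb gs ψ O s = measProb O (applyGates gs ψ) s := by
  have := h.evaluate_eq hΩ O s gs 0 (by simp) π.encA π.encB π.a π.b
    (fun w => .fresh _ _ (h.encA_mem w)) (fun w => .fresh _ _ (h.encB_mem w)) 1 ψ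
  rw [one_smul, norm_one, one_pow, one_mul] at this
  exact this

end Prep

/-! ## Single-qubit unitaries -/

section SingleQubit

open Matrix
open scoped Matrix.Norms.L2Operator

/-- The matrix of a quaternion. -/
def su (α β : ℂ) : Matrix Bool Bool ℂ :=
  Matrix.of fun i j => cond i (cond j (star α) β) (cond j (-star β) α)

theorem su_mul (α β γ δ : ℂ) :
    su α β * su γ δ = su (α * γ - star β * δ) (β * γ + star α * δ) := by
  ext i j
  rw [Matrix.mul_apply, Fintype.sum_bool]
  cases i <;> cases j <;> simp [su] <;> ring

theorem su_conjTranspose (α β : ℂ) : (su α β)ᴴ = su (star α) (-β) := by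
  ext i j
  cases i <;> cases j <;> simp [su]

theorem su_sub (α β γ δ : ℂ) : su α β - su γ δ = su (α - γ) (β - δ) := by
  ext i j
  cases i <;> cases j <;> simp [su]
  ring

theorem su_neg (α β : ℂ) : -su α β = su (-α) (-β) := by
  ext i j
  cases i <;> cases j <;> simp [su]

theorem su_one : su 1 0 = 1 := by
  ext i j
  cases i <;> cases j <;> simp [su]

theorem su_smul (r : ℝ) (α β : ℂ) : (r : ℂ) • su α β = su (r * α) (r * β) := by
  ext i j
  cases i <;> cases j <;> simp [su]

theorem su_real (r : ℝ) : su r 0 = (r : ℂ) • (1 : Matrix Bool Bool ℂ) := by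
  rw [← su_one, su_smul]; simp

theorem trace_su (α β : ℂ) : (su α β).trace = ((2 * α.re : ℝ) : ℂ) := by
  rw [Matrix.trace, Fintype.sum_bool]
  simp only [Matrix.diag_apply, su, Matrix.of_apply, cond]
  rw [add_comm, Complex.star_def, Complex.add_conj]

theorem su_conjTranspose_mul_self (α β : ℂ) :
    (su α β)ᴴ * su α β = ((‖α‖ ^ 2 + ‖β‖ ^ 2 : ℝ) : ℂ) • (1 : Matrix Bool Bool ℂ) := by
  rw [← su_real, su_conjTranspose, su_mul]
  have h : ∀ z : ℂ, star z * z = ((‖z‖ ^ 2 : ℝ) : ℂ) := fun z => by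
    rw [Complex.star_def, Complex.conj_mul']; push_cast; rfl
  congr 1
  · rw [star_neg, neg_mul, sub_neg_eq_add, h, h]; push_cast; rfl
  · rw [star_star]; ring

theorem su_mem_unitary {α β : ℂ} (h : ‖α‖ ^ 2 + ‖β‖ ^ 2 = 1) :
    su α β ∈ Matrix.unitaryGroup Bool ℂ := by
  rw [Matrix.mem_unitaryGroup_iff', Matrix.star_eq_conjTranspose, su_conjTranspose_mul_self, h]
  simp

/-- The matrix of a quaternion is a multiple of a unitary, so its operator norm is the modulus of
the quaternion. Quaternions are closed under subtraction, hence their distances can be computed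
exactly. -/
theorem norm_su (α β : ℂ) : ‖su α β‖ ^ 2 = ‖α‖ ^ 2 + ‖β‖ ^ 2 := by
  rw [sq, ← Matrix.l2_opNorm_conjTranspose_mul_self, su_conjTranspose_mul_self, norm_smul,
    norm_one, mul_one, Complex.norm_real, Real.norm_of_nonneg (by positivity)]

/-- Every single-qubit unitary is a quaternion up to a phase. -/
theorem exists_su {U : Matrix Bool Bool ℂ} (hU : U ∈ Matrix.unitaryGroup Bool ℂ) :
    ∃ e α β : ℂ, ‖e‖ = 1 ∧ ‖α‖ ^ 2 + ‖β‖ ^ 2 = 1 ∧ U = e • su α β := by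
  have h1 := Matrix.mem_unitaryGroup_iff.1 hU
  have h2 := Matrix.mem_unitaryGroup_iff'.1 hU
  have r := fun i j => congrFun (congrFun h1 i) j
  have c := fun i j => congrFun (congrFun h2 i) j
  simp only [Matrix.mul_apply, Fintype.sum_bool, Matrix.star_apply] at r c
  obtain ⟨a, ha⟩ : ∃ a, U false false = a := ⟨_, rfl⟩
  obtain ⟨b, hb⟩ : ∃ b, U false true = b := ⟨_, rfl⟩
  obtain ⟨p, hp⟩ : ∃ p, U true false = p := ⟨_, rfl⟩
  obtain ⟨d, hd⟩ : ∃ d, U true true = d := ⟨_, rfl⟩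
  have r0 := r false false
  have r1 := r true true
  have c0 := c false false
  have c1 := c true true
  have c01 := c false true
  have c10 := c true false
  simp only [ha, hb, hp, hd, Matrix.one_apply_eq, Matrix.one_apply, Bool.false_eq_true,
    Bool.true_eq_false, if_false] at r0 r1 c0 c1 c01 c10
  -- The inverse of `U` is both its adjoint and its adjugate over the determinant; this expresses
  -- the second row through the first.
  have hd' : d = (a * d - b * p) * star a := by linear_combination (-d) * c0 + p * c01
  have hp' : -p = (a * d - b * p) * star b := by linear_combination p * c1 - d * c10
  obtain ⟨δ, hδ⟩ : ∃ δ, a * d - b * p = δ := ⟨_, rfl⟩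
  rw [hδ] at hd' hp'
  have hn : ∀ z : ℂ, z * star z = ((‖z‖ ^ 2 : ℝ) : ℂ) := fun z => by
    rw [Complex.star_def, Complex.mul_conj']; push_cast; rfl
  have hab : ‖a‖ ^ 2 + ‖b‖ ^ 2 = 1 := by
    rw [hn, hn, ← Complex.ofReal_add] at r0
    rw [add_comm]; exact_mod_cast r0
  have hpd : ‖p‖ ^ 2 + ‖d‖ ^ 2 = 1 := by
    rw [hn, hn, ← Complex.ofReal_add] at r1
    rw [add_comm]; exact_mod_cast r1
  have hδ1 : ‖δ‖ = 1 := by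
    have e1 : ‖p‖ = ‖δ‖ * ‖b‖ := by rw [← norm_neg, hp', norm_mul, norm_star]
    have e2 : ‖d‖ = ‖δ‖ * ‖a‖ := by rw [hd', norm_mul, norm_star]
    rw [e1, e2] at hpd
    have : ‖δ‖ ^ 2 = 1 := by nlinarith
    nlinarith [norm_nonneg δ]
  -- The phase to be split off is a square root of the determinant.
  obtain ⟨e, he⟩ := IsAlgClosed.exists_pow_nat_eq δ (n := 2) (by norm_num)
  replace he := he.symm
  have he1 : ‖e‖ = 1 := by
    have : ‖e‖ ^ 2 = 1 := by rw [← norm_pow, ← he, hδ1]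
    nlinarith [norm_nonneg e]
  have hee : e * star e = 1 := by rw [hn, he1]; norm_num
  refine ⟨e, star e * a, e * -star b, he1, ?_, ?_⟩
  · rw [norm_mul, norm_mul, norm_star, norm_neg, norm_star, he1, one_mul, one_mul, hab]
  · ext i j
    cases i <;> cases j <;> simp only [su, Matrix.smul_apply, Matrix.of_apply, cond, smul_eq_mul,
      ha, hb, hp, hd, star_mul', star_neg, star_star]
    · linear_combination (-a) * hee
    · linear_combination (-b) * hee
    · linear_combination (-1 : ℂ) * hp' - star b * he
    · linear_combination hd' + star a * he

theorem norm_entry_le (N : Matrix Bool Bool ℂ) (i j : Bool) : ‖N i j‖ ≤ ‖N‖ := by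
  have h := Matrix.l2_opNorm_mulVec N (EuclideanSpace.single j (1 : ℂ))
  rw [PiLp.norm_single, norm_one, mul_one] at h
  refine le_trans ?_ h
  have := PiLp.norm_apply_le (WithLp.toLp 2 (N *ᵥ (EuclideanSpace.single j (1 : ℂ)))) i
  simpa using this

theorem norm_trace_le (N : Matrix Bool Bool ℂ) : ‖N.trace‖ ≤ 2 * ‖N‖ := by
  rw [Matrix.trace, Fintype.sum_bool]
  refine (norm_add_le _ _).trans ?_
  have h1 := norm_entry_le N true true
  have h2 := norm_entry_le N false false
  simp only [Matrix.diag_apply]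
  linarith

theorem norm_unitary_mul {U : Matrix Bool Bool ℂ} (hU : U ∈ Matrix.unitaryGroup Bool ℂ)
    (M : Matrix Bool Bool ℂ) : ‖U * M‖ = ‖M‖ :=
  CStarRing.norm_mem_unitary_mul M hU

theorem norm_mul_unitary {U : Matrix Bool Bool ℂ} (hU : U ∈ Matrix.unitaryGroup Bool ℂ)
    (M : Matrix Bool Bool ℂ) : ‖M * U‖ = ‖M‖ :=
  CStarRing.norm_mul_mem_unitary M hU

theorem conjTranspose_mem_unitary {U : Matrix Bool Bool ℂ}
    (hU : U ∈ Matrix.unitaryGroup Bool ℂ) : Uᴴ ∈ Matrix.unitaryGroup Bool ℂ :=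
  Unitary.star_mem hU

theorem conjTranspose_mul_self_of_unitary {U : Matrix Bool Bool ℂ}
    (hU : U ∈ Matrix.unitaryGroup Bool ℂ) : Uᴴ * U = 1 := Matrix.mem_unitaryGroup_iff'.1 hU

theorem self_mul_conjTranspose_of_unitary {U : Matrix Bool Bool ℂ}
    (hU : U ∈ Matrix.unitaryGroup Bool ℂ) : U * Uᴴ = 1 := Matrix.mem_unitaryGroup_iff.1 hU

theorem norm_sub_smul_eq {U V : Matrix Bool Bool ℂ} (hU : U ∈ Matrix.unitaryGroup Bool ℂ)
    (c : ℂ) : ‖U - c • V‖ = ‖1 - c • (Uᴴ * V)‖ := by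
  rw [← norm_unitary_mul (conjTranspose_mem_unitary hU) (U - c • V), mul_sub,
    conjTranspose_mul_self_of_unitary hU, Matrix.mul_smul]

/-- The distance modulo a phase is attained. -/
theorem exists_phase_norm_sub_le {U V : Matrix Bool Bool ℂ}
    (hU : U ∈ Matrix.unitaryGroup Bool ℂ) (hV : V ∈ Matrix.unitaryGroup Bool ℂ) :
    ∃ c : ℂ, ‖c‖ = 1 ∧ ‖U - c • V‖ ≤ phaseDist U V := by
  obtain ⟨e, α, β, he, hαβ, h⟩ := exists_su (mul_mem (conjTranspose_mem_unitary hU) hV)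
  have hee : star e * e = 1 := by
    rw [Complex.star_def, Complex.conj_mul', he]; norm_num
  have hre : ‖α‖ ^ 2 = α.re ^ 2 + α.im ^ 2 := by
    rw [Complex.sq_norm, Complex.normSq_apply]; ring
  have htr : ‖(Uᴴ * V).trace‖ = 2 * |α.re| := by
    rw [h, Matrix.trace_smul, trace_su, norm_smul, he, one_mul, Complex.norm_real, Real.norm_eq_abs,
      abs_mul, abs_two]
  -- A quaternion is determined up to sign; the sign `s` making the real part nonnegative gives the
  -- squared distance `2 - 2 * |α.re|` from the identity.
  have hsq : ∀ s : ℝ, s ^ 2 = 1 → s * α.re = |α.re| →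
      ‖(1 : Matrix Bool Bool ℂ) - ((s : ℂ) * star e) • (Uᴴ * V)‖ ≤ phaseDist U V := by
    intro s hs hs'
    rw [h, smul_smul, mul_assoc, hee, mul_one, su_smul, ← su_one, su_sub, phaseDist, htr]
    apply Real.le_sqrt_of_sq_le
    rw [norm_su, zero_sub, norm_neg, norm_mul, Complex.norm_real, mul_pow, Real.norm_eq_abs, sq_abs,
      hs, Complex.sq_norm, Complex.normSq_apply]
    simp only [Complex.sub_re, Complex.one_re, Complex.mul_re, Complex.ofReal_re,
      Complex.ofReal_im, zero_mul, sub_zero, Complex.sub_im, Complex.one_im, Complex.mul_im,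
      add_zero]
    nlinarith
  rcases le_total 0 α.re with h0 | h0
  · refine ⟨((1 : ℝ) : ℂ) * star e, by simp [he], ?_⟩
    rw [norm_sub_smul_eq hU]
    exact hsq 1 (by norm_num) (by rw [abs_of_nonneg h0, one_mul])
  · refine ⟨((-1 : ℝ) : ℂ) * star e, by simp [he], ?_⟩
    rw [norm_sub_smul_eq hU]
    exact hsq (-1) (by norm_num) (by rw [abs_of_nonpos h0]; ring)

/-- The norm of `(1 - W)ᴴ * (1 - W)` is at least half its trace, that is at least `2 - Re tr W`, and
the real part is at most the modulus. -/
theorem phaseDist_le_norm_sub {U V : Matrix Bool Bool ℂ}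
    (hU : U ∈ Matrix.unitaryGroup Bool ℂ) (hV : V ∈ Matrix.unitaryGroup Bool ℂ) {c : ℂ}
    (hc : ‖c‖ = 1) : phaseDist U V ≤ ‖U - c • V‖ := by
  rw [norm_sub_smul_eq hU]
  have hW : c • (Uᴴ * V) ∈ Matrix.unitaryGroup Bool ℂ := by
    rw [Matrix.mem_unitaryGroup_iff', Matrix.star_eq_conjTranspose, Matrix.conjTranspose_smul,
      Matrix.smul_mul, Matrix.mul_smul, smul_smul, conjTranspose_mul_self_of_unitary
        (mul_mem (conjTranspose_mem_unitary hU) hV), Complex.star_def, Complex.conj_mul', hc]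
    simp
  have htr : ‖(Uᴴ * V).trace‖ = ‖(c • (Uᴴ * V)).trace‖ := by
    rw [Matrix.trace_smul, norm_smul, hc, one_mul]
  rw [phaseDist, htr]
  obtain ⟨W, hWe⟩ : ∃ W, c • (Uᴴ * V) = W := ⟨_, rfl⟩
  rw [hWe] at hW ⊢
  apply Real.sqrt_le_iff.2 ⟨norm_nonneg _, ?_⟩
  rw [sq, ← Matrix.l2_opNorm_conjTranspose_mul_self]
  have h1 : (1 - W)ᴴ * (1 - W) = (2 : ℂ) • 1 - W - Wᴴ := by
    rw [Matrix.conjTranspose_sub, Matrix.conjTranspose_one, sub_mul, mul_sub, mul_sub,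
      conjTranspose_mul_self_of_unitary hW, two_smul]
    simp only [one_mul, mul_one]
    abel
  have h2 := norm_trace_le ((1 - W)ᴴ * (1 - W))
  have h3 : (((1 - W)ᴴ * (1 - W)).trace).re = 4 - 2 * W.trace.re := by
    rw [h1, Matrix.trace_sub, Matrix.trace_sub, Matrix.trace_conjTranspose, Matrix.trace_smul,
      Matrix.trace_one]
    simp
    ring
  have h4 := Complex.re_le_norm (((1 - W)ᴴ * (1 - W)).trace)
  have h5 := Complex.re_le_norm W.trace
  linarith

/-! ## Words -/

theorem rsqrt2_real : (1 / Real.sqrt 2) ^ 2 = (1 / 2 : ℝ) := by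
  rw [div_pow, Real.sq_sqrt (by norm_num)]; norm_num

theorem phaseMat_mem_unitary {c : ℂ} (hc : ‖c‖ = 1) :
    phaseMat c ∈ Matrix.unitaryGroup Bool ℂ := by
  rw [Matrix.mem_unitaryGroup_iff', Matrix.star_eq_conjTranspose, phaseMat,
    Matrix.diagonal_conjTranspose, Matrix.diagonal_mul_diagonal, ← Matrix.diagonal_one]
  congr 1
  funext b
  cases b
  · simp
  · simp [Complex.conj_mul', hc]

theorem norm_T_phase : ‖Complex.exp (Complex.I * (Real.pi / 4 : ℝ))‖ = 1 := by
  rw [mul_comm, Complex.norm_exp_ofReal_mul_I]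

theorem Gate1.mat_mem_unitary (g : Gate1) : g.mat ∈ Matrix.unitaryGroup Bool ℂ := by
  cases g with
  | X =>
    rw [Matrix.mem_unitaryGroup_iff']
    ext i j
    cases i <;> cases j <;> simp [Gate1.mat, Matrix.mul_apply]
  | Z => exact phaseMat_mem_unitary (by simp)
  | P => exact phaseMat_mem_unitary (by simp)
  | H =>
    rw [Matrix.mem_unitaryGroup_iff']
    ext i j
    have h := rsqrt2_mul_self
    have h' : (starRingEnd ℂ) rsqrt2 = rsqrt2 := star_rsqrt2
    cases i <;> cases j <;> simp [Gate1.mat, Matrix.mul_apply, sgn, h, h']; norm_num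
  | T => exact phaseMat_mem_unitary norm_T_phase

theorem wordMat_mem_unitary (u : List Gate1) : wordMat u ∈ Matrix.unitaryGroup Bool ℂ := by
  induction u with
  | nil => exact one_mem _
  | cons g u ih => exact mul_mem ih g.mat_mem_unitary

theorem wordMat_append (u v : List Gate1) : wordMat (u ++ v) = wordMat v * wordMat u := by
  induction u with
  | nil => simp [wordMat]
  | cons g u ih => rw [List.cons_append, wordMat, ih, wordMat, mul_assoc]

theorem Gate1.wordMat_inv (g : Gate1) : wordMat g.inv = g.matᴴ := by
  cases g with
  | X =>
    ext i j
    cases i <;> cases j <;> simp [Gate1.inv, wordMat, Gate1.mat]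
  | Z =>
    ext i j
    cases i <;> cases j <;> simp [Gate1.inv, wordMat, Gate1.mat, phaseMat]
  | P =>
    ext i j
    cases i <;> cases j <;> simp [Gate1.inv, wordMat, Gate1.mat, phaseMat]
  | H =>
    ext i j
    have h' : (starRingEnd ℂ) rsqrt2 = rsqrt2 := star_rsqrt2
    cases i <;> cases j <;> simp [Gate1.inv, wordMat, Gate1.mat, sgn, h']
  | T =>
    have hω : Complex.exp (Complex.I * (Real.pi / 4 : ℝ)) *
        Complex.exp (Complex.I * (Real.pi / 4 : ℝ)) = Complex.I := by
      rw [← Complex.exp_add, ← mul_add, ← Complex.ofReal_add,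
        show Real.pi / 4 + Real.pi / 4 = Real.pi / 2 by ring, mul_comm]
      push_cast
      exact Complex.exp_pi_div_two_mul_I
    have hn := norm_T_phase
    simp only [Gate1.inv, wordMat, Gate1.mat]
    generalize Complex.exp (Complex.I * (Real.pi / 4 : ℝ)) = ω at hω hn
    have h1 : (starRingEnd ℂ) ω * ω = 1 := by rw [Complex.conj_mul', hn]; norm_num
    have h2 : -(Complex.I * ω) = (starRingEnd ℂ) ω := by
      rw [← hω, ← one_mul ((starRingEnd ℂ) ω)]
      have h3 : (ω * ω) * (ω * ω) = -1 := by rw [hω, Complex.I_mul_I]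
      linear_combination (ω * ω * ω) * h1 - (starRingEnd ℂ) ω * h3
    ext i j
    cases i <;> cases j <;> simp [phaseMat, h2]

theorem wordMat_inv (u : List Gate1) : wordMat (wordInv u) = (wordMat u)ᴴ := by
  induction u with
  | nil => simp [wordInv, wordMat]
  | cons g u ih =>
    rw [wordInv, List.reverse_cons, List.flatMap_append, wordMat_append, wordMat,
      Matrix.conjTranspose_mul, ← ih]
    simp [Gate1.wordMat_inv, wordInv]

theorem length_wordInv_le (u : List Gate1) : (wordInv u).length ≤ 3 * u.length := by
  induction u with
  | nil => simp [wordInv]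
  | cons g u ih =>
    have : (wordInv (g :: u)).length = (wordInv u).length + g.inv.length := by
      simp [wordInv]
    rw [this, List.length_cons]
    have : g.inv.length ≤ 3 := by cases g <;> simp [Gate1.inv]
    omega

end SingleQubit

/-! ## Group commutators -/

section Commutators

open Matrix
open scoped Matrix.Norms.L2Operator

/-- The group commutator of two unitaries. -/
def gcomm (V W : Matrix Bool Bool ℂ) : Matrix Bool Bool ℂ := V * W * Vᴴ * Wᴴ

theorem gcomm_smul_left {c : ℂ} (hc : ‖c‖ = 1) (V W : Matrix Bool Bool ℂ) :
    gcomm (c • V) W = gcomm V W := by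
  have : c * star c = 1 := by rw [Complex.star_def, Complex.mul_conj', hc]; norm_num
  simp only [gcomm, Matrix.conjTranspose_smul, Matrix.smul_mul, Matrix.mul_smul, smul_smul, this,
    mul_comm (star c), one_smul]

theorem gcomm_smul_right {c : ℂ} (hc : ‖c‖ = 1) (V W : Matrix Bool Bool ℂ) :
    gcomm V (c • W) = gcomm V W := by
  have : c * star c = 1 := by rw [Complex.star_def, Complex.mul_conj', hc]; norm_num
  simp only [gcomm, Matrix.conjTranspose_smul, Matrix.smul_mul, Matrix.mul_smul, smul_smul, this,
    mul_comm (star c), one_smul]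

theorem norm_of_unitary {U : Matrix Bool Bool ℂ} (hU : U ∈ Matrix.unitaryGroup Bool ℂ) :
    ‖U‖ = 1 := by
  rw [← mul_one U, norm_unitary_mul hU, norm_one]

/-- The commutator differs from the identity by `(VW - WV)VᴴWᴴ`, and `VW - WV` is bilinear in `V -
1` and `W - 1`. Thus an error `ε` of a factor enters to first order only multiplied by `a`. -/
theorem norm_gcomm_sub_le {V W v w : Matrix Bool Bool ℂ} {a ε : ℝ}
    (hV : V ∈ Matrix.unitaryGroup Bool ℂ) (hW : W ∈ Matrix.unitaryGroup Bool ℂ)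
    (hv : v ∈ Matrix.unitaryGroup Bool ℂ) (hw : w ∈ Matrix.unitaryGroup Bool ℂ)
    (hVa : ‖V - 1‖ ≤ a) (hWa : ‖W - 1‖ ≤ a) (hvV : ‖v - V‖ ≤ ε) (hwW : ‖w - W‖ ≤ ε) :
    ‖gcomm v w - gcomm V W‖ ≤ 4 * a * ε + 2 * ε ^ 2 + 4 * a ^ 2 * ε := by
  have ha : 0 ≤ a := (norm_nonneg _).trans hVa
  have hε : 0 ≤ ε := (norm_nonneg _).trans hvV
  have hw1 : ‖w - 1‖ ≤ a + ε := by
    have := norm_add_le (W - 1) (w - W)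
    rw [show W - 1 + (w - W) = w - 1 by abel] at this
    linarith
  have hv1 : ‖v - 1‖ ≤ a + ε := by
    have := norm_add_le (V - 1) (v - V)
    rw [show V - 1 + (v - V) = v - 1 by abel] at this
    linarith
  have hcomm : ∀ X Y : Matrix Bool Bool ℂ, X ∈ Matrix.unitaryGroup Bool ℂ →
      Y ∈ Matrix.unitaryGroup Bool ℂ → gcomm X Y = 1 + (X * Y - Y * X) * (Xᴴ * Yᴴ) := by
    intro X Y hX hY
    have h1 : Y * X * (Xᴴ * Yᴴ) = 1 := by
      rw [mul_assoc, ← mul_assoc X, self_mul_conjTranspose_of_unitary hX, one_mul,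
        self_mul_conjTranspose_of_unitary hY]
    rw [sub_mul, h1, gcomm, ← mul_assoc (X * Y)]; abel
  have hsplit : gcomm v w - gcomm V W =
      ((v * w - w * v) - (V * W - W * V)) * (vᴴ * wᴴ) +
        (V * W - W * V) * (vᴴ * wᴴ - Vᴴ * Wᴴ) := by
    rw [hcomm v w hv hw, hcomm V W hV hW]; noncomm_ring
  have h1 : ‖(v * w - w * v) - (V * W - W * V)‖ ≤ 4 * a * ε + 2 * ε ^ 2 := by
    -- The difference of the additive commutators is `[v - V, w] + [V, w - W]`, in which the
    -- undisturbed factors may be shifted by the identity.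
    have e : (v * w - w * v) - (V * W - W * V) =
        ((v - V) * (w - 1) + (V - 1) * (w - W)) -
          ((w - 1) * (v - V) + (w - W) * (V - 1)) := by noncomm_ring
    rw [e]
    have t1 : ‖(v - V) * (w - 1)‖ ≤ ε * (a + ε) :=
      (norm_mul_le _ _).trans (mul_le_mul hvV hw1 (norm_nonneg _) hε)
    have t2 : ‖(V - 1) * (w - W)‖ ≤ a * ε :=
      (norm_mul_le _ _).trans (mul_le_mul hVa hwW (norm_nonneg _) ha)
    have t3 : ‖(w - 1) * (v - V)‖ ≤ (a + ε) * ε :=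
      (norm_mul_le _ _).trans (mul_le_mul hw1 hvV (norm_nonneg _) (by linarith))
    have t4 : ‖(w - W) * (V - 1)‖ ≤ ε * a :=
      (norm_mul_le _ _).trans (mul_le_mul hwW hVa (norm_nonneg _) hε)
    have s1 := norm_sub_le ((v - V) * (w - 1) + (V - 1) * (w - W))
      ((w - 1) * (v - V) + (w - W) * (V - 1))
    have s2 := norm_add_le ((v - V) * (w - 1)) ((V - 1) * (w - W))
    have s3 := norm_add_le ((w - 1) * (v - V)) ((w - W) * (V - 1))
    nlinarith
  have h2 : ‖V * W - W * V‖ ≤ 2 * a ^ 2 := by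
    have e : V * W - W * V = (V - 1) * (W - 1) - (W - 1) * (V - 1) := by noncomm_ring
    rw [e]
    have t1 : ‖(V - 1) * (W - 1)‖ ≤ a * a :=
      (norm_mul_le _ _).trans (mul_le_mul hVa hWa (norm_nonneg _) ha)
    have t2 : ‖(W - 1) * (V - 1)‖ ≤ a * a :=
      (norm_mul_le _ _).trans (mul_le_mul hWa hVa (norm_nonneg _) ha)
    have s1 := norm_sub_le ((V - 1) * (W - 1)) ((W - 1) * (V - 1))
    nlinarith
  have h3 : ‖vᴴ * wᴴ - Vᴴ * Wᴴ‖ ≤ 2 * ε := by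
    have e : vᴴ * wᴴ - Vᴴ * Wᴴ = (v - V)ᴴ * wᴴ + Vᴴ * (w - W)ᴴ := by
      rw [Matrix.conjTranspose_sub, Matrix.conjTranspose_sub]; noncomm_ring
    rw [e]
    have s := norm_add_le ((v - V)ᴴ * wᴴ) (Vᴴ * (w - W)ᴴ)
    rw [norm_mul_unitary (conjTranspose_mem_unitary hw),
      norm_unitary_mul (conjTranspose_mem_unitary hV), Matrix.l2_opNorm_conjTranspose,
      Matrix.l2_opNorm_conjTranspose] at s
    linarith
  rw [hsplit]
  have s := norm_add_le (((v * w - w * v) - (V * W - W * V)) * (vᴴ * wᴴ))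
    ((V * W - W * V) * (vᴴ * wᴴ - Vᴴ * Wᴴ))
  rw [norm_mul_unitary (mul_mem (conjTranspose_mem_unitary hv) (conjTranspose_mem_unitary hw))] at s
  have t : ‖(V * W - W * V) * (vᴴ * wᴴ - Vᴴ * Wᴴ)‖ ≤ 2 * a ^ 2 * (2 * ε) :=
    (norm_mul_le _ _).trans (mul_le_mul h2 h3 (norm_nonneg _) (by positivity))
  linarith

theorem smul_mem_unitary {c : ℂ} (hc : ‖c‖ = 1) {U : Matrix Bool Bool ℂ}
    (hU : U ∈ Matrix.unitaryGroup Bool ℂ) : c • U ∈ Matrix.unitaryGroup Bool ℂ := by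
  rw [Matrix.mem_unitaryGroup_iff', Matrix.star_eq_conjTranspose, Matrix.conjTranspose_smul,
    Matrix.smul_mul, Matrix.mul_smul, smul_smul, conjTranspose_mul_self_of_unitary hU,
    Complex.star_def, Complex.conj_mul', hc]
  simp

theorem star_mul_self_of_norm_one {c : ℂ} (hc : ‖c‖ = 1) : star c * c = 1 := by
  rw [Complex.star_def, Complex.conj_mul', hc]; norm_num

theorem norm_star_smul_sub {c : ℂ} (hc : ‖c‖ = 1) (M N : Matrix Bool Bool ℂ) :
    ‖star c • M - N‖ = ‖M - c • N‖ := by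
  have h : M - c • N = c • (star c • M - N) := by
    rw [smul_sub, smul_smul, mul_comm, star_mul_self_of_norm_one hc, one_smul]
  rw [h, norm_smul, hc, one_mul]

/-- As `norm_gcomm_sub_le`, everything up to phases. -/
theorem norm_gcomm_sub_le_of_phases {V W v w : Matrix Bool Bool ℂ} {a ε : ℝ} {c₁ c₂ c₃ c₄ : ℂ}
    (hc₁ : ‖c₁‖ = 1) (hc₂ : ‖c₂‖ = 1) (hc₃ : ‖c₃‖ = 1) (hc₄ : ‖c₄‖ = 1)
    (hV : V ∈ Matrix.unitaryGroup Bool ℂ) (hW : W ∈ Matrix.unitaryGroup Bool ℂ)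
    (hv : v ∈ Matrix.unitaryGroup Bool ℂ) (hw : w ∈ Matrix.unitaryGroup Bool ℂ)
    (hVa : ‖V - c₁ • (1 : Matrix Bool Bool ℂ)‖ ≤ a)
    (hWa : ‖W - c₂ • (1 : Matrix Bool Bool ℂ)‖ ≤ a) (hvV : ‖v - c₃ • V‖ ≤ ε)
    (hwW : ‖w - c₄ • W‖ ≤ ε) :
    ‖gcomm v w - gcomm V W‖ ≤ 4 * a * ε + 2 * ε ^ 2 + 4 * a ^ 2 * ε := by
  have n : ∀ {c : ℂ}, ‖c‖ = 1 → ‖star c‖ = 1 := fun h => by rw [norm_star, h]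
  -- All phases are moved into the factors, which the group commutator does not see.
  have key := norm_gcomm_sub_le (V := star c₁ • V) (W := star c₂ • W)
    (v := star c₁ • star c₃ • v) (w := star c₂ • star c₄ • w) (a := a) (ε := ε)
    (smul_mem_unitary (n hc₁) hV) (smul_mem_unitary (n hc₂) hW)
    (smul_mem_unitary (n hc₁) (smul_mem_unitary (n hc₃) hv))
    (smul_mem_unitary (n hc₂) (smul_mem_unitary (n hc₄) hw))
    (by rwa [norm_star_smul_sub hc₁]) (by rwa [norm_star_smul_sub hc₂])
    (by rwa [← smul_sub, norm_smul, n hc₁, one_mul, norm_star_smul_sub hc₃])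
    (by rwa [← smul_sub, norm_smul, n hc₂, one_mul, norm_star_smul_sub hc₄])
  rwa [gcomm_smul_left (n hc₁), gcomm_smul_left (n hc₃), gcomm_smul_right (n hc₂),
    gcomm_smul_right (n hc₄), gcomm_smul_left (n hc₁), gcomm_smul_right (n hc₂)] at key

/-! ## Balanced commutators exist -/

theorem sq_norm_eq (z : ℂ) : ‖z‖ ^ 2 = z.re ^ 2 + z.im ^ 2 := by
  rw [Complex.sq_norm, Complex.normSq_apply]; ring

theorem su_smul_eq (r : ℝ) (α β : ℂ) : su (r * α) (r * β) = (r : ℂ) • su α β :=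
  (su_smul r α β).symm

/-- Diagonalisation of a unit quaternion. -/
theorem exists_su_conj_diagonal {α β : ℂ} (h : ‖α‖ ^ 2 + ‖β‖ ^ 2 = 1) :
    ∃ P ∈ Matrix.unitaryGroup Bool ℂ,
      su α β * P = P * su ⟨α.re, Real.sqrt (1 - α.re ^ 2)⟩ 0 := by
  obtain ⟨r, hr⟩ : ∃ r, Real.sqrt (1 - α.re ^ 2) = r := ⟨_, rfl⟩
  have hα := sq_norm_eq α
  have hr0 : 0 ≤ r := hr ▸ Real.sqrt_nonneg _
  have hr2 : r ^ 2 = α.im ^ 2 + ‖β‖ ^ 2 := by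
    rw [← hr, Real.sq_sqrt] <;> nlinarith [sq_nonneg α.im, sq_nonneg ‖β‖]
  rw [hr]
  have hbb : star β * β = ((‖β‖ ^ 2 : ℝ) : ℂ) := by
    rw [Complex.star_def, Complex.conj_mul']; push_cast; rfl
  -- For pure quaternions `u`, `v` of equal norm, `u² = v²` gives `u (u + v) = (u + v) v`, so the
  -- normalised sum conjugates one to the other. It vanishes only for `u = -v`, where the quaternion
  -- `su 0 1` does the job.
  by_cases hz : α.im + r = 0 ∧ β = 0
  · obtain ⟨h1, rfl⟩ := hz
    refine ⟨su 0 1, su_mem_unitary (by simp), ?_⟩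
    rw [su_mul, su_mul]
    congr 1
    · simp
    · apply Complex.ext <;> simp; linarith
  · obtain ⟨s, hs⟩ : ∃ s, (α.im + r) ^ 2 + ‖β‖ ^ 2 = s := ⟨_, rfl⟩
    have hs0 : 0 < s := by
      rw [← hs]
      by_contra hneg
      have h1 : α.im + r = 0 := by nlinarith [sq_nonneg (α.im + r), sq_nonneg ‖β‖]
      have h2 : ‖β‖ = 0 := by nlinarith [sq_nonneg (α.im + r), sq_nonneg ‖β‖]
      exact hz ⟨h1, norm_eq_zero.1 h2⟩
    have hcomm : su α β * su ⟨0, α.im + r⟩ β = su ⟨0, α.im + r⟩ β * su ⟨α.re, r⟩ 0 := by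
      rw [su_mul, su_mul, hbb]
      congr 1
      · apply Complex.ext <;> simp [-Complex.ofReal_pow]
        · linarith
        · ring
      · apply Complex.ext <;> simp <;> ring
    refine ⟨su (((1 / Real.sqrt s : ℝ) : ℂ) * ⟨0, α.im + r⟩) (((1 / Real.sqrt s : ℝ) : ℂ) * β),
      su_mem_unitary ?_, ?_⟩
    · rw [norm_mul, norm_mul, mul_pow, mul_pow, ← mul_add, Complex.norm_real, Real.norm_eq_abs,
        sq_abs, sq_norm_eq ⟨0, _⟩, div_pow, Real.sq_sqrt hs0.le]
      simp only
      rw [← hs] at hs0 ⊢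
      field_simp
      ring
    · rw [su_smul_eq, Matrix.mul_smul, hcomm, Matrix.smul_mul]

/-- Unit quaternions with equal real parts are conjugate. -/
theorem exists_su_conj {α β γ δ : ℂ} (h : ‖α‖ ^ 2 + ‖β‖ ^ 2 = 1) (h' : ‖γ‖ ^ 2 + ‖δ‖ ^ 2 = 1)
    (hre : α.re = γ.re) :
    ∃ P ∈ Matrix.unitaryGroup Bool ℂ, su α β = P * su γ δ * Pᴴ := by
  obtain ⟨P, hP, e⟩ := exists_su_conj_diagonal h
  obtain ⟨Q, hQ, e'⟩ := exists_su_conj_diagonal h'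
  rw [hre] at e
  obtain ⟨D, hD⟩ : ∃ D, su ⟨γ.re, Real.sqrt (1 - γ.re ^ 2)⟩ 0 = D := ⟨_, rfl⟩
  rw [hD] at e e'
  refine ⟨P * Qᴴ, mul_mem hP (conjTranspose_mem_unitary hQ), ?_⟩
  have h1 : su α β = P * D * Pᴴ := by
    rw [← e, mul_assoc, self_mul_conjTranspose_of_unitary hP, mul_one]
  have h2 : D = Qᴴ * su γ δ * Q := by
    rw [mul_assoc, e', ← mul_assoc, conjTranspose_mul_self_of_unitary hQ, one_mul]
  rw [h1, h2, Matrix.conjTranspose_mul, Matrix.conjTranspose_conjTranspose]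
  simp only [mul_assoc]

theorem gcomm_conj {P : Matrix Bool Bool ℂ} (hP : P ∈ Matrix.unitaryGroup Bool ℂ)
    (V W : Matrix Bool Bool ℂ) : gcomm (P * V * Pᴴ) (P * W * Pᴴ) = P * gcomm V W * Pᴴ := by
  have h : ∀ M : Matrix Bool Bool ℂ, Pᴴ * (P * M) = M := fun M => by
    rw [← mul_assoc, conjTranspose_mul_self_of_unitary hP, one_mul]
  simp only [gcomm, Matrix.conjTranspose_mul, Matrix.conjTranspose_conjTranspose, mul_assoc, h]

theorem phaseDist_conj_one {P : Matrix Bool Bool ℂ} (hP : P ∈ Matrix.unitaryGroup Bool ℂ)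
    (V : Matrix Bool Bool ℂ) : phaseDist (P * V * Pᴴ) 1 = phaseDist V 1 := by
  rw [phaseDist, phaseDist, mul_one, mul_one, Matrix.trace_conjTranspose,
    Matrix.trace_conjTranspose, mul_assoc, Matrix.trace_mul_comm, mul_assoc,
    conjTranspose_mul_self_of_unitary hP, mul_one]

theorem phaseDist_su_one (α β : ℂ) : phaseDist (su α β) 1 = Real.sqrt (2 - 2 * |α.re|) := by
  rw [phaseDist, mul_one, Matrix.trace_conjTranspose, norm_star, trace_su, Complex.norm_real,
    Real.norm_eq_abs, abs_mul, abs_two]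

/-- Two rotations with equal half-angle of sine `S` about perpendicular axes have a commutator of
real part `1 - 2 * S ^ 4`. Since `δ ^ 2 = 2 - 2 * α.re`, the choice `S ^ 2 = δ / 2` matches the real
part of `D`, and unit quaternions with equal real parts are conjugate. -/
theorem exists_isBalancedCommutator {D : Matrix Bool Bool ℂ}
    (hD : D ∈ Matrix.unitaryGroup Bool ℂ) : ∃ VW, IsBalancedCommutator D VW := by
  obtain ⟨e, α, β, he, hαβ, hDe, hre⟩ : ∃ e α β : ℂ, ‖e‖ = 1 ∧ ‖α‖ ^ 2 + ‖β‖ ^ 2 = 1 ∧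
      D = e • su α β ∧ 0 ≤ α.re := by
    obtain ⟨e, α, β, he, hαβ, h⟩ := exists_su hD
    rcases le_total 0 α.re with h0 | h0
    · exact ⟨e, α, β, he, hαβ, h, h0⟩
    · refine ⟨-e, -α, -β, by rwa [norm_neg], by rwa [norm_neg, norm_neg], ?_, by simpa using h0⟩
      rw [← su_neg, neg_smul, smul_neg, neg_neg, h]
  have hδ2 : phaseDist D 1 ^ 2 = 2 - 2 * α.re := by
    have : phaseDist D 1 = phaseDist (su α β) 1 := by
      rw [phaseDist, phaseDist, mul_one, mul_one, hDe, Matrix.trace_conjTranspose,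
        Matrix.trace_conjTranspose, Matrix.trace_smul, norm_star, norm_star, norm_smul, he, one_mul]
    have h1 : α.re ^ 2 ≤ 1 := by
      have := sq_norm_eq α
      nlinarith [sq_nonneg α.im, sq_nonneg ‖β‖]
    rw [this, phaseDist_su_one, abs_of_nonneg hre, Real.sq_sqrt (by nlinarith)]
  obtain ⟨δ, hδ⟩ : ∃ δ, phaseDist D 1 = δ := ⟨_, rfl⟩
  rw [hδ] at hδ2
  have hδ0 : 0 ≤ δ := hδ ▸ Real.sqrt_nonneg _
  have hδ1 : δ ≤ 2 := by nlinarith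
  obtain ⟨S, hS⟩ : ∃ S, Real.sqrt (δ / 2) = S := ⟨_, rfl⟩
  obtain ⟨C, hC⟩ : ∃ C, Real.sqrt (1 - δ / 2) = C := ⟨_, rfl⟩
  have hS2 : S ^ 2 = δ / 2 := by rw [← hS, Real.sq_sqrt (by linarith)]
  have hC2 : C ^ 2 = 1 - δ / 2 := by rw [← hC, Real.sq_sqrt (by linarith)]
  have hC0 : 0 ≤ C := hC ▸ Real.sqrt_nonneg _
  have hC1 : C ≤ 1 := by nlinarith
  have hn : ∀ x y : ℝ, ‖(⟨x, y⟩ : ℂ)‖ ^ 2 = x ^ 2 + y ^ 2 := fun x y => sq_norm_eq ⟨x, y⟩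
  have hV := su_mem_unitary (α := ⟨C, 0⟩) (β := ⟨0, -S⟩) (by rw [hn, hn]; linarith)
  have hW := su_mem_unitary (α := ⟨C, 0⟩) (β := ⟨S, 0⟩) (by rw [hn, hn]; linarith)
  obtain ⟨γ, ε, hγε, hγre⟩ : ∃ γ ε : ℂ,
      gcomm (su ⟨C, 0⟩ ⟨0, -S⟩) (su ⟨C, 0⟩ ⟨S, 0⟩) = su γ ε ∧ γ.re = α.re := by
    refine ⟨_, _, by rw [gcomm, su_conjTranspose, su_conjTranspose, su_mul, su_mul, su_mul], ?_⟩
    simp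
    have e1 : C ^ 2 + S ^ 2 = 1 := by linarith
    have e2 : α.re = 1 - 2 * (S ^ 2) ^ 2 := by rw [hS2]; nlinarith
    rw [e2]
    linear_combination (C ^ 2 + S ^ 2 + 1) * e1
  have hγε1 : ‖γ‖ ^ 2 + ‖ε‖ ^ 2 = 1 := by
    rw [← norm_su, ← hγε, gcomm, norm_of_unitary, one_pow]
    exact mul_mem (mul_mem (mul_mem hV hW) (conjTranspose_mem_unitary hV))
      (conjTranspose_mem_unitary hW)
  obtain ⟨P, hP, hPe⟩ := exists_su_conj hαβ hγε1 hγre.symm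
  have hPt := conjTranspose_mem_unitary hP
  -- From `0 ≤ C ≤ 1` follows `C ≥ C ^ 2 = 1 - δ / 2`.
  have hdist : Real.sqrt (2 - 2 * |C|) ≤ Real.sqrt δ := by
    apply Real.sqrt_le_sqrt
    rw [abs_of_nonneg hC0]
    nlinarith
  refine ⟨(P * su ⟨C, 0⟩ ⟨0, -S⟩ * Pᴴ, P * su ⟨C, 0⟩ ⟨S, 0⟩ * Pᴴ),
    mul_mem (mul_mem hP hV) hPt, mul_mem (mul_mem hP hW) hPt, ⟨e, he, ?_⟩, ?_, ?_⟩
  · rw [hDe, hPe, ← hγε, ← gcomm_conj hP, gcomm]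
  · rw [phaseDist_conj_one hP, phaseDist_su_one, hδ]; exact hdist
  · rw [phaseDist_conj_one hP, phaseDist_su_one, hδ]; exact hdist

/-! ## The recursion -/

/-- The inverse of a gate needs up to three gates (that of `T` does), so the five parts count `1 + 3
+ 3 + 1 + 1 = 9`. -/
theorem solovayKitaev_length {l : ℕ} (d : ℕ) (U : Matrix Bool Bool ℂ) :
    (solovayKitaev l d U).length ≤ l * 9 ^ d := by
  induction d generalizing U with
  | zero => simpa [solovayKitaev, baseApprox] using (exists_nearest l U).choose_spec.1
  | succ d ih =>
    simp only [solovayKitaev, List.length_append]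
    have h1 := ih U
    have h2 := ih (gcDecompose (U * (wordMat (solovayKitaev l d U)).conjTranspose)).1
    have h3 := ih (gcDecompose (U * (wordMat (solovayKitaev l d U)).conjTranspose)).2
    have h4 := length_wordInv_le
      (solovayKitaev l d (gcDecompose (U * (wordMat (solovayKitaev l d U)).conjTranspose)).1)
    have h5 := length_wordInv_le
      (solovayKitaev l d (gcDecompose (U * (wordMat (solovayKitaev l d U)).conjTranspose)).2)
    rw [pow_succ, ← mul_assoc]
    omega

theorem gcDecompose_spec {D : Matrix Bool Bool ℂ} (hD : D ∈ Matrix.unitaryGroup Bool ℂ) :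
    IsBalancedCommutator D (gcDecompose D) := by
  have h := exists_isBalancedCommutator hD
  rw [gcDecompose, dif_pos h]
  exact h.choose_spec

/-- One level of the Solovay-Kitaev recursion improves the accuracy from `s ^ 2` to `10 s ^ 3`. -/
theorem solovayKitaev_step {l d : ℕ} {s : ℝ} (hs0 : 0 ≤ s) (hs1 : s ≤ 1)
    (ih : ∀ U ∈ Matrix.unitaryGroup Bool ℂ,
      ∃ c : ℂ, ‖c‖ = 1 ∧ ‖wordMat (solovayKitaev l d U) - c • U‖ ≤ s ^ 2)
    {U : Matrix Bool Bool ℂ} (hU : U ∈ Matrix.unitaryGroup Bool ℂ) :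
    ∃ c : ℂ, ‖c‖ = 1 ∧ ‖wordMat (solovayKitaev l (d + 1) U) - c • U‖ ≤ 10 * s ^ 3 := by
  obtain ⟨c, hc, hcU⟩ := ih U hU
  have hu := wordMat_mem_unitary (solovayKitaev l d U)
  have hut := conjTranspose_mem_unitary hu
  have hD := mul_mem hU hut
  obtain ⟨hV, hW, ⟨c₀, hc₀, hD0⟩, hV1, hW1⟩ := gcDecompose_spec hD
  obtain ⟨c₃, hc₃, hv⟩ := ih _ hV
  obtain ⟨c₄, hc₄, hw⟩ := ih _ hW
  -- The remainder is within `s ^ 2` of a phase, so its balanced factors are within `s` of phases.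
  have hdist : Real.sqrt (phaseDist (U * (wordMat (solovayKitaev l d U))ᴴ) 1) ≤ s := by
    rw [Real.sqrt_le_left hs0]
    refine (phaseDist_le_norm_sub hD (one_mem _) (c := star c) (by rwa [norm_star])).trans ?_
    have e : U * (wordMat (solovayKitaev l d U))ᴴ - star c • (1 : Matrix Bool Bool ℂ) =
        (U - star c • wordMat (solovayKitaev l d U)) * (wordMat (solovayKitaev l d U))ᴴ := by
      rw [sub_mul, Matrix.smul_mul, self_mul_conjTranspose_of_unitary hu]
    rw [e, norm_mul_unitary hut, norm_sub_rev, norm_star_smul_sub hc]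
    exact hcU
  obtain ⟨c₁, hc₁, hVa⟩ := exists_phase_norm_sub_le hV (one_mem _)
  obtain ⟨c₂, hc₂, hWa⟩ := exists_phase_norm_sub_le hW (one_mem _)
  have key := norm_gcomm_sub_le_of_phases hc₁ hc₂ hc₃ hc₄ hV hW (wordMat_mem_unitary _)
    (wordMat_mem_unitary _) (hVa.trans (hV1.trans hdist)) (hWa.trans (hW1.trans hdist)) hv hw
  refine ⟨star c₀, by rwa [norm_star], ?_⟩
  have hUe : star c₀ • U = gcomm (gcDecompose (U * (wordMat (solovayKitaev l d U))ᴴ)).1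
      (gcDecompose (U * (wordMat (solovayKitaev l d U))ᴴ)).2 * wordMat (solovayKitaev l d U) := by
    have h1 : U = U * (wordMat (solovayKitaev l d U))ᴴ * wordMat (solovayKitaev l d U) := by
      rw [mul_assoc, conjTranspose_mul_self_of_unitary hu, mul_one]
    conv_lhs => rw [h1, hD0]
    rw [Matrix.smul_mul, smul_smul, star_mul_self_of_norm_one hc₀, one_smul, gcomm]
  have hword : wordMat (solovayKitaev l (d + 1) U) =
      gcomm (wordMat (solovayKitaev l d (gcDecompose (U * (wordMat (solovayKitaev l d U))ᴴ)).1))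
        (wordMat (solovayKitaev l d (gcDecompose (U * (wordMat (solovayKitaev l d U))ᴴ)).2)) *
        wordMat (solovayKitaev l d U) := by
    simp only [solovayKitaev, wordMat_append, wordMat_inv, gcomm, mul_assoc]
  rw [hUe, hword, ← sub_mul, norm_mul_unitary hu]
  refine key.trans ?_
  have h3 : 0 ≤ s ^ 3 := by positivity
  -- With `a = s` and `ε = s ^ 2` the commutator bound is `4 s³ + 6 s⁴`, at most `10 s³` because `s
  -- ≤ 1`.
  nlinarith

end Commutators

/-! ## Density of the words -/

section Density

open Matrix

/-- The matrices of words, up to phases. -/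
def wordMonoid : Submonoid (Matrix Bool Bool ℂ) where
  carrier := {M | ∃ (c : ℂ) (u : List Gate1), ‖c‖ = 1 ∧ M = c • wordMat u}
  one_mem' := ⟨1, [], norm_one, by simp [wordMat]⟩
  mul_mem' := by
    rintro _ _ ⟨c, u, hc, rfl⟩ ⟨c', u', hc', rfl⟩
    refine ⟨c * c', u' ++ u, by rw [norm_mul, hc, hc', one_mul], ?_⟩
    rw [wordMat_append, Matrix.smul_mul, Matrix.mul_smul, smul_smul]

theorem smul_mem_wordMonoid {c : ℂ} (hc : ‖c‖ = 1) {M : Matrix Bool Bool ℂ}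
    (hM : M ∈ wordMonoid) : c • M ∈ wordMonoid := by
  obtain ⟨c', u, hc', rfl⟩ := hM
  exact ⟨c * c', u, by rw [norm_mul, hc, hc', one_mul], smul_smul _ _ _⟩

theorem wordMat_mem_wordMonoid (u : List Gate1) : wordMat u ∈ wordMonoid :=
  ⟨1, u, norm_one, (one_smul _ _).symm⟩

theorem conjTranspose_mem_wordMonoid {M : Matrix Bool Bool ℂ} (hM : M ∈ wordMonoid) :
    Mᴴ ∈ wordMonoid := by
  obtain ⟨c, u, hc, rfl⟩ := hM
  exact ⟨star c, wordInv u, by rwa [norm_star], by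
    rw [Matrix.conjTranspose_smul, wordMat_inv]⟩

/-- The rotation by the angle `2 φ` about the axis `(x, 0, z)`. -/
def rot (x z φ : ℝ) : Matrix Bool Bool ℂ :=
  su ⟨Real.cos φ, -(z * Real.sin φ)⟩ ⟨0, -(x * Real.sin φ)⟩

theorem rot_mul {x z : ℝ} (h : x ^ 2 + z ^ 2 = 1) (φ ψ : ℝ) :
    rot x z φ * rot x z ψ = rot x z (φ + ψ) := by
  rw [rot, rot, su_mul, rot, Real.cos_add, Real.sin_add]
  congr 1
  · apply Complex.ext <;> simp
    · linear_combination (-(Real.sin φ * Real.sin ψ)) * h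
    · ring
  · apply Complex.ext <;> simp <;> ring

theorem rot_zero (x z : ℝ) : rot x z 0 = 1 := by
  rw [← su_one, rot]
  congr 1 <;> apply Complex.ext <;> simp

theorem rot_neg (x z φ : ℝ) : rot x z (-φ) = (rot x z φ)ᴴ := by
  rw [rot, rot, su_conjTranspose]
  congr 1 <;> apply Complex.ext <;> simp

theorem rot_two_pi (x z : ℝ) (n : ℤ) : rot x z (n * (2 * Real.pi)) = 1 := by
  rw [← su_one, rot]
  have h1 : Real.sin (n * (2 * Real.pi)) = 0 := by
    have := Real.sin_int_mul_pi (2 * n)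
    rw [← this]; congr 1; push_cast; ring
  rw [Real.cos_int_mul_two_pi, h1]
  congr 1 <;> apply Complex.ext <;> simp

theorem continuous_su {X : Type*} [TopologicalSpace X] {f g : X → ℂ} (hf : Continuous f)
    (hg : Continuous g) : Continuous fun x => su (f x) (g x) := by
  refine continuous_matrix fun i j => ?_
  cases i <;> cases j <;> simp only [su, Matrix.of_apply, cond] <;> fun_prop

theorem continuous_rot (x z : ℝ) : Continuous (rot x z) := by
  refine continuous_su ?_ ?_
  · have : (fun φ : ℝ => (⟨Real.cos φ, -(z * Real.sin φ)⟩ : ℂ)) =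
        fun φ => ((Real.cos φ : ℝ) : ℂ) + ((-(z * Real.sin φ) : ℝ) : ℂ) * Complex.I := by
      funext φ; apply Complex.ext <;> simp [-Complex.ofReal_cos, -Complex.ofReal_sin]
    rw [this]; fun_prop
  · have : (fun φ : ℝ => (⟨0, -(x * Real.sin φ)⟩ : ℂ)) =
        fun φ => ((-(x * Real.sin φ) : ℝ) : ℂ) * Complex.I := by
      funext φ; apply Complex.ext <;> simp [-Complex.ofReal_cos, -Complex.ofReal_sin]
    rw [this]; fun_prop

theorem rot_int_mul_mem {x z θ : ℝ} (h : x ^ 2 + z ^ 2 = 1) (hθ : rot x z θ ∈ wordMonoid)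
    (m : ℤ) : rot x z (m * θ) ∈ wordMonoid := by
  have hnat : ∀ k : ℕ, rot x z (k * θ) ∈ wordMonoid := by
    intro k
    induction k with
    | zero => rw [Nat.cast_zero, zero_mul, rot_zero]; exact one_mem _
    | succ k ih =>
      rw [Nat.cast_succ, add_mul, one_mul, ← rot_mul h]
      exact mul_mem ih hθ
  obtain ⟨k, rfl | rfl⟩ := m.eq_nat_or_neg
  · exact_mod_cast hnat k
  · rw [Int.cast_neg, neg_mul, rot_neg]
    exact conjTranspose_mem_wordMonoid (by exact_mod_cast hnat k)

/-- All rotations about an axis are limits of powers of one by an irrational angle. -/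
theorem rot_mem_closure {x z θ : ℝ} (h : x ^ 2 + z ^ 2 = 1) (hθ : rot x z θ ∈ wordMonoid)
    (hirr : Irrational (θ / (2 * Real.pi))) (φ : ℝ) :
    rot x z φ ∈ wordMonoid.topologicalClosure := by
  have hd := dense_addSubgroupClosure_pair_iff.2 hirr
  have hclosed : IsClosed {φ | rot x z φ ∈ wordMonoid.topologicalClosure} :=
    (Submonoid.isClosed_topologicalClosure _).preimage (continuous_rot x z)
  have hsub : (AddSubgroup.closure {θ, 2 * Real.pi} : Set ℝ) ⊆
      {φ | rot x z φ ∈ wordMonoid.topologicalClosure} := by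
    intro ψ hψ
    obtain ⟨m, k, rfl⟩ := AddSubgroup.mem_closure_pair.1 hψ
    apply Submonoid.le_topologicalClosure
    rw [zsmul_eq_mul, zsmul_eq_mul, ← rot_mul h, rot_two_pi, mul_one]
    exact rot_int_mul_mem h hθ m
  exact (hclosed.closure_subset_iff.2 hsub) (hd.closure_eq ▸ Set.mem_univ φ)

theorem rot_conj (x z φ : ℝ) :
    su rsqrt2 rsqrt2 * rot x z φ = rot z (-x) φ * su rsqrt2 rsqrt2 := by
  rw [rot, rot, su_mul, su_mul, star_rsqrt2, rsqrt2]
  congr 1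
  · apply Complex.ext <;> simp <;> ring
  · apply Complex.ext <;> simp <;> ring

theorem wordMat_HX : wordMat [.H, .X] = su rsqrt2 rsqrt2 := by
  ext i j
  have h' : (starRingEnd ℂ) rsqrt2 = rsqrt2 := star_rsqrt2
  cases i <;> cases j <;> simp [wordMat, Gate1.mat, su, Matrix.mul_apply, sgn, h']

/-- The word `H X` is a quarter turn about the `Y` axis, which maps the plane of `X` and `Z` to
itself and takes an axis to a perpendicular one. -/
theorem rot_perp_mem_closure {x z : ℝ}
    (h : ∀ φ, rot x z φ ∈ wordMonoid.topologicalClosure) (φ : ℝ) :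
    rot z (-x) φ ∈ wordMonoid.topologicalClosure := by
  have hJ : su rsqrt2 rsqrt2 ∈ wordMonoid := wordMat_HX ▸ wordMat_mem_wordMonoid _
  have hJu : su rsqrt2 rsqrt2 ∈ Matrix.unitaryGroup Bool ℂ := wordMat_HX ▸ wordMat_mem_unitary _
  have e : rot z (-x) φ = su rsqrt2 rsqrt2 * rot x z φ * (su rsqrt2 rsqrt2)ᴴ := by
    rw [rot_conj, mul_assoc, self_mul_conjTranspose_of_unitary hJu, mul_one]
  rw [e]
  exact mul_mem (mul_mem (wordMonoid.le_topologicalClosure hJ) (h φ))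
    (wordMonoid.le_topologicalClosure (conjTranspose_mem_wordMonoid hJ))

theorem rot_mul_rot_mul_rot {x z : ℝ} (h : x ^ 2 + z ^ 2 = 1) (φ t ψ : ℝ) :
    rot x z φ * rot z (-x) t * rot x z ψ =
      su ⟨Real.cos t * Real.cos (φ + ψ),
          -(z * (Real.cos t * Real.sin (φ + ψ)) - x * (Real.sin t * Real.cos (φ - ψ)))⟩
        ⟨Real.sin t * Real.sin (φ - ψ),
          -(x * (Real.cos t * Real.sin (φ + ψ)) + z * (Real.sin t * Real.cos (φ - ψ)))⟩ := by
  rw [rot, rot, rot, su_mul, su_mul, Real.cos_add, Real.sin_add, Real.sin_sub, Real.cos_sub]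
  congr 1 <;> apply Complex.ext <;> simp <;> grind

/-- Euler decomposition. -/
theorem su_eq_rot_mul {x z : ℝ} (h : x ^ 2 + z ^ 2 = 1) {α β : ℂ}
    (hαβ : ‖α‖ ^ 2 + ‖β‖ ^ 2 = 1) :
    ∃ φ t ψ, su α β = rot x z φ * rot z (-x) t * rot x z ψ := by
  -- Coordinates adapted to the axes: `p` holds the real part and the component along `(x, 0, z)`,
  -- `q` the other two components. The moduli are `cos t` and `sin t`, the arguments `φ + ψ` and `φ
  -- - ψ`.
  obtain ⟨p, hp⟩ : ∃ p : ℂ, p = ⟨α.re, -(x * β.im + z * α.im)⟩ := ⟨_, rfl⟩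
  obtain ⟨q, hq⟩ : ∃ q : ℂ, q = ⟨-(z * β.im - x * α.im), β.re⟩ := ⟨_, rfl⟩
  have hpq : ‖p‖ ^ 2 + ‖q‖ ^ 2 = 1 := by
    rw [sq_norm_eq, sq_norm_eq] at hαβ
    rw [sq_norm_eq, sq_norm_eq, hp, hq]
    simp only
    linear_combination hαβ + (α.im ^ 2 + β.im ^ 2) * h
  have hp1 : ‖p‖ ≤ 1 := by nlinarith [norm_nonneg p, sq_nonneg ‖q‖]
  have hcos : Real.cos (Real.arccos ‖p‖) = ‖p‖ :=
    Real.cos_arccos (by linarith [norm_nonneg p]) hp1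
  have hsin : Real.sin (Real.arccos ‖p‖) = ‖q‖ := by
    rw [Real.sin_arccos, show 1 - ‖p‖ ^ 2 = ‖q‖ ^ 2 by linarith, Real.sqrt_sq (norm_nonneg _)]
  refine ⟨(p.arg + q.arg) / 2, Real.arccos ‖p‖, (p.arg - q.arg) / 2, ?_⟩
  rw [rot_mul_rot_mul_rot h, hcos, hsin,
    show (p.arg + q.arg) / 2 + (p.arg - q.arg) / 2 = p.arg by ring,
    show (p.arg + q.arg) / 2 - (p.arg - q.arg) / 2 = q.arg by ring,
    Complex.norm_mul_cos_arg, Complex.norm_mul_sin_arg, Complex.norm_mul_cos_arg,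
    Complex.norm_mul_sin_arg, hp, hq]
  congr 1
  · apply Complex.ext
    · rfl
    · simp only; linear_combination (-α.im) * h
  · apply Complex.ext
    · rfl
    · simp only; linear_combination (-β.im) * h

theorem cos_pi_div_eight_sq : Real.cos (Real.pi / 8) ^ 2 = 1 / 2 + Real.sqrt 2 / 4 := by
  rw [Real.cos_sq, show 2 * (Real.pi / 8) = Real.pi / 4 by ring, Real.cos_pi_div_four]; ring

/-- An angle with cosine `cos (π / 8) / √2` is not a rational multiple of `π`. -/
theorem irrational_of_cos {θ : ℝ} (h : Real.cos θ = Real.cos (Real.pi / 8) * (1 / Real.sqrt 2)) :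
    Irrational (θ / (2 * Real.pi)) := by
  rintro ⟨q, hq⟩
  have hθ : θ = ((2 * q : ℚ) : ℝ) * Real.pi := by
    push_cast; rw [hq]; field_simp
  have hint := Real.isIntegral_two_mul_cos_rat_mul_pi (2 * q)
  rw [← hθ, h] at hint
  -- From the algebraic integer `2 cos θ` one gets `√2 / 2`, whose square 1/2 would have to be an
  -- integer.
  have hsq : (2 * (Real.cos (Real.pi / 8) * (1 / Real.sqrt 2))) ^ 2 - 1 = Real.sqrt 2 / 2 := by
    rw [mul_pow, mul_pow, cos_pi_div_eight_sq, rsqrt2_real]; ring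
  have hhalf : ((2 * (Real.cos (Real.pi / 8) * (1 / Real.sqrt 2))) ^ 2 - 1) ^ 2 =
      algebraMap ℚ ℝ (1 / 2) := by
    rw [hsq, div_pow, Real.sq_sqrt (by norm_num)]; norm_num
  have hint2 := ((hint.pow 2).sub isIntegral_one).pow 2
  rw [hhalf, isIntegral_algebraMap_iff (algebraMap ℚ ℝ).injective,
    IsIntegrallyClosed.isIntegral_iff] at hint2
  obtain ⟨m, hm⟩ := hint2
  have h2 : (m : ℚ) * 2 = 1 := by
    have : (m : ℚ) = 1 / 2 := hm
    rw [this]; norm_num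
  have h3 : m * 2 = 1 := by exact_mod_cast h2
  omega

theorem T_mat_eq : ∃ e : ℂ, ‖e‖ = 1 ∧ Gate1.T.mat =
    e • su ⟨Real.cos (Real.pi / 8), -Real.sin (Real.pi / 8)⟩ 0 := by
  have hη : Complex.exp ((Real.pi / 8 : ℝ) * Complex.I) =
      ⟨Real.cos (Real.pi / 8), Real.sin (Real.pi / 8)⟩ := by
    apply Complex.ext
    · rw [Complex.exp_ofReal_mul_I_re]
    · rw [Complex.exp_ofReal_mul_I_im]
  have h2 : Complex.exp (Complex.I * (Real.pi / 4 : ℝ)) =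
      Complex.exp ((Real.pi / 8 : ℝ) * Complex.I) * Complex.exp ((Real.pi / 8 : ℝ) * Complex.I) := by
    rw [← Complex.exp_add]; congr 1; push_cast; ring
  have h1 := Complex.norm_exp_ofReal_mul_I (Real.pi / 8)
  refine ⟨Complex.exp ((Real.pi / 8 : ℝ) * Complex.I), h1, ?_⟩
  have hs : (⟨Real.cos (Real.pi / 8), -Real.sin (Real.pi / 8)⟩ : ℂ) =
      star (Complex.exp ((Real.pi / 8 : ℝ) * Complex.I)) := by
    rw [hη]; rfl
  have h3 := star_mul_self_of_norm_one h1
  rw [hs]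
  generalize Complex.exp ((Real.pi / 8 : ℝ) * Complex.I) = η at h2 h3
  simp only [Gate1.mat, h2]
  rw [Complex.star_def, mul_comm] at h3
  ext i j
  cases i <;> cases j <;> simp [phaseMat, su, h3]

theorem H_mat_eq : Gate1.H.mat =
    Complex.I • su ⟨0, -(1 / Real.sqrt 2)⟩ ⟨0, -(1 / Real.sqrt 2)⟩ := by
  ext i j
  cases i <;> cases j <;> apply Complex.ext <;> simp [Gate1.mat, su, sgn, rsqrt2,
    Real.sqrt_div_self']

/-- The word `T H T H T` is a rotation about an axis in the plane of `X` and `Z`. -/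
theorem exists_rot_mem_wordMonoid :
    ∃ x z θ : ℝ, x ^ 2 + z ^ 2 = 1 ∧ rot x z θ ∈ wordMonoid ∧ Irrational (θ / (2 * Real.pi)) := by
  obtain ⟨e, he, hT⟩ := T_mat_eq
  obtain ⟨r, hr⟩ : ∃ r, 1 / Real.sqrt 2 = r := ⟨_, rfl⟩
  obtain ⟨c, hc⟩ : ∃ c, Real.cos (Real.pi / 8) = c := ⟨_, rfl⟩
  obtain ⟨s, hs⟩ : ∃ s, Real.sin (Real.pi / 8) = s := ⟨_, rfl⟩
  have hr2 : r ^ 2 = 1 / 2 := hr ▸ rsqrt2_real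
  have hcs : c ^ 2 + s ^ 2 = 1 := by rw [← hc, ← hs, add_comm]; exact Real.sin_sq_add_cos_sq _
  have hr' : Real.sqrt 2 / 2 = r := by
    rw [← hr]
    field_simp
    rw [Real.sq_sqrt (by norm_num)]
  have hc2s : c ^ 2 - s ^ 2 = r := by
    rw [← hr', ← Real.cos_pi_div_four, show Real.pi / 4 = 2 * (Real.pi / 8) by ring,
      Real.cos_two_mul, hc]
    linarith
  have h2cs : 2 * s * c = r := by
    rw [← hr', ← Real.sin_pi_div_four, show Real.pi / 4 = 2 * (Real.pi / 8) by ring,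
      Real.sin_two_mul, hc, hs]
  have hH := H_mat_eq
  rw [hr] at hH
  rw [hc, hs] at hT
  -- `T` and `H` are symmetric matrices and the word is a palindrome, so its matrix is symmetric and
  -- has no `Y` component.
  have hword : wordMat [.T, .H, .T, .H, .T] = (e ^ 3) • su ⟨c * r, -(c * r)⟩ ⟨0, -s⟩ := by
    simp only [wordMat, one_mul]
    rw [hT, hH]
    simp only [Matrix.smul_mul, Matrix.mul_smul, smul_smul, su_mul]
    have hI : e * Complex.I * e * Complex.I * e = -e ^ 3 := by
      linear_combination (e ^ 3) * Complex.I_mul_I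
    have hI' : e * (Complex.I * (e * (Complex.I * e))) = -e ^ 3 := by
      linear_combination (e ^ 3) * Complex.I_mul_I
    first | rw [hI] | rw [hI']
    rw [neg_smul, ← smul_neg, su_neg]
    congr 2
    · apply Complex.ext <;> simp <;> grind
    · apply Complex.ext <;> simp <;> grind
  have hmem : su ⟨c * r, -(c * r)⟩ ⟨0, -s⟩ ∈ wordMonoid := by
    have h1 := smul_mem_wordMonoid (c := star (e ^ 3)) (by rw [norm_star, norm_pow, he, one_pow])
      (wordMat_mem_wordMonoid [.T, .H, .T, .H, .T])
    rwa [hword, smul_smul, star_mul_self_of_norm_one (by rw [norm_pow, he, one_pow]),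
      one_smul] at h1
  have hone : (c * r) ^ 2 + (s ^ 2 + (c * r) ^ 2) = 1 := by rw [mul_pow, hr2]; linarith
  obtain ⟨ρ, hρ⟩ : ∃ ρ, Real.sqrt (s ^ 2 + (c * r) ^ 2) = ρ := ⟨_, rfl⟩
  have hρ2 : ρ ^ 2 = s ^ 2 + (c * r) ^ 2 := by rw [← hρ, Real.sq_sqrt (by positivity)]
  have hρ0 : ρ ≠ 0 := by
    intro h0
    rw [h0] at hρ2
    have h1 : s ^ 2 = 0 := by nlinarith [sq_nonneg s, sq_nonneg (c * r)]
    have h2 : (c * r) ^ 2 = 0 := by nlinarith [sq_nonneg s, sq_nonneg (c * r)]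
    rw [h1, h2] at hone
    norm_num at hone
  have hcos : Real.cos (Real.arccos (c * r)) = c * r :=
    Real.cos_arccos (by nlinarith [sq_nonneg s]) (by nlinarith [sq_nonneg s])
  have hsin : Real.sin (Real.arccos (c * r)) = ρ := by
    rw [Real.sin_arccos, ← hρ]; congr 1; linarith
  refine ⟨s / ρ, c * r / ρ, Real.arccos (c * r), ?_, ?_, ?_⟩
  · rw [div_pow, div_pow, ← add_div, ← hρ2, div_self (pow_ne_zero _ hρ0)]
  · rw [rot, hcos, hsin, div_mul_cancel₀ _ hρ0, div_mul_cancel₀ _ hρ0]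
    exact hmem
  · exact irrational_of_cos (by rw [hcos, ← hc, ← hr])

/-- The words are dense in the single-qubit unitaries, up to phases. -/
theorem unitary_mem_closure {U : Matrix Bool Bool ℂ} (hU : U ∈ Matrix.unitaryGroup Bool ℂ) :
    U ∈ wordMonoid.topologicalClosure := by
  obtain ⟨x, z, θ, h, hθ, hirr⟩ := exists_rot_mem_wordMonoid
  have h1 := rot_mem_closure h hθ hirr
  obtain ⟨e, α, β, he, hαβ, rfl⟩ := exists_su hU
  obtain ⟨φ, t, ψ, hs⟩ := su_eq_rot_mul h hαβ
  have h2 : (e • (1 : Matrix Bool Bool ℂ)) ∈ wordMonoid.topologicalClosure :=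
    wordMonoid.le_topologicalClosure (smul_mem_wordMonoid he (one_mem _))
  have h3 := mul_mem h2 (mul_mem (mul_mem (h1 φ) (rot_perp_mem_closure h1 t)) (h1 ψ))
  rwa [Matrix.smul_mul, one_mul, ← hs] at h3

theorem continuous_phaseDist_left (V : Matrix Bool Bool ℂ) :
    Continuous fun U => phaseDist U V := by
  unfold phaseDist
  exact Real.continuous_sqrt.comp (continuous_const.sub
    ((continuous_id.matrix_conjTranspose.matrix_mul continuous_const).matrix_trace.norm))

theorem continuous_phaseDist_right (U : Matrix Bool Bool ℂ) :
    Continuous fun V => phaseDist U V := by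
  unfold phaseDist
  exact Real.continuous_sqrt.comp (continuous_const.sub
    ((continuous_const.matrix_mul continuous_id).matrix_trace.norm))

theorem exists_word_phaseDist_lt {U : Matrix Bool Bool ℂ}
    (hU : U ∈ Matrix.unitaryGroup Bool ℂ) {δ : ℝ} (hδ : 0 < δ) :
    ∃ u : List Gate1, phaseDist (wordMat u) U < δ := by
  have hopen : IsOpen {V | phaseDist V U < δ} :=
    isOpen_lt (continuous_phaseDist_left U) continuous_const
  have hself : phaseDist U U < δ := by
    rw [phaseDist, conjTranspose_mul_self_of_unitary hU, Matrix.trace_one]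
    simpa using hδ
  obtain ⟨_, hM, c, u, hc, rfl⟩ := mem_closure_iff.1 (unitary_mem_closure hU) _ hopen hself
  refine ⟨u, ?_⟩
  have e : phaseDist (c • wordMat u) U = phaseDist (wordMat u) U := by
    rw [phaseDist, phaseDist, Matrix.conjTranspose_smul, Matrix.smul_mul, Matrix.trace_smul,
      norm_smul, norm_star, hc, one_mul]
  exact e ▸ hM

theorem isCompact_unitaryGroup :
    IsCompact (Matrix.unitaryGroup Bool ℂ : Set (Matrix Bool Bool ℂ)) := by
  have hK : IsCompact (Set.pi Set.univ fun _ : Bool => Set.pi Set.univ fun _ : Bool =>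
      Metric.closedBall (0 : ℂ) 1) :=
    isCompact_univ_pi fun _ => isCompact_univ_pi fun _ => isCompact_closedBall _ _
  refine hK.of_isClosed_subset ?_ ?_
  · have : (Matrix.unitaryGroup Bool ℂ : Set (Matrix Bool Bool ℂ)) = {U | Uᴴ * U = 1} := by
      ext U; exact Matrix.mem_unitaryGroup_iff'
    rw [this]
    exact isClosed_eq (continuous_id.matrix_conjTranspose.matrix_mul continuous_id)
      continuous_const
  · intro U hU i _ j _
    rw [mem_closedBall_zero_iff]
    exact entry_norm_bound_of_unitary hU i j

/-- Words of bounded length approximate all single-qubit unitaries. -/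
theorem exists_length_phaseDist_lt {δ : ℝ} (hδ : 0 < δ) :
    ∃ l₀ : ℕ, ∀ U ∈ Matrix.unitaryGroup Bool ℂ,
      ∃ u : List Gate1, u.length ≤ l₀ ∧ phaseDist (wordMat u) U < δ := by
  -- Each word covers the open set of unitaries near it; finitely many words suffice, and the
  -- longest gives the bound.
  obtain ⟨t, ht⟩ := isCompact_unitaryGroup.elim_finite_subcover
    (fun u : List Gate1 => {V | phaseDist (wordMat u) V < δ})
    (fun u => isOpen_lt (continuous_phaseDist_right _) continuous_const)
    (fun U hU => Set.mem_iUnion.2 (exists_word_phaseDist_lt hU hδ))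
  refine ⟨t.sup List.length, fun U hU => ?_⟩
  obtain ⟨u, hu⟩ := Set.mem_iUnion.1 (ht hU)
  obtain ⟨hut, hu⟩ := Set.mem_iUnion.1 hu
  exact ⟨u, Finset.le_sup hut, hu⟩

end Density

/-! ## The accuracy of the Solovay-Kitaev algorithm -/

/-- The accuracy at recursion depth `d`. -/
def skError (d : ℕ) : ℝ := 1 / 100 * (1 / 2 : ℝ) ^ ((3 / 2 : ℝ) ^ d)

theorem skError_pos (d : ℕ) : 0 < skError d := by
  unfold skError; positivity

theorem strictAnti_skError : StrictAnti skError := by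
  intro m n h
  have h1 : (3 / 2 : ℝ) ^ m < (3 / 2 : ℝ) ^ n := pow_lt_pow_right₀ (by norm_num) h
  have h2 := Real.rpow_lt_rpow_of_exponent_gt (x := 1 / 2) (by norm_num) (by norm_num) h1
  unfold skError
  linarith

/-- With `s = t / 10` the step `s² ↦ 10 s³` becomes `t² ↦ t³` after multiplication by 100. Hence the
constant 1/100 and the exponent `(3 / 2) ^ d` satisfy the recursion with equality. -/
theorem exists_sq_eq_skError (d : ℕ) :
    ∃ s : ℝ, 0 ≤ s ∧ s ≤ 1 ∧ s ^ 2 = skError d ∧ 10 * s ^ 3 = skError (d + 1) := by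
  obtain ⟨e, he⟩ : ∃ e : ℝ, e = (3 / 2) ^ d := ⟨_, rfl⟩
  have he0 : 0 ≤ e := by rw [he]; positivity
  have hle : (1 / 2 : ℝ) ^ (e / 2) ≤ 1 :=
    Real.rpow_le_one (by norm_num) (by norm_num) (by linarith)
  have hpow : ∀ k : ℕ, ((1 / 2 : ℝ) ^ (e / 2)) ^ k = (1 / 2 : ℝ) ^ (e / 2 * k) := fun k => by
    rw [Real.rpow_mul_natCast (by norm_num)]
  refine ⟨1 / 10 * (1 / 2 : ℝ) ^ (e / 2), by positivity, by linarith, ?_, ?_⟩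
  · rw [mul_pow, hpow, skError, ← he]
    congr 1
    · norm_num
    · congr 1; push_cast; ring
  · rw [mul_pow, hpow, skError, pow_succ (3 / 2 : ℝ) d, ← he, ← mul_assoc]
    congr 1
    · norm_num
    · congr 1; push_cast; ring

/-- On the logarithmic scale a power of `9 ^ d` is linear in `d`, while the accuracy contributes
`-log 2` times `(3 / 2) ^ d`. -/
theorem superpolynomialDecay_skError :
    Asymptotics.SuperpolynomialDecay atTop (fun d : ℕ => (9 : ℝ) ^ d) skError := by
  intro j
  have h1 : Tendsto (fun d : ℕ => (d : ℝ) ^ 1 / (3 / 2 : ℝ) ^ d) atTop (nhds 0) :=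
    tendsto_pow_const_div_const_pow_of_one_lt 1 (by norm_num)
  have h2 : Tendsto (fun d : ℕ => (j * Real.log 9) * ((d : ℝ) ^ 1 / (3 / 2 : ℝ) ^ d) - Real.log 2)
      atTop (nhds (-Real.log 2)) := by
    have := (h1.const_mul (j * Real.log 9)).sub_const (Real.log 2)
    simpa using this
  have h3 : Tendsto (fun d : ℕ => (3 / 2 : ℝ) ^ d) atTop atTop :=
    tendsto_pow_atTop_atTop_of_one_lt (by norm_num)
  have h4 := h3.atTop_mul_neg (by simpa using Real.log_pos (by norm_num : (1 : ℝ) < 2)) h2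
  have h5 := (Real.tendsto_exp_atBot.comp h4).const_mul (1 / 100)
  rw [mul_zero] at h5
  refine h5.congr fun d => ?_
  have e1 : (3 / 2 : ℝ) ^ d * (j * Real.log 9 * ((d : ℝ) ^ 1 / (3 / 2 : ℝ) ^ d) - Real.log 2) =
      Real.log 9 * (d * j) + Real.log (1 / 2) * (3 / 2 : ℝ) ^ d := by
    rw [one_div, Real.log_inv]
    field_simp
    ring
  have e2 : ((9 : ℝ) ^ d) ^ j = Real.exp (Real.log 9 * (d * j)) := by
    rw [← pow_mul, ← Real.rpow_natCast, Real.rpow_def_of_pos (by norm_num)]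
    push_cast; rfl
  rw [Function.comp_apply, e1, Real.exp_add, e2, skError, Real.rpow_def_of_pos (by norm_num)]
  ring

section Accuracy

open scoped Matrix.Norms.L2Operator

/-- The density of words is needed only once, for the fixed initial accuracy `skError 0`; this
determines `l₀` for all depths. -/
theorem exists_solovayKitaev_accuracy :
    ∃ l₀ : ℕ, ∀ l, l₀ ≤ l → ∀ (d : ℕ), ∀ U ∈ Matrix.unitaryGroup Bool ℂ,
      ∃ c : ℂ, ‖c‖ = 1 ∧ ‖wordMat (solovayKitaev l d U) - c • U‖ ≤ skError d := by
  obtain ⟨l₀, h₀⟩ := exists_length_phaseDist_lt (skError_pos 0)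
  refine ⟨l₀, fun l hl d => ?_⟩
  induction d with
  | zero =>
    intro U hU
    obtain ⟨u, hu, hd⟩ := h₀ U hU
    obtain ⟨c, hc, h⟩ := exists_phase_norm_sub_le (wordMat_mem_unitary (solovayKitaev l 0 U)) hU
    exact ⟨c, hc, h.trans (((exists_nearest l U).choose_spec.2 u (hu.trans hl)).trans hd.le)⟩
  | succ d ih =>
    intro U hU
    obtain ⟨s, hs0, hs1, hs2, hs3⟩ := exists_sq_eq_skError d
    rw [← hs3]
    exact solovayKitaev_step hs0 hs1 (fun V hV => by rw [hs2]; exact ih V hV) hU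

end Accuracy

/-! ## Norms of states -/

section KetNorm

/-- The Euclidean norm of a vector of amplitudes. -/
def ketNorm {B : Type} [Fintype B] (φ : B → ℂ) : ℝ := ‖WithLp.toLp 2 φ‖

variable {B : Type} [Fintype B]

theorem ketNorm_sq (φ : B → ℂ) : ketNorm φ ^ 2 = normSq φ := (normSq_eq_norm_sq φ).symm

theorem ketNorm_nonneg (φ : B → ℂ) : 0 ≤ ketNorm φ := norm_nonneg _

theorem ketNorm_eq_sqrt (φ : B → ℂ) : ketNorm φ = Real.sqrt (normSq φ) := by
  rw [← ketNorm_sq, Real.sqrt_sq (ketNorm_nonneg φ)]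

theorem ketNorm_add_le (φ ψ : B → ℂ) : ketNorm (φ + ψ) ≤ ketNorm φ + ketNorm ψ :=
  norm_add_le (WithLp.toLp 2 φ) (WithLp.toLp 2 ψ)

theorem abs_ketNorm_sub_le (φ ψ : B → ℂ) : |ketNorm φ - ketNorm ψ| ≤ ketNorm (φ - ψ) :=
  abs_norm_sub_norm_le (WithLp.toLp 2 φ) (WithLp.toLp 2 ψ)

theorem ketNorm_smul (c : ℂ) (φ : B → ℂ) : ketNorm (c • φ) = ‖c‖ * ketNorm φ :=
  norm_smul c (WithLp.toLp 2 φ)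

end KetNorm

section GateNorms

open Matrix
open scoped Matrix.Norms.L2Operator

variable {n : ℕ}

theorem sum_sum_update (w : Fin n) (f : (Fin n → Bool) → ℝ) :
    ∑ x, ∑ b, f (Function.update x w b) = 2 * ∑ x, f x := by
  have h : ∀ x : Fin n → Bool, ∑ b, f (Function.update x w b) =
      f x + f (shift x fun v => decide (v = w)) := by
    intro x
    have hflip : (shift x fun v => decide (v = w)) = Function.update x w (!x w) := by
      funext v
      by_cases hv : v = w
      · subst hv; simp [shift]
      · simp [shift, hv]
    rw [hflip, Fintype.sum_bool]
    conv_rhs => rw [← Function.update_eq_self w x]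
    cases hx : x w <;> simp [add_comm]
  have h' : ∑ x, f (shift x fun v => decide (v = w)) = ∑ x, f x :=
    (shiftEquiv fun v : Fin n => decide (v = w)).sum_comp f
  rw [Finset.sum_congr rfl fun x _ => h x, Finset.sum_add_distrib, h']
  ring

/-- The matrix acts separately on each pair of amplitudes that differ only at wire `w`. Summing over
all strings and both values at `w` counts every amplitude twice and avoids choosing representatives.
-/
theorem normSq_apply1_le (M : Matrix Bool Bool ℂ) (w : Fin n) (φ : Ket (Fin n)) :
    normSq (apply1 M w φ) ≤ ‖M‖ ^ 2 * normSq φ := by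
  have h : 2 * normSq (apply1 M w φ) ≤ ‖M‖ ^ 2 * (2 * normSq φ) := by
    rw [normSq, normSq, ← sum_sum_update w, ← sum_sum_update w, Finset.mul_sum]
    refine Finset.sum_le_sum fun x _ => ?_
    have key := Matrix.l2_opNorm_mulVec M (WithLp.toLp 2 fun b => φ (Function.update x w b))
    have key2 := pow_le_pow_left₀ (norm_nonneg _) key 2
    rw [mul_pow, EuclideanSpace.norm_sq_eq, EuclideanSpace.norm_sq_eq] at key2
    simpa [apply1, Matrix.mulVec, dotProduct] using key2
  linarith

theorem ketNorm_apply1_le (M : Matrix Bool Bool ℂ) (w : Fin n) (φ : Ket (Fin n)) :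
    ketNorm (apply1 M w φ) ≤ ‖M‖ * ketNorm φ := by
  refine le_of_sq_le_sq ?_ (mul_nonneg (norm_nonneg _) (ketNorm_nonneg _))
  rw [mul_pow, ketNorm_sq, ketNorm_sq]
  exact normSq_apply1_le M w φ

theorem ketNorm_apply1_unitary {U : Matrix Bool Bool ℂ} (hU : U ∈ Matrix.unitaryGroup Bool ℂ)
    (w : Fin n) (φ : Ket (Fin n)) : ketNorm (apply1 U w φ) = ketNorm φ := by
  refine le_antisymm ?_ ?_
  · have := ketNorm_apply1_le U w φ
    rwa [norm_of_unitary hU, one_mul] at this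
  · have := ketNorm_apply1_le Uᴴ w (apply1 U w φ)
    rwa [norm_of_unitary (conjTranspose_mem_unitary hU), one_mul, ← apply1_mul,
      conjTranspose_mul_self_of_unitary hU, apply1_one] at this

theorem ketNorm_applyCNOT {c t : Fin n} (h : c ≠ t) (φ : Ket (Fin n)) :
    ketNorm (applyCNOT c t φ) = ketNorm φ := by
  have hinv : Function.Involutive fun x : Fin n → Bool => Function.update x t (x t ^^ x c) := by
    intro x
    simp [Function.update_of_ne h]
  rw [ketNorm_eq_sqrt, ketNorm_eq_sqrt]
  congr 1
  exact Equiv.sum_comp hinv.toPerm fun x => ‖φ x‖ ^ 2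

theorem Gate.ketNorm_apply (g : Gate n) (φ : Ket (Fin n)) : ketNorm (g.apply φ) = ketNorm φ := by
  cases g with
  | one g w => exact ketNorm_apply1_unitary g.mat_mem_unitary w φ
  | cnot c t h => exact ketNorm_applyCNOT h φ

theorem Gate.apply_sub (g : Gate n) (φ ψ : Ket (Fin n)) :
    g.apply (φ - ψ) = g.apply φ - g.apply ψ := by
  cases g with
  | one g w => exact apply1_sub_ket _ _ _ _
  | cnot c t h => rfl

/-! ## Decomposed circuits -/

theorem applyGates_append (gs hs : List (Gate n)) (φ : Ket (Fin n)) :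
    applyGates (gs ++ hs) φ = applyGates hs (applyGates gs φ) := by
  induction gs generalizing φ with
  | nil => rfl
  | cons g gs ih => exact ih _

theorem applyGates_map_one (u : List Gate1) (w : Fin n) (φ : Ket (Fin n)) :
    applyGates (u.map fun g => Gate.one g w) φ = apply1 (wordMat u) w φ := by
  induction u generalizing φ with
  | nil => exact (apply1_one w φ).symm
  | cons g u ih => rw [List.map_cons, applyGates, ih, wordMat, apply1_mul, Gate.apply]

theorem rotMat_mem_unitary {H : Matrix Bool Bool ℂ} (hH : H.IsHermitian) (t : ℝ) :
    rotMat H t ∈ Matrix.unitaryGroup Bool ℂ := by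
  have h1 : ((-Complex.I * (t : ℂ)) • H)ᴴ = -((-Complex.I * (t : ℂ)) • H) := by
    rw [Matrix.conjTranspose_smul, hH.eq, ← neg_smul]
    congr 1
    simp
  rw [Matrix.mem_unitaryGroup_iff', Matrix.star_eq_conjTranspose, rotMat,
    ← Matrix.exp_conjTranspose, h1,
    ← Matrix.exp_add_of_commute _ _ (Commute.refl ((-Complex.I * (t : ℂ)) • H)).neg_left,
    neg_add_cancel, NormedSpace.exp_zero]

/-- `φ'` is within `δ` of `φ` up to a phase. -/
def CloseKet (δ : ℝ) (φ' φ : Ket (Fin n)) : Prop :=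
  ∃ c : ℂ, ‖c‖ = 1 ∧ ketNorm (φ' - c • φ) ≤ δ

/-- The unitary `M` does not enlarge the inherited error, and replacing `U` costs the operator
distance once because the ideal state has norm one. -/
theorem CloseKet.apply1 {δ ε : ℝ} {φ' φ : Ket (Fin n)} (h : CloseKet δ φ' φ)
    (hφ : ketNorm φ = 1) {M U : Matrix Bool Bool ℂ} (hM : M ∈ Matrix.unitaryGroup Bool ℂ)
    (hMU : ∃ c : ℂ, ‖c‖ = 1 ∧ ‖M - c • U‖ ≤ ε) (w : Fin n) :
    CloseKet (δ + ε) (apply1 M w φ') (apply1 U w φ) := by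
  obtain ⟨c, hc, h⟩ := h
  obtain ⟨e, he, hMU⟩ := hMU
  refine ⟨c * e, by rw [norm_mul, hc, he, one_mul], ?_⟩
  have hsplit : DVQA.apply1 M w φ' - (c * e) • DVQA.apply1 U w φ =
      DVQA.apply1 M w (φ' - c • φ) + c • DVQA.apply1 (M - e • U) w φ := by
    rw [apply1_sub_ket, apply1_smul_ket, apply1_sub, apply1_smul, smul_sub, smul_smul]
    abel
  rw [hsplit]
  refine (ketNorm_add_le _ _).trans (add_le_add ?_ ?_)
  · rwa [ketNorm_apply1_unitary hM]
  · rw [ketNorm_smul, hc, one_mul]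
    refine (ketNorm_apply1_le _ _ _).trans ?_
    rwa [hφ, mul_one]

/-- Replacing the single-qubit unitaries by approximations costs at most `ε` each. -/
theorem closeKet_decompose {R l d : ℕ} {ε : ℝ}
    (hε : ∀ U ∈ Matrix.unitaryGroup Bool ℂ,
      ∃ c : ℂ, ‖c‖ = 1 ∧ ‖wordMat (solovayKitaev l d U) - c • U‖ ≤ ε)
    (θ : Fin R → ℝ) (A : List (AnsatzGate n R)) :
    ∀ (δ : ℝ) (φ' φ : Ket (Fin n)), ketNorm φ = 1 → CloseKet δ φ' φ →
      CloseKet (δ + A.countP AnsatzGate.isApprox * ε) (applyGates (decompose l d A θ) φ')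
        (applyAnsatz θ A φ) ∧ ketNorm (applyAnsatz θ A φ) = 1 := by
  induction A with
  | nil =>
    intro δ φ' φ hφ h
    refine ⟨?_, hφ⟩
    simpa [decompose, applyGates, applyAnsatz] using h
  | cons g A ih =>
    intro δ φ' φ hφ h
    have hd : decompose l d (g :: A) θ = g.decompose l d θ ++ decompose l d A θ := rfl
    rw [hd, applyGates_append, applyAnsatz, List.countP_cons]
    cases g with
    | rot w r H hH =>
      have hU := rotMat_mem_unitary hH (θ r)
      have h1 := h.apply1 hφ (wordMat_mem_unitary _) (hε _ hU) w
      have h2 := ih _ _ _ ((ketNorm_apply1_unitary hU w φ).trans hφ) h1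
      rw [AnsatzGate.decompose, applyGates_map_one]
      simp only [AnsatzGate.isApprox, if_true]
      push_cast
      rwa [show δ + ((A.countP AnsatzGate.isApprox : ℝ) + 1) * ε =
        δ + ε + A.countP AnsatzGate.isApprox * ε by ring]
    | unitary w W hW =>
      have h1 := h.apply1 hφ (wordMat_mem_unitary _) (hε _ hW) w
      have h2 := ih _ _ _ ((ketNorm_apply1_unitary hW w φ).trans hφ) h1
      rw [AnsatzGate.decompose, applyGates_map_one]
      simp only [AnsatzGate.isApprox, if_true]
      push_cast
      rwa [show δ + ((A.countP AnsatzGate.isApprox : ℝ) + 1) * ε =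
        δ + ε + A.countP AnsatzGate.isApprox * ε by ring]
    | gate g =>
      obtain ⟨c, hc, h⟩ := h
      have h1 : CloseKet δ (g.apply φ') (g.apply φ) := by
        refine ⟨c, hc, ?_⟩
        rwa [← Gate.apply_smul, ← Gate.apply_sub, Gate.ketNorm_apply]
      have h2 := ih _ _ _ ((g.ketNorm_apply φ).trans hφ) h1
      simpa [AnsatzGate.decompose, applyGates, AnsatzGate.isApprox, AnsatzGate.apply] using h2

theorem ketNorm_applyGates (gs : List (Gate n)) (φ : Ket (Fin n)) :
    ketNorm (applyGates gs φ) = ketNorm φ := by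
  induction gs generalizing φ with
  | nil => rfl
  | cons g gs ih => rw [applyGates, ih, Gate.ketNorm_apply]

/-- The probability is the squared norm of a linear contraction of the state; factoring a difference
of squares gives the factor two. -/
theorem abs_measProb_sub_le (O : Fin n → Pauli) (s : Bool) {φ ψ : Ket (Fin n)}
    (hφ : ketNorm φ = 1) (hψ : ketNorm ψ = 1) :
    |measProb O φ s - measProb O ψ s| ≤ 2 * ketNorm (φ - ψ) := by
  let P : Ket (Fin n) → Ket (Fin n) := fun φ x => (φ x + sgn s * applyPauli O φ x) / 2
  have hP : ∀ φ, measProb O φ s = ketNorm (P φ) ^ 2 := fun φ => (ketNorm_sq _).symm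
  have hPle : ∀ φ, ketNorm (P φ) ≤ ketNorm φ := by
    intro φ
    refine le_of_sq_le_sq ?_ (ketNorm_nonneg _)
    rw [← hP, ketNorm_sq, ← measProb_add O φ]
    have h1 := measProb_nonneg O φ false
    have h2 := measProb_nonneg O φ true
    cases s <;> linarith
  have hsub : P φ - P ψ = P (φ - ψ) := by
    funext x
    simp only [P, Pi.sub_apply, applyPauli_sub]; ring
  rw [hP, hP, sq_sub_sq, abs_mul, abs_of_nonneg (add_nonneg (ketNorm_nonneg _) (ketNorm_nonneg _))]
  have h1 := hPle φ
  have h2 := hPle ψ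
  have h3 : |ketNorm (P φ) - ketNorm (P ψ)| ≤ ketNorm (φ - ψ) :=
    (abs_ketNorm_sub_le _ _).trans (hsub ▸ hPle _)
  exact mul_le_mul (by linarith) h3 (abs_nonneg _) (by norm_num)

theorem CloseKet.abs_measProb_sub_le {δ : ℝ} {φ' φ : Ket (Fin n)} (h : CloseKet δ φ' φ)
    (hφ' : ketNorm φ' = 1) (hφ : ketNorm φ = 1) (O : Fin n → Pauli) (s : Bool) :
    |measProb O φ' s - measProb O φ s| ≤ 2 * δ := by
  obtain ⟨c, hc, h⟩ := h
  have h1 := DVQA.abs_measProb_sub_le O s hφ' (ψ := c • φ) (by rw [ketNorm_smul, hc, hφ, one_mul])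
  rw [measProb_smul, hc, one_pow, one_mul] at h1
  linarith

end GateNorms

/-! ## One delegated execution -/

namespace VQA

open scoped Matrix.Norms.L2Operator

variable {n R K : ℕ} (Q : VQA n R K)

theorem ketNorm_input (k : Fin K) : ketNorm (Q.input k) = 1 := by
  rw [ketNorm_eq_sqrt, Q.input_norm, Real.sqrt_one]

theorem closeKet_output {l d : ℕ} {ε : ℝ}
    (hε : ∀ U ∈ Matrix.unitaryGroup Bool ℂ,
      ∃ c : ℂ, ‖c‖ = 1 ∧ ‖wordMat (solovayKitaev l d U) - c • U‖ ≤ ε)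
    (θ : Fin R → ℝ) (k : Fin K) :
    CloseKet (Q.numApprox * ε) (applyGates (Q.gates l d θ) (Q.input k)) (Q.output θ k) ∧
      ketNorm (Q.output θ k) = 1 := by
  have h := closeKet_decompose hε θ Q.ansatz 0 (Q.input k) (Q.input k) (Q.ketNorm_input k)
    ⟨1, norm_one, by simp [ketNorm]⟩
  rwa [zero_add] at h

theorem abs_delegatedProb_sub_le {l d : ℕ} {ε : ℝ}
    (hε : ∀ U ∈ Matrix.unitaryGroup Bool ℂ,
      ∃ c : ℂ, ‖c‖ = 1 ∧ ‖wordMat (solovayKitaev l d U) - c • U‖ ≤ ε)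
    {Ω : Setup} (hΩ : Ω.Correct) {κ : ℕ} (θ : Fin R → ℝ) (k : Fin K) {π : Prep Ω κ n}
    (hπ : Q.HonestPrep l d θ π) (s : Bool) :
    |Q.delegatedProb l d π θ k s - Q.prob θ k s| ≤ 2 * Q.numApprox * ε := by
  obtain ⟨h1, h2⟩ := Q.closeKet_output hε θ k
  rw [delegatedProb, Prep.Honest.delegatedProb_eq hπ hΩ, prob, mul_assoc]
  exact h1.abs_measProb_sub_le ((ketNorm_applyGates _ _).trans (Q.ketNorm_input k)) h2 _ _

theorem sum_prob (θ : Fin R → ℝ) (k : Fin K) : Q.prob θ k false + Q.prob θ k true = 1 := by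
  -- A trivial accuracy suffices, since only the norm of the exact output is taken from
  -- `closeKet_output`.
  have h : ∀ U ∈ Matrix.unitaryGroup Bool ℂ,
      ∃ c : ℂ, ‖c‖ = 1 ∧ ‖wordMat (solovayKitaev 0 0 U) - c • U‖ ≤ 2 := by
    intro U hU
    refine ⟨1, norm_one, ?_⟩
    rw [one_smul]
    refine (norm_sub_le _ _).trans ?_
    rw [norm_of_unitary (wordMat_mem_unitary _), norm_of_unitary hU]; norm_num
  rw [prob, prob, measProb_add, ← ketNorm_sq, output]
  rw [show ketNorm (applyAnsatz θ Q.ansatz (Q.input k)) = 1 from (Q.closeKet_output h θ k).2]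
  norm_num

theorem sum_delegatedProb {l d : ℕ} {Ω : Setup} (hΩ : Ω.Correct) {κ : ℕ} (θ : Fin R → ℝ)
    (k : Fin K) {π : Prep Ω κ n} (hπ : Q.HonestPrep l d θ π) :
    Q.delegatedProb l d π θ k false + Q.delegatedProb l d π θ k true = 1 := by
  rw [delegatedProb, delegatedProb, Prep.Honest.delegatedProb_eq hπ hΩ,
    Prep.Honest.delegatedProb_eq hπ hΩ, measProb_add, ← ketNorm_sq, ketNorm_applyGates,
    Q.ketNorm_input, one_pow]

theorem prob_nonneg (θ : Fin R → ℝ) (k : Fin K) (s : Bool) : 0 ≤ Q.prob θ k s :=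
  measProb_nonneg _ _ _

theorem delegatedProb_nonneg {l d : ℕ} {Ω : Setup} (hΩ : Ω.Correct) {κ : ℕ} (θ : Fin R → ℝ)
    (k : Fin K) {π : Prep Ω κ n} (hπ : Q.HonestPrep l d θ π) (s : Bool) :
    0 ≤ Q.delegatedProb l d π θ k s := by
  rw [delegatedProb, Prep.Honest.delegatedProb_eq hπ hΩ]
  exact measProb_nonneg _ _ _

/-- The cost function computed from delegated executions converges to the exact one. -/
theorem exists_abs_delegatedCost_sub_le {l : ℕ} {ε : ℕ → ℝ} (hε0 : Tendsto ε atTop (nhds 0))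
    (hε : ∀ d, ∀ U ∈ Matrix.unitaryGroup Bool ℂ,
      ∃ c : ℂ, ‖c‖ = 1 ∧ ‖wordMat (solovayKitaev l d U) - c • U‖ ≤ ε d)
    (hf : ∀ k, Continuous (Q.f k)) (θ : Fin R → ℝ) {η : ℝ} (hη : 0 < η) :
    ∃ d₀ : ℕ, ∀ d : ℕ, d₀ ≤ d → ∀ (Ω : Setup), Ω.Correct →
      ∀ (κ : ℕ) (π : Fin K → Prep Ω κ n), (∀ k, Q.HonestPrep l d θ (π k)) →
        |Q.delegatedCost l d π θ - Q.cost θ| ≤ η := by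
  -- The denominator `K + 1` also covers an empty sum.
  have hη' : 0 < η / (K + 1) := by positivity
  have hcont := fun k => Metric.continuous_iff.1 (hf k) (expect (Q.obs k) (Q.output θ k)) _ hη'
  choose δ hδ0 hδ using hcont
  -- An expectation value is a difference of two probabilities, each off by at most `2 N ε`.
  have hlim : Tendsto (fun d => 4 * Q.numApprox * ε d) atTop (nhds 0) := by
    simpa using hε0.const_mul (4 * (Q.numApprox : ℝ))
  have hev : ∀ᶠ d in atTop, ∀ k, 4 * Q.numApprox * ε d < δ k :=
    eventually_all.2 fun k => hlim.eventually_lt_const (hδ0 k)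
  obtain ⟨d₀, hd₀⟩ := eventually_atTop.1 hev
  refine ⟨d₀, fun d hd Ω hΩ κ π hπ => ?_⟩
  rw [delegatedCost, cost, ← Finset.sum_sub_distrib]
  have hterm : ∀ k, |Q.f k ((π k).delegatedExpect (Q.gates l d θ) (Q.input k) (Q.obs k)) -
      Q.f k (expect (Q.obs k) (Q.output θ k))| ≤ η / (K + 1) := by
    intro k
    refine (hδ k _ ?_).le
    refine lt_of_le_of_lt ?_ (hd₀ d hd k)
    have h0 := Q.abs_delegatedProb_sub_le (hε d) hΩ θ k (hπ k) false
    have h1 := Q.abs_delegatedProb_sub_le (hε d) hΩ θ k (hπ k) true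
    rw [abs_le] at h0 h1
    rw [Real.dist_eq, ← measProb_sub, Prep.delegatedExpect]
    simp only [delegatedProb, prob] at h0 h1
    rw [abs_le]
    constructor <;> linarith [h0.1, h0.2, h1.1, h1.2]
  refine (Finset.abs_sum_le_sum_abs _ _).trans ((Finset.sum_le_sum fun k _ => hterm k).trans ?_)
  rw [Finset.sum_const, Finset.card_univ, Fintype.card_fin, nsmul_eq_mul, mul_div_assoc',
    div_le_iff₀ (by positivity)]
  nlinarith

end VQA

/-! ## Sequences of dependent random results -/

section Sequential

variable {α : Type*} [Fintype α]

/-- Transition weights that depend on the earlier results only and are probabilities. -/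
structure IsSequential {m : ℕ} (p : Fin m → (Fin m → α) → α → ℝ) : Prop where
  congr : ∀ t r r', (∀ s < t, r s = r' s) → p t r = p t r'
  nonneg : ∀ t r a, 0 ≤ p t r a
  sum_eq : ∀ t r, ∑ a, p t r a = 1

/-- The weights after a first result `a`. -/
def tailWeights {m : ℕ} (p : Fin (m + 1) → (Fin (m + 1) → α) → α → ℝ) (a : α) :
    Fin m → (Fin m → α) → α → ℝ :=
  fun t r => p t.succ (Fin.cons a r)

theorem IsSequential.tail {m : ℕ} {p : Fin (m + 1) → (Fin (m + 1) → α) → α → ℝ}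
    (h : IsSequential p) (a : α) : IsSequential (tailWeights p a) where
  congr t r r' hr := h.congr _ _ _ fun s hs => by
    induction s using Fin.cases with
    | zero => rfl
    | succ s => simpa using hr s (Fin.succ_lt_succ_iff.1 hs)
  nonneg t r := h.nonneg _ _
  sum_eq t r := h.sum_eq _ _

/-- The first weight depends on no earlier result, so `default` serves as an arbitrary history. -/
theorem IsSequential.prod_cons [Inhabited α] {m : ℕ} {p : Fin (m + 1) → (Fin (m + 1) → α) → α → ℝ}
    (h : IsSequential p) (a : α) (r : Fin m → α) :
    ∏ t, p t (Fin.cons a r) ((Fin.cons a r : Fin (m + 1) → α) t) =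
      p 0 default a * ∏ t, tailWeights p a t r (r t) := by
  rw [Fin.prod_univ_succ, Fin.cons_zero,
    h.congr 0 (Fin.cons a r) default fun s hs => absurd hs (Fin.not_lt_zero s)]
  rfl

theorem IsSequential.sum_prod [Inhabited α] {m : ℕ} {p : Fin m → (Fin m → α) → α → ℝ}
    (h : IsSequential p) : ∑ r : Fin m → α, ∏ t, p t r (r t) = 1 := by
  induction m with
  | zero => simp
  | succ m ih =>
    rw [sum_fin_succ_fun]
    simp only [h.prod_cons, ← Finset.mul_sum]
    rw [Finset.sum_congr rfl fun a _ => by rw [ih (h.tail a), mul_one], h.sum_eq]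

/-- Total variation distances of the single steps add up. -/
theorem IsSequential.abs_sum_sub_le [Inhabited α] {m : ℕ} {p q : Fin m → (Fin m → α) → α → ℝ}
    (hp : IsSequential p) (hq : IsSequential q) {η : ℝ}
    (hη : ∀ t r (f : α → ℝ), (∀ a, 0 ≤ f a) → (∀ a, f a ≤ 1) →
      |∑ a, f a * (p t r a - q t r a)| ≤ η)
    (f : (Fin m → α) → ℝ) (hf0 : ∀ r, 0 ≤ f r) (hf1 : ∀ r, f r ≤ 1) :
    |∑ r : Fin m → α, f r * (∏ t, p t r (r t) - ∏ t, q t r (r t))| ≤ m * η := by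
  induction m with
  | zero => simp
  | succ m ih =>
    have hIH := fun a => ih (hp.tail a) (hq.tail a) (fun t r => hη t.succ (Fin.cons a r))
      (fun r => f (Fin.cons a r)) (fun r => hf0 _) (fun r => hf1 _)
    have hH0 : ∀ a, 0 ≤ ∑ r, f (Fin.cons a r) * ∏ t, tailWeights q a t r (r t) := fun a =>
      Finset.sum_nonneg fun r _ => mul_nonneg (hf0 _)
        (Finset.prod_nonneg fun t _ => (hq.tail a).nonneg t r (r t))
    have hH1 : ∀ a, ∑ r, f (Fin.cons a r) * ∏ t, tailWeights q a t r (r t) ≤ 1 := fun a => by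
      rw [← (hq.tail a).sum_prod]
      refine Finset.sum_le_sum fun r _ => ?_
      exact mul_le_of_le_one_left
        (Finset.prod_nonneg fun t _ => (hq.tail a).nonneg t r (r t)) (hf1 _)
    -- The hybrid: first `p` is followed by the change of the later steps, then the first step is
    -- changed with later steps distributed by `q`. In the second part the conditional expectation
    -- of `f` is again a test function with values in `[0, 1]`.
    have hsplit : ∑ r, f r * (∏ t, p t r (r t) - ∏ t, q t r (r t)) =
        (∑ a, p 0 default a * ∑ r, f (Fin.cons a r) *
          (∏ t, tailWeights p a t r (r t) - ∏ t, tailWeights q a t r (r t))) +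
        ∑ a, (∑ r, f (Fin.cons a r) * ∏ t, tailWeights q a t r (r t)) *
          (p 0 default a - q 0 default a) := by
      rw [sum_fin_succ_fun, ← Finset.sum_add_distrib]
      refine Finset.sum_congr rfl fun a _ => ?_
      rw [Finset.mul_sum, Finset.sum_mul, ← Finset.sum_add_distrib]
      refine Finset.sum_congr rfl fun r _ => ?_
      rw [hp.prod_cons, hq.prod_cons]; ring
    rw [hsplit]
    refine (abs_add_le _ _).trans ?_
    have h1 : |∑ a, p 0 default a * ∑ r, f (Fin.cons a r) *
        (∏ t, tailWeights p a t r (r t) - ∏ t, tailWeights q a t r (r t))| ≤ m * η := by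
      refine (Finset.abs_sum_le_sum_abs _ _).trans ?_
      calc _ ≤ ∑ a, p 0 default a * (m * η) := Finset.sum_le_sum fun a _ => by
            rw [abs_mul, abs_of_nonneg (hp.nonneg _ _ _)]
            exact mul_le_mul_of_nonneg_left (hIH a) (hp.nonneg _ _ _)
        _ = m * η := by rw [← Finset.sum_mul, hp.sum_eq, one_mul]
    have h2 := hη 0 default _ hH0 hH1
    push_cast
    linarith

theorem isSequential_pi {E : ℕ} {u : Fin E → Bool → ℝ} (h0 : ∀ e s, 0 ≤ u e s)
    (h1 : ∀ e, u e false + u e true = 1) :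
    IsSequential (fun (e : Fin E) (_ : Fin E → Bool) => u e) where
  congr _ _ _ _ := rfl
  nonneg e _ s := h0 e s
  sum_eq e _ := by rw [Fintype.sum_bool, add_comm, h1]

/-- For two laws on two points the differences are opposite, so the total variation distance is one
of them and not their sum. -/
theorem abs_sum_bool_sub_le {u v : Bool → ℝ} (hu : u false + u true = 1)
    (hv : v false + v true = 1) {η : ℝ} (h : ∀ s, |u s - v s| ≤ η) (f : Bool → ℝ)
    (hf0 : ∀ a, 0 ≤ f a) (hf1 : ∀ a, f a ≤ 1) : |∑ a, f a * (u a - v a)| ≤ η := by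
  have e : ∑ a, f a * (u a - v a) = (f true - f false) * (u true - v true) := by
    rw [Fintype.sum_bool]
    linear_combination f false * hu - f false * hv
  rw [e, abs_mul]
  have h1 : |f true - f false| ≤ 1 := by
    rw [abs_le]; constructor <;> linarith [hf0 true, hf0 false, hf1 true, hf1 false]
  exact (mul_le_of_le_one_left (abs_nonneg _) h1).trans (h true)

end Sequential

/-! ## The training -/

namespace Training

variable {R K T E : ℕ} (τ : Training R K T E)

theorem params_congr {r r' : Fin T → Fin E → Bool} {k : ℕ}
    (h : ∀ s : Fin T, (s : ℕ) < k → r s = r' s) : τ.params r k = τ.params r' k := by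
  induction k with
  | zero => rfl
  | succ k ih =>
    rw [params, params, ih fun s hs => h s (by omega)]
    split_ifs with hk
    · rw [h ⟨k, hk⟩ (Nat.lt_succ_self k)]
    · rfl

theorem isSequential_prod {p : Fin T → Fin E → (Fin R → ℝ) → Bool → ℝ}
    (h0 : ∀ t e θ s, 0 ≤ p t e θ s) (h1 : ∀ t e θ, p t e θ false + p t e θ true = 1) :
    IsSequential fun (t : Fin T) (r : Fin T → Fin E → Bool) (a : Fin E → Bool) =>
      ∏ e, p t e (τ.params r t) (a e) where
  congr t r r' h := by
    rw [τ.params_congr (r := r) (r' := r') fun s hs => h s hs]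
  nonneg t r a := Finset.prod_nonneg fun e _ => h0 _ _ _ _
  sum_eq t r := (isSequential_pi (h0 t · (τ.params r t)) (h1 t · (τ.params r t))).sum_prod

/-- If all single executions have nearly the same law then so has the training. -/
theorem abs_prob_sub_le {p q : Fin T → Fin E → (Fin R → ℝ) → Bool → ℝ} {η : ℝ}
    (hp0 : ∀ t e θ s, 0 ≤ p t e θ s) (hp1 : ∀ t e θ, p t e θ false + p t e θ true = 1)
    (hq0 : ∀ t e θ s, 0 ≤ q t e θ s) (hq1 : ∀ t e θ, q t e θ false + q t e θ true = 1)
    (h : ∀ t e θ s, |p t e θ s - q t e θ s| ≤ η) (S : Set (Fin T → Fin E → Bool)) :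
    |τ.prob p S - τ.prob q S| ≤ T * E * η := by
  classical
  -- The hybrid bound is used twice: inside over the `E` independent executions of an iteration,
  -- outside over the `T` iterations with adaptively chosen parameters.
  have key := (τ.isSequential_prod hp0 hp1).abs_sum_sub_le (τ.isSequential_prod hq0 hq1)
    (η := E * η) (fun t r f hf0 hf1 =>
      (isSequential_pi (hp0 t · (τ.params r t)) (hp1 t · (τ.params r t))).abs_sum_sub_le
        (isSequential_pi (hq0 t · (τ.params r t)) (hq1 t · (τ.params r t)))
        (fun e _ g hg0 hg1 => abs_sum_bool_sub_le (hp1 _ _ _) (hq1 _ _ _) (h _ _ _) g hg0 hg1)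
        f hf0 hf1)
    (fun r => if r ∈ S then 1 else 0) (fun r => by split_ifs <;> norm_num)
    (fun r => by split_ifs <;> norm_num)
  rw [mul_assoc]
  convert key using 2
  rw [prob, prob, ← Finset.sum_sub_distrib]
  refine Finset.sum_congr rfl fun r _ => ?_
  by_cases hr : r ∈ S <;> simp [hr]

end Training

open scoped Matrix.Norms.L2Operator in
theorem abs_delegatedTraining_sub_le {n R K T E l d : ℕ} (Q : VQA n R K) {ε : ℝ}
    (hε : ∀ U ∈ Matrix.unitaryGroup Bool ℂ,
      ∃ c : ℂ, ‖c‖ = 1 ∧ ‖wordMat (solovayKitaev l d U) - c • U‖ ≤ ε)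
    {Ω : Setup} (hΩ : Ω.Correct) {κ : ℕ} (τ : Training R K T E)
    (π : Fin T → Fin E → (Fin R → ℝ) → Prep Ω κ n)
    (hπ : ∀ t e θ, Q.HonestPrep l d (τ.query t θ e).1 (π t e θ))
    (S : Set (Fin T → Fin E → Bool)) :
    |delegatedTraining Q τ l d π S - idealTraining Q τ S| ≤ T * E * (2 * Q.numApprox * ε) := by
  rw [delegatedTraining, idealTraining]
  apply τ.abs_prob_sub_le
  · intro t e θ s
    exact Q.delegatedProb_nonneg hΩ _ _ (hπ t e θ) s
  · intro t e θ
    exact Q.sum_delegatedProb hΩ _ _ (hπ t e θ)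
  · intro t e θ s
    exact Q.prob_nonneg _ _ s
  · intro t e θ
    exact Q.sum_prob _ _
  · intro t e θ s
    exact Q.abs_delegatedProb_sub_le hε hΩ _ _ (hπ t e θ) s

end

end DVQA

/-! ### Assembly of the main theorem -/

theorem theorem3 :
    ∃ (l₀ : ℕ) (ε : ℕ → ℝ),
      StrictAnti ε ∧
      Asymptotics.SuperpolynomialDecay atTop (fun d : ℕ => (9 : ℝ) ^ d) ε ∧
      -- homomorphic evaluation of any gate sequence is exact
      (∀ (Ω : Setup), Ω.Correct → ∀ (κ n : ℕ) (gs : List (Gate n)) (π : Prep Ω κ n),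
        π.Honest (tCount gs) → ∀ (ψ : Ket (Fin n)) (O : Fin n → Pauli) (s : Bool),
          π.delegatedProb gs ψ O s = measProb O (applyGates gs ψ) s) ∧
      ∀ l : ℕ, l₀ ≤ l →
        -- accuracy and length of the decompositions
        (∀ (d : ℕ) (U : Matrix Bool Bool ℂ), U ∈ Matrix.unitaryGroup Bool ℂ →
          (solovayKitaev l d U).length ≤ l * 9 ^ d ∧
          ∃ c : ℂ, ‖c‖ = 1 ∧
            ‖Matrix.toEuclideanCLM (n := Bool) (𝕜 := ℂ)
              (wordMat (solovayKitaev l d U) - c • U)‖ ≤ ε d) ∧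
        ∀ (n R K : ℕ) (Q : VQA n R K),
          -- the results of one execution
          (∀ (Ω : Setup), Ω.Correct → ∀ (κ d : ℕ) (θ : Fin R → ℝ) (k : Fin K) (π : Prep Ω κ n),
            Q.HonestPrep l d θ π → ∀ s : Bool,
              |Q.delegatedProb l d π θ k s - Q.prob θ k s| ≤ 2 * Q.numApprox * ε d) ∧
          -- the cost function
          ((∀ k, Continuous (Q.f k)) → ∀ (θ : Fin R → ℝ) (η : ℝ), 0 < η →
            ∃ d₀ : ℕ, ∀ d : ℕ, d₀ ≤ d →
              ∀ (Ω : Setup), Ω.Correct → ∀ (κ : ℕ) (π : Fin K → Prep Ω κ n),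
                (∀ k, Q.HonestPrep l d θ (π k)) →
                  |Q.delegatedCost l d π θ - Q.cost θ| ≤ η) ∧
          -- the training: all measurement results, and the trained parameters
          ∀ (Ω : Setup), Ω.Correct → ∀ (κ T E : ℕ) (τ : Training R K T E) (d : ℕ)
            (π : Fin T → Fin E → (Fin R → ℝ) → Prep Ω κ n),
            (∀ t e θ, Q.HonestPrep l d (τ.query t θ e).1 (π t e θ)) →
              (∀ S : Set (Fin T → Fin E → Bool),
                |delegatedTraining Q τ l d π S - idealTraining Q τ S| ≤
                  T * E * (2 * Q.numApprox * ε d)) ∧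
              (∀ P : Set (Fin R → ℝ),
                |delegatedTraining Q τ l d π {r | τ.trained r ∈ P} -
                    idealTraining Q τ {r | τ.trained r ∈ P}| ≤
                  T * E * (2 * Q.numApprox * ε d)) := by
  obtain ⟨l₀, h₀⟩ := exists_solovayKitaev_accuracy
  have hlim : Tendsto skError atTop (nhds 0) := by
    simpa using superpolynomialDecay_skError 0
  refine ⟨l₀, skError, strictAnti_skError, superpolynomialDecay_skError,
    fun Ω hΩ κ n gs π hπ ψ O s => hπ.delegatedProb_eq hΩ ψ O s, fun l hl => ?_⟩
  -- The operator norm on matrices unfolds to the norm of the associated map of Euclidean space, so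
  -- `h₀` applies as it stands.
  refine ⟨fun d U hU => ⟨solovayKitaev_length d U, h₀ l hl d U hU⟩, fun n R K Q => ?_⟩
  refine ⟨fun Ω hΩ κ d θ k π hπ s => Q.abs_delegatedProb_sub_le (h₀ l hl d) hΩ θ k hπ s,
    fun hf θ η hη => Q.exists_abs_delegatedCost_sub_le hlim (h₀ l hl) hf θ hη, ?_⟩
  intro Ω hΩ κ T E τ d π hπ
  exact ⟨fun S => abs_delegatedTraining_sub_le Q (h₀ l hl d) hΩ τ π hπ S,
    fun P => abs_delegatedTraining_sub_le Q (h₀ l hl d) hΩ τ π hπ _⟩
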